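/- **Setting (the process calculus qCCS).** Let $qVar$ and $cVar$ be countably infinite sets of quantum and classical variables, $\mathcal H=\bigotimes_{q\in qVar}\mathbb C^2$ the separable Hilbert space whose orthonormal basis vectors assign to each qubit a value in $\{0,1\}$, with value $1$ for finitely many qubits only, and, for $S\subseteq qVar$, $\mathcal H_S$ the space of the qubits in $S$, so that $\mathcal H=\mathcal H_S\otimes\mathcal H_{\overline S}$. A (partial) density operator is a positive operator $\rho$ with $\mathrm{tr}\,\rho\le 1$; a super-operator is a completely positive trace-nonincreasing linear map; one acting on $\mathcal H_S$ is extended by the identity. Let $cChan,qChan$ be sets of classical and quantum channel names, and $Chan$ their disjoint union. Processes are $$P::=\mathbf{nil}\mid A(\tilde q)\mid \tau.P\mid c?x.P\mid c!e.P\mid \mathsf c?q.P\mid \mathsf c!q.P\mid \mathcal E[\tilde q].P\mid M[\tilde q;x].P\mid P+P\mid P\|P\mid P[f]\mid P\backslash L\mid \mathbf{if}\ b\ \mathbf{then}\ P,$$ where $c\in cChan$, $\mathsf c\in qChan$, $\tilde q$ is a finite tuple of distinct quantum variables, $e$ and $b$ are real-valued and boolean-valued expressions in classical variables, $\mathcal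 E$ is a trace-preserving super-operator and $M$ a Hermitian operator on the qubits $\tilde q$, $f$ is an injective map $Chan\to Chan$ preserving $cChan$ and $qChan$, and $L\subseteq Chan$. The free quantum variables $qv(P)$ are defined as usual, $\mathsf c?q$ binding $q$; it is required that $q\notin qv(P)$ in $\mathsf c!q.P$ and $qv(P)\cap qv(Q)=\emptyset$ in $P\|Q$. Each constant scheme $A$ has one defining equation $A(\tilde q)\stackrel{def}=P$ with $qv(P)\subseteq\tilde q$ and $P$ closed. A process is closed if it has no free classical variables ($c?x$ and $M[\tilde q;x]$ bind $x$). A configuration $\langle P,\rho\rangle$ is a closed process $P$ with a nonzero partial density operator $\rho$ on $\mathcal H$. **Transitions.** $\langle P,\rho\rangle\xrightarrow{\alpha}\mu$, with $\mu$ a finitely supported probability distribution over configurations and $\alpha\in\{\tau,c?v,c!v,\mathsf c?r,\mathsf c!r\}$ ($v\in\mathbb R$, $r\in qVar$), is the smallest relation such that (a point distribution is written as its point): - $\langle\tau.P,\rho\rangle\xrightarrow{\tau}\langle P,\rho\rangle$; $\langle c?x.P,\rho\rangle\xrightarrow{c?v}\langle P\{v/x\},\rho\rangle$; $\langle c!e.P,\rho\rangle\xrightarrow{c!v}\langle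 P,\rho\rangle$ if $v$ is the value of $e$; - $\langle\mathsf c?q.P,\rho\rangle\xrightarrow{\mathsf c?r}\langle P\{r/q\},\rho\rangle$ if $r\notin qv(\mathsf c?q.P)$; $\langle\mathsf c!q.P,\rho\rangle\xrightarrow{\mathsf c!q}\langle P,\rho\rangle$; - $\langle\mathcal E[\tilde r].P,\rho\rangle\xrightarrow{\tau}\langle P,\mathcal E_{\tilde r}(\rho)\rangle$; $\langle M[\tilde r;x].P,\rho\rangle\xrightarrow{\tau}\sum_i p_i\langle P\{\lambda_i/x\},E^i_{\tilde r}\rho E^i_{\tilde r}/p_i\rangle$, where $M=\sum_i\lambda_iE^i$ is the spectral decomposition and $p_i=\mathrm{tr}(E^i_{\tilde r}\rho)/\mathrm{tr}(\rho)$ (terms with $p_i=0$ are omitted); - if one component of $P_1\|P_2$ has a transition $c?v$ (resp. $\mathsf c?r$) and the other one $c!v$ (resp. $\mathsf c!r$) at $\rho$, to $P_1'$ and $P_2'$, then $\langle P_1\|P_2,\rho\rangle\xrightarrow{\tau}\langle P_1'\|P_2',\rho\rangle$; each component may also move alone, the other one being kept, where a quantum input $\mathsf c?r$ requires that $r$ is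 not free in the other component; - $P+Q$ has the transitions of $P$ and of $Q$; $P[f]$ those of $P$ with actions relabeled by $f$ and $[f]$ kept on the targets; $P\backslash L$ those of $P$ whose channel is not in $L$, with $\backslash L$ kept on the targets; $\mathbf{if}\ b\ \mathbf{then}\ P$ those of $P$ if $b$ is true, and none otherwise; $A(\tilde r)$ those of $P\{\tilde r/\tilde q\}$ if $A(\tilde q)\stackrel{def}=P$. A relation $T$ between configurations and distributions is lifted to distributions: $\mu\,T\,\nu$ if there are $\nu_{\mathcal C}$ with $\mathcal C\,T\,\nu_{\mathcal C}$ for each $\mathcal C\in supp(\mu)$ and $\nu=\sum_{\mathcal C}\mu(\mathcal C)\nu_{\mathcal C}$. $\Rightarrow$ is the smallest relation with $\mathcal C\Rightarrow\mathcal C$, and $\mathcal C\Rightarrow\sum_ip_i\mu_i$ whenever $\mathcal C\xrightarrow{\tau}\sum_ip_i\mathcal C_i$ with distinct $\mathcal C_i$, $p_i>0$, and $\mathcal C_i\Rightarrow\mu_i$ for all $i$. $\stackrel{\hat\tau}\Rightarrow$ is $\Rightarrow$, and, for $\alpha\ne\tau$, $\stackrel{\hat\alpha}\Rightarrow$ is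 $\Rightarrow\xrightarrow{\alpha}\Rightarrow$ (lifted relations). A relation $\mathcal R$ on configurations is lifted by: $\mu\mathcal R\nu$ if there is a coupling of $\mu$ and $\nu$ supported in $\mathcal R$. $qv(\mu)$ is the union of the $qv(P)$ over $\langle P,\rho\rangle\in supp(\mu)$, and $\mathcal E(\mu)$ is the image of $\mu$ under $\langle P,\rho\rangle\mapsto\langle P,\mathcal E(\rho)\rangle$. **Bisimilarity.** A relation $\mathcal R$ on configurations is a bisimulation if $\langle P,\rho\rangle\mathcal R\langle Q,\sigma\rangle$ implies $qv(P)=qv(Q)$, $\mathrm{tr}_{qv(P)}(\rho)=\mathrm{tr}_{qv(Q)}(\sigma)$, and 1. whenever $\langle P,\rho\rangle\xrightarrow{\mathsf c?q}\mu$, there is $\nu$ with $\langle Q,\sigma\rangle\Rightarrow\xrightarrow{\mathsf c?q}\nu$ such that $\mathcal E(\mu)\mathcal R\mathcal E(\nu)$ for every super-operator $\mathcal E$ acting on $\mathcal H_{\overline{qv(\mu)-\{q\}}}$ that maps no state occurring in $\mu$ to $0$; 2. whenever $\langle P,\rho\rangle\xrightarrow{\alpha}\mu$ and $\alpha$ is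 not a quantum input, there is $\nu$ with $\langle Q,\sigma\rangle\stackrel{\hat\alpha}\Rightarrow\nu$ and $\mu\mathcal R\nu$; and the symmetric conditions with the roles of the two configurations exchanged. Write $\langle P,\rho\rangle\approx\langle Q,\sigma\rangle$ if some bisimulation relates them. **Theorem.** If $\langle P,\rho\rangle\approx\langle Q,\sigma\rangle$, then 1. $\langle P\|R,\rho\rangle\approx\langle Q\|R,\sigma\rangle$ for every closed process $R$ with $qv(R)\cap qv(P)=\emptyset$; 2. $\langle P[f],\rho\rangle\approx\langle Q[f],\sigma\rangle$ for every relabeling function $f$; 3. $\langle P\backslash L,\rho\rangle\approx\langle Q\backslash L,\sigma\rangle$ for every $L\subseteq Chan$; 4. $\langle\mathbf{if}\ b\ \mathbf{then}\ P,\rho\rangle\approx\langle\mathbf{if}\ b\ \mathbf{then}\ Q,\sigma\rangle$ for every closed boolean expression $b$. -/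

import Mathlib

open scoped ComplexOrder

noncomputable section

namespace QCCS

/-! ### Qubit systems, density operators and super-operators

Quantum variables are natural numbers, and a set of qubits indexed by `ι` has as computational
basis the finite subsets `a` of `ι` (the basis vector in which exactly the qubits of `a` are in the
state one).  For `ι = Fin n` this is the space of `n` qubits, for `ι = ℕ` it is the separable
infinite tensor product of all the qubits, with orthonormal basis indexed by `Finset ℕ`, and for a
set `T` of quantum variables `ι = T` gives the space `H_T`.  An operator is given by its matrix in
the computational basis; positive trace class operators correspond exactly to the positive
semidefinite matrices with summable diagonal. -/

/-- Matrices, in the computational basis, of operators on the qubits indexed by `ι`. -/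
abbrev Op (ι : Type) : Type := Matrix (Finset ι) (Finset ι) ℂ

/-- The trace. -/
def Op.tr {ι : Type} (A : Op ι) : ℂ := ∑' a, A a a

/-- Positive operators with finite trace. -/
def Op.IsPosTraceClass {κ : Type} (A : Matrix κ κ ℂ) : Prop :=
  A.PosSemidef ∧ Summable fun a => A a a

/-- (Partial) density operators: positive, of trace at most one. -/
def Op.IsDensity {ι : Type} (ρ : Op ι) : Prop :=
  Op.IsPosTraceClass ρ ∧ ρ.tr.re ≤ 1

/-- Complete positivity: `I ⊗ Φ` maps positive (trace class) operators to positive operators.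
Only the values of `Φ` on trace class operators matter. -/
def IsCompletelyPositive {ι : Type} (Φ : Op ι →ₗ[ℂ] Op ι) : Prop :=
  ∀ (k : ℕ) (A : Matrix (Fin k × Finset ι) (Fin k × Finset ι) ℂ), Op.IsPosTraceClass A →
    (Matrix.of fun i j : Fin k × Finset ι =>
      Φ (Matrix.of fun a b => A (i.1, a) (j.1, b)) i.2 j.2).PosSemidef

/-- Super-operators: completely positive and trace-nonincreasing. -/
def IsSuperOperator {ι : Type} (Φ : Op ι →ₗ[ℂ] Op ι) : Prop :=
  IsCompletelyPositive Φ ∧ ∀ A : Op ι, Op.IsPosTraceClass A →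
    (Summable fun a => Φ A a a) ∧ (Φ A).tr.re ≤ A.tr.re

/-- Trace preservation. -/
def IsTracePreserving {ι : Type} (Φ : Op ι →ₗ[ℂ] Op ι) : Prop :=
  ∀ A : Op ι, Op.IsPosTraceClass A → (Φ A).tr = A.tr

/-- The trace-preserving super-operators on `n` qubits. -/
def TPSuperOperator (n : ℕ) : Type :=
  {Φ : Op (Fin n) →ₗ[ℂ] Op (Fin n) // IsSuperOperator Φ ∧ IsTracePreserving Φ}

/-- The Hermitian operators on `n` qubits. -/
def Observable (n : ℕ) : Type := {M : Op (Fin n) // M.IsHermitian}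

/-- The projector to the eigenspace of `M` for `t` (zero if `t` is not an eigenvalue). -/
def Observable.proj {n : ℕ} (M : Observable n) (t : ℝ) : Op (Fin n) :=
  (M.2.eigenvectorUnitary : Op (Fin n)) *
    Matrix.diagonal (fun a => if M.2.eigenvalues a = t then (1 : ℂ) else 0) *
    star (M.2.eigenvectorUnitary : Op (Fin n))

/-- The values in `x` of the qubits `e i`. -/
def readAt {ι : Type} (e : ι ↪ ℕ) (x : Finset ℕ) : Finset ι :=
  x.preimage e e.injective.injOn

open Classical in
/-- The basis vector `x` with the values of the qubits `e i` replaced by those in `a`. -/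
def writeAt {ι : Type} (e : ι ↪ ℕ) (a : Finset ι) (x : Finset ℕ) : Finset ℕ :=
  x.filter (fun q => q ∉ Set.range e) ∪ a.map e

/-- `Φ ⊗ I` applied to `ρ`, where `Φ` acts on the qubits `e i` and `I` is the identity map on the
operators of all the other qubits. -/
def applyAt {ι : Type} (e : ι ↪ ℕ) (Φ : Op ι →ₗ[ℂ] Op ι) (ρ : Op ℕ) : Op ℕ :=
  Matrix.of fun x y =>
    Φ (Matrix.of fun a b => ρ (writeAt e a x) (writeAt e b y)) (readAt e x) (readAt e y)

/-- The partial trace `tr_S`, an operator on the qubits outside `S`. -/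
def partialTrace (S : Finset ℕ) (ρ : Op ℕ) : Op {q : ℕ // q ∉ S} :=
  Matrix.of fun y z => ∑ a ∈ S.powerset,
    ρ (a ∪ y.map (Function.Embedding.subtype _)) (a ∪ z.map (Function.Embedding.subtype _))

/-- The probability `tr(E ρ) / tr(ρ)` of the outcome `t` when `M` is measured on the qubits `r i`
in the state `ρ`, where `E` is the eigenprojector for `t`. -/
def measProb {n : ℕ} (M : Observable n) (r : Fin n ↪ ℕ) (ρ : Op ℕ) (t : ℝ) : ℝ :=
  ((applyAt r (LinearMap.mulLeft ℂ (M.proj t)) ρ).tr / ρ.tr).re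

/-- The state `E ρ E / p` after the outcome `t`, where `p` is the probability of `t`. -/
def measState {n : ℕ} (M : Observable n) (r : Fin n ↪ ℕ) (ρ : Op ℕ) (t : ℝ) : Op ℕ :=
  ((measProb M r ρ t : ℂ))⁻¹ •
    applyAt r (LinearMap.mulLeft ℂ (M.proj t) ∘ₗ LinearMap.mulRight ℂ (M.proj t)) ρ

/-! ### Syntax -/

/-- Expressions with values in `α` over real variables (which are indexed by natural numbers): a
finite set of free variables together with a value that depends only on those. -/
structure Exp (α : Type) where
  vars : Finset ℕ
  eval : (ℕ → ℝ) → α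
  eval_congr : ∀ s t : ℕ → ℝ, (∀ x ∈ vars, s x = t x) → eval s = eval t

/-- Substitution of the value `v` for the variable `x`. -/
def Exp.subst {α : Type} (e : Exp α) (x : ℕ) (v : ℝ) : Exp α where
  vars := e.vars.erase x
  eval s := e.eval (Function.update s x v)
  eval_congr s t h := by
    refine e.eval_congr _ _ fun y hy => ?_
    by_cases hxy : y = x
    · subst hxy; simp
    · simp [Function.update_of_ne hxy, h y (Finset.mem_erase.2 ⟨hxy, hy⟩)]

/-- The value of a closed expression. -/
def Exp.value {α : Type} (e : Exp α) : α := e.eval fun _ => 0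

/-- The classical and quantum channel names and the process constant schemes with their arities. -/
structure Signature where
  cChan : Type*
  qChan : Type*
  Const : Type*
  ar : Const → ℕ

/-- All channel names. -/
abbrev Signature.Chan (S : Signature) := S.cChan ⊕ S.qChan

/-- One-to-one functions on `Chan` that map `cChan` to `cChan` and `qChan` to `qChan`. -/
structure Relabeling (S : Signature) where
  onC : S.cChan ↪ S.cChan
  onQ : S.qChan ↪ S.qChan

/-- Process terms; the side conditions on quantum variables are in `Proc.Valid`. -/
inductive Proc (S : Signature)
  /-- `nil` -/
  | nil : Proc S
  /-- `A(q₁,…,qₙ)` -/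
  | const (A : S.Const) (q : Fin (S.ar A) → ℕ) : Proc S
  /-- `τ.P` -/
  | tau (P : Proc S) : Proc S
  /-- `c?x.P` for a classical channel `c` -/
  | cin (c : S.cChan) (x : ℕ) (P : Proc S) : Proc S
  /-- `c!e.P` for a classical channel `c` -/
  | cout (c : S.cChan) (e : Exp ℝ) (P : Proc S) : Proc S
  /-- `c?q.P` for a quantum channel `c` -/
  | qin (c : S.qChan) (q : ℕ) (P : Proc S) : Proc S
  /-- `c!q.P` for a quantum channel `c` -/
  | qout (c : S.qChan) (q : ℕ) (P : Proc S) : Proc S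
  /-- `E[q₁,…,qₙ].P` -/
  | oper {n : ℕ} (E : TPSuperOperator n) (q : Fin n → ℕ) (P : Proc S) : Proc S
  /-- `M[q₁,…,qₙ;x].P` -/
  | meas {n : ℕ} (M : Observable n) (q : Fin n → ℕ) (x : ℕ) (P : Proc S) : Proc S
  /-- `P + Q` -/
  | sum (P Q : Proc S) : Proc S
  /-- `P ‖ Q` -/
  | par (P Q : Proc S) : Proc S
  /-- `P[f]` -/
  | relabel (P : Proc S) (f : Relabeling S) : Proc S
  /-- `P \ L` -/
  | restrict (P : Proc S) (L : Set S.Chan) : Proc S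
  /-- `if b then P` -/
  | cond (b : Exp Bool) (P : Proc S) : Proc S

namespace Proc

variable {S : Signature}

/-- Free quantum variables. -/
def qv : Proc S → Finset ℕ
  | nil => ∅
  | const _ q => Finset.univ.image q
  | tau P => P.qv
  | cin _ _ P => P.qv
  | cout _ _ P => P.qv
  | qin _ q P => P.qv.erase q
  | qout _ q P => insert q P.qv
  | oper _ q P => P.qv ∪ Finset.univ.image q
  | meas _ q _ P => P.qv ∪ Finset.univ.image q
  | sum P Q => P.qv ∪ Q.qv
  | par P Q => P.qv ∪ Q.qv
  | relabel P _ => P.qv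
  | restrict P _ => P.qv
  | cond _ P => P.qv

/-- The formation rules for quantum processes: tuples of quantum variables are distinct, an output
qubit is not used afterwards, and parallel components share no quantum variable. -/
def Valid : Proc S → Prop
  | nil => True
  | const _ q => Function.Injective q
  | tau P => P.Valid
  | cin _ _ P => P.Valid
  | cout _ _ P => P.Valid
  | qin _ _ P => P.Valid
  | qout _ q P => q ∉ P.qv ∧ P.Valid
  | oper _ q P => Function.Injective q ∧ P.Valid
  | meas _ q _ P => Function.Injective q ∧ P.Valid
  | sum P Q => P.Valid ∧ Q.Valid
  | par P Q => Disjoint P.qv Q.qv ∧ P.Valid ∧ Q.Valid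
  | relabel P _ => P.Valid
  | restrict P _ => P.Valid
  | cond _ P => P.Valid

/-- Free classical variables; classical input and measurement bind their variable. -/
def fv : Proc S → Finset ℕ
  | nil => ∅
  | const _ _ => ∅
  | tau P => P.fv
  | cin _ x P => P.fv.erase x
  | cout _ e P => e.vars ∪ P.fv
  | qin _ _ P => P.fv
  | qout _ _ P => P.fv
  | oper _ _ P => P.fv
  | meas _ _ x P => P.fv.erase x
  | sum P Q => P.fv ∪ Q.fv
  | par P Q => P.fv ∪ Q.fv
  | relabel P _ => P.fv
  | restrict P _ => P.fv
  | cond b P => b.vars ∪ P.fv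

/-- `P{v/x}` for a classical variable `x` and a value `v`. -/
def csubst : Proc S → ℕ → ℝ → Proc S
  | nil, _, _ => nil
  | const A q, _, _ => const A q
  | tau P, x, v => tau (P.csubst x v)
  | cin c y P, x, v => cin c y (if y = x then P else P.csubst x v)
  | cout c e P, x, v => cout c (e.subst x v) (P.csubst x v)
  | qin c q P, x, v => qin c q (P.csubst x v)
  | qout c q P, x, v => qout c q (P.csubst x v)
  | oper E q P, x, v => oper E q (P.csubst x v)
  | meas M q y P, x, v => meas M q y (if y = x then P else P.csubst x v)
  | sum P Q, x, v => sum (P.csubst x v) (Q.csubst x v)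
  | par P Q, x, v => par (P.csubst x v) (Q.csubst x v)
  | relabel P f, x, v => relabel (P.csubst x v) f
  | restrict P L, x, v => restrict (P.csubst x v) L
  | cond b P, x, v => cond (b.subst x v) (P.csubst x v)

/-- A name for a bound quantum variable `q` that is not in the finite set `A`: `q` itself if
possible, and otherwise the successor of the maximum of `A`. -/
def freshen (A : Finset ℕ) (q : ℕ) : ℕ := if q ∈ A then A.sup id + 1 else q

/-- Simultaneous capture-avoiding substitution of the quantum variables `s q` for the free
quantum variables `q`. -/
def qsubst : Proc S → (ℕ → ℕ) → Proc S
  | nil, _ => nil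
  | const A q, s => const A (s ∘ q)
  | tau P, s => tau (P.qsubst s)
  | cin c x P, s => cin c x (P.qsubst s)
  | cout c e P, s => cout c e (P.qsubst s)
  | qin c q P, s =>
      qin c (freshen ((P.qv.erase q).image s) q)
        (P.qsubst (Function.update s q (freshen ((P.qv.erase q).image s) q)))
  | qout c q P, s => qout c (s q) (P.qsubst s)
  | oper E q P, s => oper E (s ∘ q) (P.qsubst s)
  | meas M q x P, s => meas M (s ∘ q) x (P.qsubst s)
  | sum P Q, s => sum (P.qsubst s) (Q.qsubst s)
  | par P Q, s => par (P.qsubst s) (Q.qsubst s)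
  | relabel P f, s => relabel (P.qsubst s) f
  | restrict P L, s => restrict (P.qsubst s) L
  | cond b P, s => cond b (P.qsubst s)

end Proc

/-- The defining equations `A(q₁,…,qₙ) = P`, one for each constant scheme, where `P` is a process
without free classical variables and with `qv(P) ⊆ {q₁,…,qₙ}`. -/
structure Equations (S : Signature) where
  params : (A : S.Const) → Fin (S.ar A) → ℕ
  body : S.Const → Proc S
  params_injective : ∀ A, Function.Injective (params A)
  body_valid : ∀ A, (body A).Valid
  body_qv : ∀ A, ∀ q ∈ (body A).qv, q ∈ Set.range (params A)
  body_closed : ∀ A, (body A).fv = ∅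

/-- The body of `A` with the actual parameters `r` substituted for the formal ones. -/
def Equations.unfold {S : Signature} (D : Equations S) (A : S.Const) (r : Fin (S.ar A) → ℕ) :
    Proc S :=
  (D.body A).qsubst (Function.extend (D.params A) r id)

/-! ### Operational semantics -/

/-- Pairs of a process term and an operator on the space of all the qubits. -/
@[ext] structure Config (S : Signature) where
  proc : Proc S
  state : Op ℕ

/-- The set `Con` of configurations: closed quantum processes with a nonzero (partial) density
operator. -/
def Config.IsCon {S : Signature} (C : Config S) : Prop :=
  C.proc.Valid ∧ C.proc.fv = ∅ ∧ C.state.IsDensity ∧ C.state ≠ 0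

/-- Actions. -/
inductive Act (S : Signature)
  | tau : Act S
  | cin (c : S.cChan) (v : ℝ) : Act S
  | cout (c : S.cChan) (v : ℝ) : Act S
  | qin (c : S.qChan) (r : ℕ) : Act S
  | qout (c : S.qChan) (r : ℕ) : Act S

namespace Act

variable {S : Signature}

/-- Quantum inputs. -/
def IsQIn : Act S → Prop
  | qin _ _ => True
  | _ => False

/-- The set of the channel names of an action. -/
def cn : Act S → Set S.Chan
  | tau => ∅
  | cin c _ => {Sum.inl c}
  | cout c _ => {Sum.inl c}
  | qin c _ => {Sum.inr c}
  | qout c _ => {Sum.inr c}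

/-- Relabeling of an action. -/
def relabel (f : Relabeling S) : Act S → Act S
  | tau => tau
  | cin c v => cin (f.onC c) v
  | cout c v => cout (f.onC c) v
  | qin c r => qin (f.onQ c) r
  | qout c r => qout (f.onQ c) r

/-- The string of visible actions of an action. -/
def hat : Act S → List (Act S)
  | tau => []
  | a => [a]

end Act

/-- Apply a function to the process component of a configuration. -/
def Config.mapProc {S : Signature} (g : Proc S → Proc S) (C : Config S) : Config S :=
  ⟨g C.proc, C.state⟩

/-- The transition relation: the smallest relation closed under the inference rules. All the
distributions that it produces have finite support. -/
inductive Step {S : Signature} (D : Equations S) :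
    Config S → Act S → PMF (Config S) → Prop
  | tau (P ρ) : Step D ⟨.tau P, ρ⟩ .tau (PMF.pure ⟨P, ρ⟩)
  | cinp (c x P ρ v) : Step D ⟨.cin c x P, ρ⟩ (.cin c v) (PMF.pure ⟨P.csubst x v, ρ⟩)
  | coutp (c e P ρ) : Step D ⟨.cout c e P, ρ⟩ (.cout c e.value) (PMF.pure ⟨P, ρ⟩)
  | ccom_left {P₁ P₂ P₁' P₂' ρ c v} :
      Step D ⟨P₁, ρ⟩ (.cin c v) (PMF.pure ⟨P₁', ρ⟩) →
      Step D ⟨P₂, ρ⟩ (.cout c v) (PMF.pure ⟨P₂', ρ⟩) →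
      Step D ⟨.par P₁ P₂, ρ⟩ .tau (PMF.pure ⟨.par P₁' P₂', ρ⟩)
  | ccom_right {P₁ P₂ P₁' P₂' ρ c v} :
      Step D ⟨P₁, ρ⟩ (.cout c v) (PMF.pure ⟨P₁', ρ⟩) →
      Step D ⟨P₂, ρ⟩ (.cin c v) (PMF.pure ⟨P₂', ρ⟩) →
      Step D ⟨.par P₁ P₂, ρ⟩ .tau (PMF.pure ⟨.par P₁' P₂', ρ⟩)
  | qinp (c q P ρ r) : r ∉ (Proc.qin c q P).qv →
      Step D ⟨.qin c q P, ρ⟩ (.qin c r) (PMF.pure ⟨P.qsubst (Function.update id q r), ρ⟩)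
  | qoutp (c q P ρ) : Step D ⟨.qout c q P, ρ⟩ (.qout c q) (PMF.pure ⟨P, ρ⟩)
  | qcom_left {P₁ P₂ P₁' P₂' ρ c r} :
      Step D ⟨P₁, ρ⟩ (.qin c r) (PMF.pure ⟨P₁', ρ⟩) →
      Step D ⟨P₂, ρ⟩ (.qout c r) (PMF.pure ⟨P₂', ρ⟩) →
      Step D ⟨.par P₁ P₂, ρ⟩ .tau (PMF.pure ⟨.par P₁' P₂', ρ⟩)
  | qcom_right {P₁ P₂ P₁' P₂' ρ c r} :
      Step D ⟨P₁, ρ⟩ (.qout c r) (PMF.pure ⟨P₁', ρ⟩) →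
      Step D ⟨P₂, ρ⟩ (.qin c r) (PMF.pure ⟨P₂', ρ⟩) →
      Step D ⟨.par P₁ P₂, ρ⟩ .tau (PMF.pure ⟨.par P₁' P₂', ρ⟩)
  | oper {n : ℕ} (E : TPSuperOperator n) (r : Fin n → ℕ) (hr : Function.Injective r) (P ρ) :
      Step D ⟨.oper E r P, ρ⟩ .tau (PMF.pure ⟨P, applyAt ⟨r, hr⟩ E.1 ρ⟩)
  /- The weight `w t` is zero unless `t` is an eigenvalue of `M`. -/
  | meas {n : ℕ} (M : Observable n) (r : Fin n → ℕ) (hr : Function.Injective r) (x P ρ)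
      (w : PMF ℝ) (hw : ∀ t, w t = ENNReal.ofReal (measProb M ⟨r, hr⟩ ρ t)) :
      Step D ⟨.meas M r x P, ρ⟩ .tau
        (w.map fun t => ⟨P.csubst x t, measState M ⟨r, hr⟩ ρ t⟩)
  | inp_int_left {P₁ P₂ P₁' ρ c r} :
      Step D ⟨P₁, ρ⟩ (.qin c r) (PMF.pure ⟨P₁', ρ⟩) → r ∉ P₂.qv →
      Step D ⟨.par P₁ P₂, ρ⟩ (.qin c r) (PMF.pure ⟨.par P₁' P₂, ρ⟩)
  | inp_int_right {P₁ P₂ P₂' ρ c r} :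
      Step D ⟨P₂, ρ⟩ (.qin c r) (PMF.pure ⟨P₂', ρ⟩) → r ∉ P₁.qv →
      Step D ⟨.par P₁ P₂, ρ⟩ (.qin c r) (PMF.pure ⟨.par P₁ P₂', ρ⟩)
  | oth_int_left {P₁ P₂ ρ α μ} :
      Step D ⟨P₁, ρ⟩ α μ → ¬ α.IsQIn →
      Step D ⟨.par P₁ P₂, ρ⟩ α (μ.map (Config.mapProc fun P' => .par P' P₂))
  | oth_int_right {P₁ P₂ ρ α μ} :
      Step D ⟨P₂, ρ⟩ α μ → ¬ α.IsQIn →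
      Step D ⟨.par P₁ P₂, ρ⟩ α (μ.map (Config.mapProc fun P' => .par P₁ P'))
  | sum_left {P Q ρ α μ} : Step D ⟨P, ρ⟩ α μ → Step D ⟨.sum P Q, ρ⟩ α μ
  | sum_right {P Q ρ α μ} : Step D ⟨Q, ρ⟩ α μ → Step D ⟨.sum P Q, ρ⟩ α μ
  | rel {P f ρ α μ} : Step D ⟨P, ρ⟩ α μ →
      Step D ⟨.relabel P f, ρ⟩ (α.relabel f) (μ.map (Config.mapProc fun P' => .relabel P' f))
  | res {P L ρ α μ} : Step D ⟨P, ρ⟩ α μ → Disjoint α.cn L →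
      Step D ⟨.restrict P L, ρ⟩ α (μ.map (Config.mapProc fun P' => .restrict P' L))
  | cho {b P ρ α μ} : Step D ⟨P, ρ⟩ α μ → b.value = true →
      Step D ⟨.cond b P, ρ⟩ α μ
  | unfold {A r ρ α μ} : Step D ⟨D.unfold A r, ρ⟩ α μ → Step D ⟨.const A r, ρ⟩ α μ

section

variable {S : Signature}

/-- The lifting of transitions to distributions. -/
def LiftTrans (T : Config S → PMF (Config S) → Prop) (μ ν : PMF (Config S)) : Prop :=
  ∃ f : Config S → PMF (Config S), (∀ C ∈ μ.support, T C (f C)) ∧ ν = μ.bind f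

/-- The weak transition `C ⇒ μ`. -/
inductive WeakStep (D : Equations S) : Config S → PMF (Config S) → Prop
  | refl (C) : WeakStep D C (PMF.pure C)
  | step {C μ} (f : Config S → PMF (Config S)) :
      Step D C .tau μ → (∀ C' ∈ μ.support, WeakStep D C' (f C')) → WeakStep D C (μ.bind f)

/-- The weak transition of distributions along a string of actions. -/
def WeakTrans (D : Equations S) : PMF (Config S) → List (Act S) → PMF (Config S) → Prop
  | μ, [], ν => LiftTrans (WeakStep D) μ ν
  | μ, α :: s, ν => ∃ μ₁ ν₁, LiftTrans (WeakStep D) μ μ₁ ∧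
      LiftTrans (fun C => Step D C α) μ₁ ν₁ ∧ WeakTrans D ν₁ s ν

/-- A weak silent transition followed by an `α`-transition. -/
def WeakThen (D : Equations S) (α : Act S) (C : Config S) (ν : PMF (Config S)) : Prop :=
  ∃ μ₁, WeakStep D C μ₁ ∧ LiftTrans (fun C => Step D C α) μ₁ ν

/-! ### Bisimulation -/

/-- The lifting of a relation to distributions through a weight function. -/
def LiftRel (R : Config S → Config S → Prop) (μ ν : PMF (Config S)) : Prop :=
  ∃ δ : Config S → Config S → ENNReal,
    (∀ C, ∑' C', δ C C' = μ C) ∧ (∀ C', ∑' C, δ C C' = ν C') ∧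
    ∀ C C', 0 < δ C C' → R C C'

/-- The free quantum variables of a distribution. -/
def distQv (μ : PMF (Config S)) : Set ℕ := ⋃ C ∈ μ.support, (C.proc.qv : Set ℕ)

/-- A super-operator on the qubits in `T`, applied to the state of a configuration. -/
def Config.applyOn (T : Set ℕ) (Φ : Op T →ₗ[ℂ] Op T) (C : Config S) : Config S :=
  ⟨C.proc, applyAt (Function.Embedding.subtype _) Φ C.state⟩

/-- `E(μ) R E(ν)` for every super-operator `E` that acts on the qubits outside `V` and for which
the distribution `E(κ)` lives on configurations, that is, on nonzero states. -/
def RelUnderSuperOps (R : Config S → Config S → Prop) (V : Set ℕ) (κ μ ν : PMF (Config S)) :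
    Prop :=
  ∀ Φ : Op ↥(Vᶜ) →ₗ[ℂ] Op ↥(Vᶜ), IsSuperOperator Φ →
    (∀ C ∈ κ.support, (C.applyOn Vᶜ Φ).state ≠ 0) →
    LiftRel R (μ.map (Config.applyOn Vᶜ Φ)) (ν.map (Config.applyOn Vᶜ Φ))

/-- Bisimulations. -/
def IsBisimulation (D : Equations S) (R : Config S → Config S → Prop) : Prop :=
  ∀ C C' : Config S, R C C' →
    C.IsCon ∧ C'.IsCon ∧
    C.proc.qv = C'.proc.qv ∧
    partialTrace C.proc.qv C.state = partialTrace C.proc.qv C'.state ∧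
    (∀ c q μ, Step D C (.qin c q) μ →
      ∃ ν, WeakThen D (.qin c q) C' ν ∧ RelUnderSuperOps R (distQv μ \ {q}) μ μ ν) ∧
    (∀ α μ, ¬ α.IsQIn → Step D C α μ →
      ∃ ν, WeakTrans D (PMF.pure C') α.hat ν ∧ LiftRel R μ ν) ∧
    (∀ c q ν, Step D C' (.qin c q) ν →
      ∃ μ, WeakThen D (.qin c q) C μ ∧ RelUnderSuperOps R (distQv ν \ {q}) ν μ ν) ∧
    (∀ α ν, ¬ α.IsQIn → Step D C' α ν →
      ∃ μ, WeakTrans D (PMF.pure C) α.hat μ ∧ LiftRel R μ ν)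

/-- Bisimilarity of configurations. -/
def Bisimilar (D : Equations S) (C C' : Config S) : Prop :=
  ∃ R : Config S → Config S → Prop, IsBisimulation D R ∧ R C C'

end

end QCCS

end

/-! Relabeling, restriction and conditionals act on the process alone, so there a bisimulation is
transported pair by pair (`bisimilar_context`, `Bisimilar.cond`). The substance lies in parallel
composition: `R` may apply super-operators and measurements to its own qubits, so bisimilarity of
`⟨P, ρ⟩` and `⟨Q, σ⟩` has to survive every operation outside `qv(P)`. The definition of a
bisimulation demands this only after a quantum input; `Bisimilar.external` proves it in general.

To this end, the pairs `⟨P, G ρ⟩`, `⟨Q, G σ⟩` obtained from bisimilar ones by a positive multiple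
`G` of a super-operator outside `qv(P)` are shown to form a bisimulation (`ExtRel.halfSim`).
Positive multiples are admitted because post-measurement states are renormalized. Three facts carry
the argument.

Transitions depend on the state only through the operation or measurement performed (`Step.form`),
and `G` commutes with whatever happens on the qubits of the process (`External.comm`). Hence
transitions at `ρ` and at `G ρ` correspond.

`G` need not preserve traces. A measurement branch with probability `p_i` and state `ρ_i` reappears
after `G` with probability `p_i tr(G ρ_i) / tr(G ρ)`. The distribution reached from `G ρ` is
therefore not an image of the one reached from `ρ` but a reweighting of it, followed by
normalization of the states (`Tilt`); `WeakStep.tilt` propagates this along weak transitions.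

Bisimilar configurations have equal partial traces, so `G` gives them equal traces
(`Bisimilar.trR_eq`). The reweighting density thus agrees on matched pairs, and a coupling can
itself be reweighted (`Tilt.liftRel`).

Given this closure, composing bisimilar configurations with the same `R` yields a bisimulation
(`ParRel.halfSim`). Moves of `P` and communications are answered through the moves of `Q`. Moves of
`R` are copied: its super-operators are covered by `Bisimilar.external`, and its measurements have
equal probabilities on both sides and bisimilar outcomes by `Bisimilar.measState`. -/

noncomputable section

namespace QCCS

/-! ### Expectations of finitely or countably supported distributions -/

section Expect

variable {α β : Type*}

/-- The expectation of a nonnegative function. -/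
def expect (μ : PMF α) (h : α → ENNReal) : ENNReal := ∑' a, μ a * h a

theorem expect_pure (a : α) (h : α → ENNReal) : expect (PMF.pure a) h = h a := by
  classical
  unfold expect
  rw [tsum_eq_single a]
  · simp
  · intro b hb; simp [PMF.pure_apply, hb]

theorem expect_bind (μ : PMF α) (f : α → PMF β) (h : β → ENNReal) :
    expect (μ.bind f) h = expect μ fun a => expect (f a) h := by
  simp only [expect, PMF.bind_apply, ← ENNReal.tsum_mul_left, ← ENNReal.tsum_mul_right]
  rw [ENNReal.tsum_comm]
  simp only [mul_assoc]

theorem expect_map (μ : PMF α) (f : α → β) (h : β → ENNReal) :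
    expect (μ.map f) h = expect μ fun a => h (f a) := by
  rw [← PMF.bind_pure_comp, expect_bind]
  simp [expect_pure]

theorem expect_congr {μ : PMF α} {h k : α → ENNReal} (H : ∀ a ∈ μ.support, h a = k a) :
    expect μ h = expect μ k := by
  refine tsum_congr fun a => ?_
  by_cases ha : a ∈ μ.support
  · rw [H a ha]
  · rw [(μ.apply_eq_zero_iff a).2 ha]; simp

theorem expect_one (μ : PMF α) : expect μ (fun _ => 1) = 1 := by
  simp [expect, μ.tsum_coe]

open Classical in
theorem expect_ite_eq (μ : PMF α) (a : α) : expect μ (fun b => if b = a then 1 else 0) = μ a := by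
  unfold expect
  rw [tsum_eq_single a] <;> simp +contextual

theorem expect_eq_zero_iff {μ : PMF α} {h : α → ENNReal} :
    expect μ h = 0 ↔ ∀ a ∈ μ.support, h a = 0 := by
  simp only [expect, ENNReal.tsum_eq_zero, mul_eq_zero, PMF.mem_support_iff]
  exact forall_congr' fun a => or_iff_not_imp_left

theorem pmf_ext_expect {μ ν : PMF α} (h : ∀ k, expect μ k = expect ν k) : μ = ν := by
  classical
  ext a
  rw [← expect_ite_eq, ← expect_ite_eq, h]

theorem exists_pmf (f : α → ENNReal) (h : ∑' a, f a = 1) : ∃ p : PMF α, ∀ a, p a = f a :=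
  ⟨⟨f, h ▸ ENNReal.summable.hasSum⟩, fun _ => rfl⟩

/-- Tilting a distribution by a density `g` of finite nonzero mean. -/
theorem exists_tilt (μ : PMF α) (g : α → ENNReal) (h0 : expect μ g ≠ 0) (ht : expect μ g ≠ ⊤) :
    ∃ ν : PMF α, (∀ h, expect μ g * expect ν h = expect μ fun a => g a * h a) ∧
      ∀ a ∈ ν.support, a ∈ μ.support ∧ g a ≠ 0 := by
  have hc := ENNReal.mul_inv_cancel h0 ht
  obtain ⟨ν, hν⟩ := exists_pmf (fun a => μ a * g a * (expect μ g)⁻¹)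
    (by rw [ENNReal.tsum_mul_right]; exact hc)
  refine ⟨ν, fun h => ?_, fun a ha => ?_⟩
  · change expect μ g * (∑' a, ν a * h a) = ∑' a, μ a * (g a * h a)
    rw [← ENNReal.tsum_mul_left]
    refine tsum_congr fun a => ?_
    rw [hν]
    calc _ = μ a * (g a * h a) * (expect μ g * (expect μ g)⁻¹) := by ring
      _ = _ := by rw [hc, mul_one]
  · rw [PMF.mem_support_iff, hν] at ha
    exact ⟨fun h => ha (by simp [h]), fun h => ha (by simp [h])⟩

end Expect

/-! ### Lifted relations -/

section Lift

universe u v w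
variable {S : Signature.{u, v, w}}

/-- A weight function is the mass function of a joint distribution with the prescribed marginals.
The `PMF` form is the one that can be mapped and reweighted. -/
theorem liftRel_of_coupling {R : Config S → Config S → Prop} {μ ν : PMF (Config S)}
    (π : PMF (Config S × Config S)) (h1 : π.map Prod.fst = μ) (h2 : π.map Prod.snd = ν)
    (hR : ∀ p ∈ π.support, R p.1 p.2) : LiftRel R μ ν := by
  classical
  refine ⟨fun C C' => π (C, C'), fun C => ?_, fun C' => ?_, fun C C' h => hR (C, C') h.ne'⟩
  · rw [← h1, PMF.map_apply, ENNReal.tsum_prod', eq_comm, tsum_eq_single C]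
    · simp
    · intro b hb; simp [hb.symm]
  · rw [← h2, PMF.map_apply, ENNReal.tsum_prod', ENNReal.tsum_comm, eq_comm, tsum_eq_single C']
    · simp
    · intro b hb; simp [hb.symm]

theorem LiftRel.exists_coupling {R : Config S → Config S → Prop} {μ ν : PMF (Config S)}
    (h : LiftRel R μ ν) : ∃ π : PMF (Config S × Config S),
      π.map Prod.fst = μ ∧ π.map Prod.snd = ν ∧ ∀ p ∈ π.support, R p.1 p.2 := by
  classical
  obtain ⟨δ, h1, h2, h3⟩ := h
  have hs : ∑' p : Config S × Config S, δ p.1 p.2 = 1 := by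
    rw [ENNReal.tsum_prod']; simp only [h1]; exact μ.tsum_coe
  obtain ⟨π, hπ⟩ := exists_pmf _ hs
  refine ⟨π, ?_, ?_, fun p hp => ?_⟩
  · ext C
    rw [PMF.map_apply, ENNReal.tsum_prod', tsum_eq_single C]
    · simpa [hπ] using h1 C
    · intro b hb; simp [hb.symm]
  · ext C
    rw [PMF.map_apply, ENNReal.tsum_prod', ENNReal.tsum_comm, tsum_eq_single C]
    · simpa [hπ] using h2 C
    · intro b hb; simp [hb.symm]
  · exact h3 _ _ (pos_iff_ne_zero.2 (hπ p ▸ hp))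

theorem LiftRel.mono {R T : Config S → Config S → Prop} {μ ν : PMF (Config S)}
    (h : LiftRel R μ ν) (hRT : ∀ C C', R C C' → T C C') : LiftRel T μ ν := by
  obtain ⟨δ, h1, h2, h3⟩ := h
  exact ⟨δ, h1, h2, fun C C' h => hRT _ _ (h3 _ _ h)⟩

theorem LiftRel.symm {R : Config S → Config S → Prop} {μ ν : PMF (Config S)}
    (h : LiftRel R μ ν) : LiftRel (fun C C' => R C' C) ν μ := by
  obtain ⟨δ, h1, h2, h3⟩ := h
  exact ⟨fun C C' => δ C' C, h2, h1, fun C C' h => h3 _ _ h⟩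

theorem liftRel_map {R T : Config S → Config S → Prop} {μ ν : PMF (Config S)}
    {g k : Config S → Config S} (h : LiftRel R μ ν)
    (H : ∀ C ∈ μ.support, ∀ C' ∈ ν.support, R C C' → T (g C) (k C')) :
    LiftRel T (μ.map g) (ν.map k) := by
  obtain ⟨π, rfl, rfl, h3⟩ := h.exists_coupling
  refine liftRel_of_coupling (π.map (Prod.map g k)) ?_ ?_ fun p hp => ?_
  · simp only [PMF.map_comp]; rfl
  · simp only [PMF.map_comp]; rfl
  · rw [PMF.mem_support_map_iff] at hp
    obtain ⟨q, hq, rfl⟩ := hp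
    refine H _ ?_ _ ?_ (h3 q hq)
    · rw [PMF.mem_support_map_iff]; exact ⟨q, hq, rfl⟩
    · rw [PMF.mem_support_map_iff]; exact ⟨q, hq, rfl⟩

/-- The only coupling with a point distribution is the product. For transitions to a point it
therefore suffices to follow the support of the answer, without its weights. -/
theorem liftRel_pure_left {R : Config S → Config S → Prop} {C : Config S} {ν : PMF (Config S)} :
    LiftRel R (PMF.pure C) ν ↔ ∀ C' ∈ ν.support, R C C' := by
  constructor
  · intro h C' hC'
    obtain ⟨π, h1, rfl, h3⟩ := h.exists_coupling
    rw [PMF.mem_support_map_iff] at hC'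
    obtain ⟨p, hp, rfl⟩ := hC'
    have : p.1 ∈ (π.map Prod.fst).support := by
      rw [PMF.mem_support_map_iff]; exact ⟨p, hp, rfl⟩
    rw [h1, PMF.mem_support_pure_iff] at this
    exact this ▸ h3 p hp
  · intro h
    refine liftRel_of_coupling (ν.map fun C' => (C, C')) ?_ ?_ fun p hp => ?_
    · rw [PMF.map_comp]; exact PMF.map_const _ _
    · rw [PMF.map_comp]; exact PMF.map_id _
    · rw [PMF.mem_support_map_iff] at hp
      obtain ⟨q, hq, rfl⟩ := hp
      exact h _ hq

theorem liftTrans_pure {T : Config S → PMF (Config S) → Prop} {C : Config S}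
    {ν : PMF (Config S)} : LiftTrans T (PMF.pure C) ν ↔ T C ν := by
  constructor
  · rintro ⟨f, hf, rfl⟩
    rw [PMF.pure_bind]; exact hf C (by simp)
  · intro h
    exact ⟨fun _ => ν, by simpa using h, by simp⟩

/-- The lifting chooses one continuation per configuration; injectivity of `g` keeps distinct
configurations, with possibly distinct continuations, from being merged by the image. -/
theorem LiftTrans.map {T U : Config S → PMF (Config S) → Prop} {μ ν : PMF (Config S)}
    {g : Config S → Config S} (hg : Function.Injective g) {k : Config S → Config S}
    (H : ∀ C κ, C ∈ μ.support → T C κ → U (g C) (κ.map k))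
    (h : LiftTrans T μ ν) : LiftTrans U (μ.map g) (ν.map k) := by
  classical
  obtain ⟨f, hf, rfl⟩ := h
  have : Nonempty (Config S) := ⟨μ.support_nonempty.some⟩
  have hi : ∀ C, f (Function.invFun g (g C)) = f C := fun C => by
    rw [Function.leftInverse_invFun hg C]
  refine ⟨fun X => (f (Function.invFun g X)).map k, fun X hX => ?_, ?_⟩
  · rw [PMF.mem_support_map_iff] at hX
    obtain ⟨C, hC, rfl⟩ := hX
    simp only [hi]; exact H _ _ hC (hf C hC)
  · rw [PMF.map_bind, PMF.bind_map]
    congr 1; funext C; simp [hi]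

theorem WeakStep.single {D : Equations S} {C μ} (h : Step D C .tau μ) : WeakStep D C μ := by
  simpa using WeakStep.step PMF.pure h fun C' _ => .refl C'

theorem WeakStep.trans {D : Equations S} {C μ} (h : WeakStep D C μ) {f : Config S → PMF (Config S)}
    (hf : ∀ C' ∈ μ.support, WeakStep D C' (f C')) : WeakStep D C (μ.bind f) := by
  induction h with
  | refl C => simpa using hf
  | @step C μ g h1 h2 ih =>
    rw [PMF.bind_bind]
    refine .step _ h1 fun C' hC' => ih C' hC' fun C'' hC'' => hf _ ?_
    rw [PMF.mem_support_bind_iff]; exact ⟨C', hC', hC''⟩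

theorem WeakStep.trans_lift {D : Equations S} {C μ ν} (h : WeakStep D C μ)
    (hf : LiftTrans (WeakStep D) μ ν) : WeakStep D C ν := by
  obtain ⟨f, hf, rfl⟩ := hf
  exact h.trans hf

theorem WeakStep.map {D : Equations S} {g : Config S → Config S} (hg : Function.Injective g)
    (H : ∀ C μ, Step D C .tau μ → Step D (g C) .tau (μ.map g)) {C μ} (h : WeakStep D C μ) :
    WeakStep D (g C) (μ.map g) := by
  induction h with
  | refl C => rw [PMF.pure_map]; exact .refl _
  | @step C μ f h1 h2 ih =>
    obtain ⟨k, hk, he⟩ := LiftTrans.map (T := fun C κ => WeakStep D (g C) (κ.map g))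
      (U := WeakStep D) (k := g) hg (fun C κ _ h => h) ⟨f, ih, rfl⟩
    rw [he]; exact .step _ (H _ _ h1) hk

end Lift

/-! ### Substitution -/

namespace Proc

universe u v w
variable {S : Signature.{u, v, w}}

theorem freshen_notMem (A : Finset ℕ) (q : ℕ) : freshen A q ∉ A := by
  unfold freshen
  split_ifs with h
  · intro h'
    have : A.sup id + 1 ≤ A.sup id := Finset.le_sup (f := id) h'
    omega
  · exact h

theorem qv_csubst (P : Proc S) (x : ℕ) (v : ℝ) : (P.csubst x v).qv = P.qv := by
  induction P <;> simp only [csubst, qv] <;> (try split_ifs) <;> simp_all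

theorem valid_csubst (P : Proc S) (x : ℕ) (v : ℝ) : (P.csubst x v).Valid ↔ P.Valid := by
  induction P <;> simp only [csubst, Valid, qv_csubst] <;> (try split_ifs) <;> simp_all

theorem fv_csubst (P : Proc S) (x : ℕ) (v : ℝ) : (P.csubst x v).fv = P.fv.erase x := by
  induction P with
  | cin c y P ih | meas M q y P ih =>
    simp only [csubst, fv]; split_ifs with h
    · subst h; simp
    · rw [ih, Finset.erase_right_comm]
  | _ => simp_all [csubst, fv, Exp.subst, Finset.erase_union_distrib]

/-- Under a binder, the fresh name avoids the images of the other free variables, so erasing it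
removes exactly the image of the bound one. -/
theorem qv_qsubst (P : Proc S) (s : ℕ → ℕ) : (P.qsubst s).qv = P.qv.image s := by
  induction P generalizing s with
  | qin c q P ih =>
    simp only [qsubst, qv, ih]
    have hf := freshen_notMem ((P.qv.erase q).image s) q
    set f := freshen ((P.qv.erase q).image s) q
    ext y
    simp only [Finset.mem_erase, Finset.mem_image]
    constructor
    · rintro ⟨hy, x, hx, rfl⟩
      by_cases hxq : x = q
      · subst hxq; simp at hy
      · exact ⟨x, ⟨hxq, hx⟩, by simp [hxq]⟩
    · rintro ⟨x, ⟨hxq, hx⟩, rfl⟩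
      refine ⟨fun h => hf ?_, x, hx, by simp [hxq]⟩
      rw [← h]
      exact Finset.mem_image_of_mem _ (Finset.mem_erase.2 ⟨hxq, hx⟩)
  | const A q => simp [qsubst, qv, Finset.image_image]
  | _ => simp_all [qsubst, qv, Finset.image_union, Finset.image_image, Finset.image_insert]

theorem fv_qsubst (P : Proc S) (s : ℕ → ℕ) : (P.qsubst s).fv = P.fv := by
  induction P generalizing s <;> simp_all [qsubst, fv]

/-- The formation rules only assert that certain free variables differ, which an injective
substitution respects. Freshness of the new bound name keeps the updated substitution injective on
the body of an input. -/
theorem valid_qsubst (P : Proc S) (s : ℕ → ℕ) (hs : Set.InjOn s P.qv) (h : P.Valid) :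
    (P.qsubst s).Valid := by
  induction P generalizing s with
  | nil => trivial
  | const A q =>
    intro i j hij
    exact h (hs (by simp [qv]) (by simp [qv]) hij)
  | qin c q P ih =>
    simp only [qsubst, Valid] at h ⊢
    have hf := freshen_notMem ((P.qv.erase q).image s) q
    set f := freshen ((P.qv.erase q).image s) q
    refine ih _ ?_ h
    have key : ∀ x ∈ P.qv, x ≠ q → s x ≠ f := fun x hx hxq he =>
      hf (he ▸ Finset.mem_image_of_mem _ (Finset.mem_erase.2 ⟨hxq, hx⟩))
    intro x hx y hy hxy
    by_cases hxq : x = q <;> by_cases hyq : y = q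
    · rw [hxq, hyq]
    · subst hxq; simp [hyq] at hxy; exact (key y hy hyq hxy.symm).elim
    · subst hyq; simp [hxq] at hxy; exact (key x hx hxq hxy).elim
    · simp [hxq, hyq] at hxy
      exact hs (by simp [qv, hxq]; exact hx) (by simp [qv, hyq]; exact hy) hxy
  | qout c q P ih =>
    simp only [qsubst, Valid, qv_qsubst, Finset.mem_image, not_exists, not_and] at h ⊢
    refine ⟨fun x hx he => h.1 ?_, ih s (hs.mono (by simp [qv])) h.2⟩
    rwa [← hs (by simp [qv]; exact Or.inr hx) (by simp [qv]) he]
  | oper E q P ih | meas M q x P ih =>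
    refine ⟨fun i j hij => h.1 (hs ?_ ?_ hij), ih s (hs.mono (by simp [qv])) h.2⟩ <;> simp [qv]
  | sum P Q ihP ihQ =>
    exact ⟨ihP s (hs.mono (by simp [qv])) h.1, ihQ s (hs.mono (by simp [qv])) h.2⟩
  | par P Q ihP ihQ =>
    refine ⟨?_, ihP s (hs.mono (by simp [qv])) h.2.1, ihQ s (hs.mono (by simp [qv])) h.2.2⟩
    rw [qv_qsubst, qv_qsubst, Finset.disjoint_left]
    intro y hy hy'
    obtain ⟨a, ha, rfl⟩ := Finset.mem_image.1 hy
    obtain ⟨b, hb, hab⟩ := Finset.mem_image.1 hy'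
    have : b = a := hs (by simp [qv]; exact Or.inr hb) (by simp [qv]; exact Or.inl ha) hab
    exact Finset.disjoint_left.1 h.1 ha (this ▸ hb)
  | _ => simp_all [qsubst, Valid, qv]

end Proc

section

universe u v w
variable {S : Signature.{u, v, w}}

theorem Equations.extend_injOn (D : Equations S) {A : S.Const} {r : Fin (S.ar A) → ℕ}
    (hr : Function.Injective r) :
    Set.InjOn (Function.extend (D.params A) r id) (D.body A).qv := by
  intro x hx y hy hxy
  obtain ⟨i, rfl⟩ := D.body_qv A x hx
  obtain ⟨j, rfl⟩ := D.body_qv A y hy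
  rw [(D.params_injective A).extend_apply, (D.params_injective A).extend_apply] at hxy
  rw [hr hxy]

theorem Equations.valid_unfold (D : Equations S) {A : S.Const} {r : Fin (S.ar A) → ℕ}
    (hr : Function.Injective r) : (D.unfold A r).Valid :=
  Proc.valid_qsubst _ _ (D.extend_injOn hr) (D.body_valid A)

theorem Equations.qv_unfold (D : Equations S) (A : S.Const) (r : Fin (S.ar A) → ℕ) :
    (D.unfold A r).qv ⊆ Finset.univ.image r := by
  unfold Equations.unfold
  rw [Proc.qv_qsubst]
  intro y hy
  obtain ⟨x, hx, rfl⟩ := Finset.mem_image.1 hy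
  obtain ⟨i, rfl⟩ := D.body_qv A x hx
  rw [(D.params_injective A).extend_apply]
  simp

theorem Equations.fv_unfold (D : Equations S) (A : S.Const) (r : Fin (S.ar A) → ℕ) :
    (D.unfold A r).fv = ∅ := by
  unfold Equations.unfold
  rw [Proc.fv_qsubst, D.body_closed]

/-! ### Preservation of the formation rules by transitions -/

/-- Well-formed processes without free classical variables. -/
def Proc.Good (P : Proc S) : Prop := P.Valid ∧ P.fv = ∅

/-- The bound on the quantum variables after an action. -/
def Act.bound : Act S → Finset ℕ → Finset ℕ
  | .qin _ r, V => insert r V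
  | .qout _ r, V => V.erase r
  | _, V => V

theorem Act.bound_mono (α : Act S) {V W : Finset ℕ} (h : V ⊆ W) : α.bound V ⊆ α.bound W := by
  cases α <;> simp only [Act.bound]
  case qin => exact Finset.insert_subset_insert _ h
  case qout => exact Finset.erase_subset_erase _ h
  all_goals exact h

/-- The subject reduction property. -/
def Reduces (P : Proc S) (α : Act S) (P' : Proc S) : Prop :=
  P'.Good ∧ P'.qv ⊆ α.bound P.qv ∧ ∀ c r, α = .qout c r → r ∈ P.qv

theorem Proc.good_par {P Q : Proc S} :
    (Proc.par P Q).Good ↔ Disjoint P.qv Q.qv ∧ P.Good ∧ Q.Good := by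
  simp only [Proc.Good, Proc.Valid, Proc.fv, Finset.union_eq_empty]
  tauto

/-- Only an input enlarges the variables of the moving component, and the received variable is
excluded from `Q` by `hα`. -/
theorem Reduces.par_left {P P' Q : Proc S} {α : Act S} (h : Reduces P α P')
    (hC : (Proc.par P Q).Good) (hα : ∀ c r, α = .qin c r → r ∉ Q.qv) :
    Reduces (.par P Q) α (.par P' Q) := by
  obtain ⟨hd, hP, hQ⟩ := Proc.good_par.1 hC
  obtain ⟨hP', hb, ho⟩ := h
  cases α with
  | qin c r =>
    have hr := hα c r rfl
    simp only [Act.bound] at hb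
    refine ⟨Proc.good_par.2 ⟨Finset.disjoint_of_subset_left hb ?_, hP', hQ⟩, ?_, by simp⟩
    · simp [hr, hd]
    · simp only [Act.bound, Proc.qv]
      rw [← Finset.insert_union]
      exact Finset.union_subset_union_left hb
  | qout c r =>
    have hr := ho c r rfl
    have hrQ := Finset.disjoint_left.1 hd hr
    simp only [Act.bound] at hb
    refine ⟨Proc.good_par.2 ⟨Finset.disjoint_of_subset_left (hb.trans (Finset.erase_subset _ _)) hd,
      hP', hQ⟩, ?_, ?_⟩
    · simp only [Act.bound, Proc.qv]
      rw [Finset.erase_union_distrib, Finset.erase_eq_of_notMem hrQ]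
      exact Finset.union_subset_union_left hb
    · intro c' r' h
      obtain ⟨rfl, rfl⟩ := (Act.qout.injEq ..).mp h
      exact Finset.mem_union_left _ hr
  | _ =>
    exact ⟨Proc.good_par.2 ⟨Finset.disjoint_of_subset_left hb hd, hP', hQ⟩,
      Finset.union_subset_union_left hb, by simp⟩

theorem Reduces.par_right {P Q Q' : Proc S} {α : Act S} (h : Reduces Q α Q')
    (hC : (Proc.par P Q).Good) (hα : ∀ c r, α = .qin c r → r ∉ P.qv) :
    Reduces (.par P Q) α (.par P Q') := by
  have hC' : (Proc.par Q P).Good := by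
    rw [Proc.good_par] at hC ⊢; exact ⟨hC.1.symm, hC.2.2, hC.2.1⟩
  obtain ⟨h1, h2, h3⟩ := h.par_left hC' hα
  rw [Proc.good_par] at h1
  refine ⟨Proc.good_par.2 ⟨h1.1.symm, h1.2.2, h1.2.1⟩, ?_, ?_⟩
  · simpa only [Proc.qv, Finset.union_comm] using h2
  · simpa only [Proc.qv, Finset.union_comm] using h3

/-- Complementary actions. -/
def Com (α β : Act S) : Prop :=
  (∃ c v, α = .cin c v ∧ β = .cout c v) ∨ (∃ c v, α = .cout c v ∧ β = .cin c v) ∨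
    (∃ c r, α = .qin c r ∧ β = .qout c r) ∨ (∃ c r, α = .qout c r ∧ β = .qin c r)

/-- The quantum variables of `P` and of an input or output partner after a communication. -/
theorem Reduces.par_com {P P' Q Q' : Proc S} {α β : Act S} (h : Reduces P α P')
    (k : Reduces Q β Q') (hC : (Proc.par P Q).Good)
    (hαβ : Com α β) :
    Reduces (.par P Q) .tau (.par P' Q') := by
  obtain ⟨hd, hP, hQ⟩ := Proc.good_par.1 hC
  obtain ⟨hP', hb, ho⟩ := h
  obtain ⟨hQ', kb, ko⟩ := k
  have key : Disjoint P'.qv Q'.qv ∧ P'.qv ∪ Q'.qv ⊆ P.qv ∪ Q.qv := by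
    rw [Finset.disjoint_left] at hd ⊢
    simp only [Finset.subset_iff, Finset.mem_union] at hb kb ⊢
    rcases hαβ with ⟨c, v, rfl, rfl⟩ | ⟨c, v, rfl, rfl⟩ | ⟨c, r, rfl, rfl⟩ | ⟨c, r, rfl, rfl⟩
    · exact ⟨fun x hx hx' => hd (hb hx) (kb hx'), fun x hx => hx.imp (@hb x) (@kb x)⟩
    · exact ⟨fun x hx hx' => hd (hb hx) (kb hx'), fun x hx => hx.imp (@hb x) (@kb x)⟩
    -- The exchanged qubit belongs to the sender before the communication and no longer afterwards,
    -- so ownership moves without overlap. The last case is the mirror image.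
    · have hr := ko c r rfl
      simp only [Act.bound, Finset.mem_insert, Finset.mem_erase] at hb kb
      constructor
      · intro x hx hx'
        rcases hb hx with rfl | h
        · exact (kb hx').1 rfl
        · exact hd h (kb hx').2
      · rintro x (hx | hx)
        · rcases hb hx with rfl | h
          · exact Or.inr hr
          · exact Or.inl h
        · exact Or.inr (kb hx).2
    · have hr := ho c r rfl
      simp only [Act.bound, Finset.mem_insert, Finset.mem_erase] at hb kb
      constructor
      · intro x hx hx'
        rcases kb hx' with rfl | h
        · exact (hb hx).1 rfl
        · exact hd (hb hx).2 h
      · rintro x (hx | hx)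
        · exact Or.inl (hb hx).2
        · rcases kb hx with rfl | h
          · exact Or.inl hr
          · exact Or.inr h
  exact ⟨Proc.good_par.2 ⟨key.1, hP', hQ'⟩, key.2, by simp⟩

theorem Reduces.of_subset {P P₂ P' : Proc S} {α : Act S} (h : Reduces P α P')
    (hs : P.qv ⊆ P₂.qv) : Reduces P₂ α P' :=
  ⟨h.1, h.2.1.trans (α.bound_mono hs), fun c r hα => hs (h.2.2 c r hα)⟩

theorem mem_pure_self {α : Type*} (a : α) : a ∈ (PMF.pure a).support := by simp

/-- Induction on the derivation. This keeps the relations built below on well-formed processes and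
controls which qubits a process can own after a move. -/
theorem Step.reduces {D : Equations S} {C : Config S} {α μ} (h : Step D C α μ)
    (hC : C.proc.Good) : ∀ C' ∈ μ.support, Reduces C.proc α C'.proc := by
  induction h with
  | tau P ρ | coutp c e P ρ =>
    simp only [Proc.Good, Proc.Valid, Proc.fv, Finset.union_eq_empty] at hC
    simp_all [Reduces, Proc.Good, Act.bound, Proc.qv]
  | cinp c x P ρ v =>
    simp only [Proc.Good, Proc.Valid, Proc.fv] at hC
    simp_all [Reduces, Proc.Good, Act.bound, Proc.qv, Proc.valid_csubst, Proc.qv_csubst,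
      Proc.fv_csubst]
  | @ccom_left P₁ P₂ P₁' P₂' ρ c v _ _ ih₁ ih₂ | @ccom_right P₁ P₂ P₁' P₂' ρ c v _ _ ih₁ ih₂
  | @qcom_left P₁ P₂ P₁' P₂' ρ c v _ _ ih₁ ih₂ | @qcom_right P₁ P₂ P₁' P₂' ρ c v _ _ ih₁ ih₂ =>
    intro C' hC'
    rw [PMF.mem_support_pure_iff] at hC'
    subst hC'
    have hC' := Proc.good_par.1 hC
    refine (ih₁ hC'.2.1 _ (mem_pure_self _)).par_com (ih₂ hC'.2.2 _ (mem_pure_self _)) hC ?_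
    simp [Com]
  | qinp c q P ρ r hr =>
    intro C' hC'
    rw [PMF.mem_support_pure_iff] at hC'
    subst hC'
    simp only [Proc.Good, Proc.Valid, Proc.fv, Proc.qv, Finset.mem_erase, not_and] at hC hr
    refine ⟨⟨Proc.valid_qsubst _ _ ?_ hC.1, by rw [Proc.fv_qsubst, hC.2]⟩, ?_, by simp⟩
    · intro x hx y hy hxy
      by_cases hxq : x = q <;> by_cases hyq : y = q
      · rw [hxq, hyq]
      · subst hxq; simp [hyq] at hxy; exact (hr (hxy ▸ hyq) (hxy ▸ hy)).elim
      · subst hyq; simp [hxq] at hxy; exact (hr (hxy ▸ hxq) (hxy ▸ hx)).elim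
      · simpa [hxq, hyq] using hxy
    · intro y hy
      rw [Proc.qv_qsubst] at hy
      obtain ⟨x, hx, rfl⟩ := Finset.mem_image.1 hy
      by_cases hxq : x = q
      · simp [Act.bound, hxq]
      · simp [Act.bound, Proc.qv, hxq, hx]
  | qoutp c q P ρ =>
    intro C' hC'
    rw [PMF.mem_support_pure_iff] at hC'
    subst hC'
    simp only [Proc.Good, Proc.Valid, Proc.fv] at hC
    refine ⟨⟨hC.1.2, hC.2⟩, ?_, ?_⟩
    · simp [Act.bound, Proc.qv, Finset.erase_insert hC.1.1]
    · intro c' r h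
      obtain ⟨rfl, rfl⟩ := (Act.qout.injEq ..).mp h
      simp [Proc.qv]
  | oper E r hr P ρ =>
    simp only [Proc.Good, Proc.Valid, Proc.fv] at hC
    simp_all [Reduces, Proc.Good, Act.bound, Proc.qv]
  | meas M r hr x P ρ w hw =>
    intro C' hC'
    obtain ⟨t, -, rfl⟩ := (PMF.mem_support_map_iff ..).1 hC'
    simp only [Proc.Good, Proc.Valid, Proc.fv] at hC
    simp_all [Reduces, Proc.Good, Act.bound, Proc.qv, Proc.valid_csubst, Proc.qv_csubst,
      Proc.fv_csubst]
  | inp_int_left h hr ih =>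
    intro C' hC'
    rw [PMF.mem_support_pure_iff] at hC'
    subst hC'
    refine (ih (Proc.good_par.1 hC).2.1 _ (mem_pure_self _)).par_left hC fun c' r' h => ?_
    obtain ⟨rfl, rfl⟩ := (Act.qin.injEq ..).mp h
    exact hr
  | inp_int_right h hr ih =>
    intro C' hC'
    rw [PMF.mem_support_pure_iff] at hC'
    subst hC'
    refine (ih (Proc.good_par.1 hC).2.2 _ (mem_pure_self _)).par_right hC fun c' r' h => ?_
    obtain ⟨rfl, rfl⟩ := (Act.qin.injEq ..).mp h
    exact hr
  | oth_int_left h hq ih =>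
    intro C' hC'
    obtain ⟨C'', hC'', rfl⟩ := (PMF.mem_support_map_iff ..).1 hC'
    exact (ih (Proc.good_par.1 hC).2.1 _ hC'').par_left hC
      fun c' r' h => by simp [h, Act.IsQIn] at hq
  | oth_int_right h hq ih =>
    intro C' hC'
    obtain ⟨C'', hC'', rfl⟩ := (PMF.mem_support_map_iff ..).1 hC'
    exact (ih (Proc.good_par.1 hC).2.2 _ hC'').par_right hC
      fun c' r' h => by simp [h, Act.IsQIn] at hq
  | sum_left h ih =>
    simp only [Proc.Good, Proc.Valid, Proc.fv, Finset.union_eq_empty] at hC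
    exact fun C' hC' => (ih ⟨hC.1.1, hC.2.1⟩ C' hC').of_subset (by simp [Proc.qv])
  | sum_right h ih =>
    simp only [Proc.Good, Proc.Valid, Proc.fv, Finset.union_eq_empty] at hC
    exact fun C' hC' => (ih ⟨hC.1.2, hC.2.2⟩ C' hC').of_subset (by simp [Proc.qv])
  | @rel P f ρ α μ h ih =>
    intro C' hC'
    obtain ⟨C'', hC'', rfl⟩ := (PMF.mem_support_map_iff ..).1 hC'
    obtain ⟨h1, h2, h3⟩ := ih hC _ hC''
    refine ⟨h1, ?_, ?_⟩
    · cases α <;> exact h2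
    · cases α <;> simp [Act.relabel]
      exact h3 _ _ rfl
  | res h hL ih =>
    intro C' hC'
    obtain ⟨C'', hC'', rfl⟩ := (PMF.mem_support_map_iff ..).1 hC'
    exact ih hC C'' hC''
  | cho h hb ih =>
    simp only [Proc.Good, Proc.Valid, Proc.fv, Finset.union_eq_empty] at hC
    exact ih ⟨hC.1, hC.2.2⟩
  | @unfold A r ρ α μ h ih =>
    exact fun C' hC' => (ih ⟨D.valid_unfold hC.1, D.fv_unfold A r⟩ C' hC').of_subset
      (D.qv_unfold A r)

/-! ### The form of the transitions of a process in an arbitrary state -/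

theorem pure_injective {α : Type*} : Function.Injective (PMF.pure : α → PMF α) := by
  intro a b h
  have : a ∈ (PMF.pure b).support := by rw [← h]; simp
  simpa using this

theorem pure_mk_inj {P Q : Proc S} {ρ σ : Op ℕ}
    (h : PMF.pure (Config.mk P ρ) = PMF.pure (Config.mk Q σ)) : P = Q ∧ ρ = σ := by
  simpa using pure_injective h

/-- Transitions to a point distribution that keep the state and do not depend on it. -/
def KeepForm (D : Equations S) (P : Proc S) (α : Act S) (ρ : Op ℕ) (μ : PMF (Config S)) : Prop :=
  ∃ P', μ = PMF.pure ⟨P', ρ⟩ ∧ ∀ σ, Step D ⟨P, σ⟩ α (PMF.pure ⟨P', σ⟩)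

/-- Transitions that apply a super-operator. -/
def OperForm (D : Equations S) (P : Proc S) (ρ : Op ℕ) (μ : PMF (Config S)) : Prop :=
  ∃ (n : ℕ) (E : TPSuperOperator n) (r : Fin n ↪ ℕ) (P' : Proc S), (∀ i, r i ∈ P.qv) ∧
    μ = PMF.pure ⟨P', applyAt r E.1 ρ⟩ ∧
    ∀ σ, Step D ⟨P, σ⟩ .tau (PMF.pure ⟨P', applyAt r E.1 σ⟩)

/-- Transitions that perform a measurement. -/
def MeasForm (D : Equations S) (P : Proc S) (ρ : Op ℕ) (μ : PMF (Config S)) : Prop :=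
  ∃ (n : ℕ) (M : Observable n) (r : Fin n ↪ ℕ) (P' : ℝ → Proc S) (w : PMF ℝ),
    (∀ i, r i ∈ P.qv) ∧ (∀ t, w t = ENNReal.ofReal (measProb M r ρ t)) ∧
    μ = w.map (fun t => ⟨P' t, measState M r ρ t⟩) ∧
    ∀ σ (w' : PMF ℝ), (∀ t, w' t = ENNReal.ofReal (measProb M r σ t)) →
      Step D ⟨P, σ⟩ .tau (w'.map fun t => ⟨P' t, measState M r σ t⟩)

theorem KeepForm.map {D : Equations S} {P P₂ : Proc S} {α β : Act S} {ρ μ} (h : KeepForm D P α ρ μ)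
    (g : Proc S → Proc S)
    (hg : ∀ σ κ, Step D ⟨P, σ⟩ α κ → Step D ⟨P₂, σ⟩ β (κ.map (Config.mapProc g))) :
    KeepForm D P₂ β ρ (μ.map (Config.mapProc g)) := by
  obtain ⟨P', rfl, H⟩ := h
  exact ⟨g P', PMF.pure_map _ _,
    fun σ => by simpa [PMF.pure_map, Config.mapProc] using hg σ _ (H σ)⟩

theorem OperForm.map {D : Equations S} {P P₂ : Proc S} {ρ μ} (h : OperForm D P ρ μ)
    (g : Proc S → Proc S) (hs : P.qv ⊆ P₂.qv)
    (hg : ∀ σ κ, Step D ⟨P, σ⟩ .tau κ → Step D ⟨P₂, σ⟩ .tau (κ.map (Config.mapProc g))) :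
    OperForm D P₂ ρ (μ.map (Config.mapProc g)) := by
  obtain ⟨n, E, r, P', hr, rfl, H⟩ := h
  exact ⟨n, E, r, g P', fun i => hs (hr i), PMF.pure_map _ _,
    fun σ => by simpa [PMF.pure_map, Config.mapProc] using hg σ _ (H σ)⟩

theorem MeasForm.map {D : Equations S} {P P₂ : Proc S} {ρ μ} (h : MeasForm D P ρ μ)
    (g : Proc S → Proc S) (hs : P.qv ⊆ P₂.qv)
    (hg : ∀ σ κ, Step D ⟨P, σ⟩ .tau κ → Step D ⟨P₂, σ⟩ .tau (κ.map (Config.mapProc g))) :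
    MeasForm D P₂ ρ (μ.map (Config.mapProc g)) := by
  obtain ⟨n, M, r, P', w, hr, hw, rfl, H⟩ := h
  refine ⟨n, M, r, fun t => g (P' t), w, fun i => hs (hr i), hw, PMF.map_comp _ _ _,
    fun σ w' hw' => ?_⟩
  have := hg σ _ (H σ w' hw')
  rwa [PMF.map_comp] at this

theorem map_mapProc_id (μ : PMF (Config S)) : μ.map (Config.mapProc id) = μ :=
  PMF.map_id μ

/-- The possible forms of a transition. -/
def StepForm (D : Equations S) (P : Proc S) (α : Act S) (ρ : Op ℕ) (μ : PMF (Config S)) : Prop :=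
  KeepForm D P α ρ μ ∨ (α = .tau ∧ (OperForm D P ρ μ ∨ MeasForm D P ρ μ))

theorem StepForm.map {D : Equations S} {P P₂ : Proc S} {α β : Act S} {ρ μ} (h : StepForm D P α ρ μ)
    (g : Proc S → Proc S) (hs : P.qv ⊆ P₂.qv) (hαβ : α = .tau → β = .tau)
    (hg : ∀ σ κ, Step D ⟨P, σ⟩ α κ → Step D ⟨P₂, σ⟩ β (κ.map (Config.mapProc g))) :
    StepForm D P₂ β ρ (μ.map (Config.mapProc g)) := by
  rcases h with h | ⟨rfl, h⟩
  · exact Or.inl (h.map g hg)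
  · obtain rfl := hαβ rfl
    exact Or.inr ⟨rfl, h.imp (fun h => h.map g hs hg) (fun h => h.map g hs hg)⟩

theorem StepForm.of_step {D : Equations S} {P P₂ : Proc S} {α : Act S} {ρ μ}
    (h : StepForm D P α ρ μ) (hs : P.qv ⊆ P₂.qv)
    (hg : ∀ σ κ, Step D ⟨P, σ⟩ α κ → Step D ⟨P₂, σ⟩ α κ) :
    StepForm D P₂ α ρ μ := by
  have := h.map (P₂ := P₂) id hs id fun σ κ hκ => by rw [map_mapProc_id]; exact hg σ κ hκ
  rwa [map_mapProc_id] at this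

/-- The other two forms are silent, so a visible transition can be replayed in every state. -/
theorem KeepForm.pure {D : Equations S} {P P' : Proc S} {α : Act S} {ρ ρ'}
    (h : StepForm D P α ρ (PMF.pure ⟨P', ρ'⟩)) (hα : α ≠ .tau) :
    ∀ σ, Step D ⟨P, σ⟩ α (PMF.pure ⟨P', σ⟩) := by
  obtain ⟨P'', he, H⟩ := h.resolve_right fun h => hα h.1
  rwa [(pure_mk_inj he).1]

/-- No rule has a premise on the state other than the outcome weights of a measurement. A derivation
therefore transfers to another state as soon as outcome weights for that state are supplied. -/
theorem Step.form {D : Equations S} {C : Config S} {α μ} (h : Step D C α μ) :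
    StepForm D C.proc α C.state μ := by
  induction h with
  | tau => exact Or.inl ⟨_, rfl, fun σ => .tau ..⟩
  | ccom_left h₁ h₂ ih₁ ih₂ =>
    exact Or.inl ⟨_, rfl, fun σ => .ccom_left (KeepForm.pure ih₁ (by simp) σ)
      (KeepForm.pure ih₂ (by simp) σ)⟩
  | ccom_right h₁ h₂ ih₁ ih₂ =>
    exact Or.inl ⟨_, rfl, fun σ => .ccom_right (KeepForm.pure ih₁ (by simp) σ)
      (KeepForm.pure ih₂ (by simp) σ)⟩
  | qcom_left h₁ h₂ ih₁ ih₂ =>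
    exact Or.inl ⟨_, rfl, fun σ => .qcom_left (KeepForm.pure ih₁ (by simp) σ)
      (KeepForm.pure ih₂ (by simp) σ)⟩
  | qcom_right h₁ h₂ ih₁ ih₂ =>
    exact Or.inl ⟨_, rfl, fun σ => .qcom_right (KeepForm.pure ih₁ (by simp) σ)
      (KeepForm.pure ih₂ (by simp) σ)⟩
  | oper E r hr P ρ =>
    exact Or.inr ⟨rfl, Or.inl ⟨_, E, ⟨r, hr⟩, P, fun i => by simp [Proc.qv], rfl,
      fun σ => .oper ..⟩⟩
  | meas M r hr x P ρ w hw =>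
    exact Or.inr ⟨rfl, Or.inr ⟨_, M, ⟨r, hr⟩, fun t => P.csubst x t, w, fun i => by simp [Proc.qv],
      hw, rfl, fun σ w' hw' => .meas _ _ hr _ _ _ _ hw'⟩⟩
  | cinp => exact Or.inl ⟨_, rfl, fun σ => .cinp ..⟩
  | coutp => exact Or.inl ⟨_, rfl, fun σ => .coutp ..⟩
  | qinp c q P ρ r hr => exact Or.inl ⟨_, rfl, fun σ => .qinp _ _ _ _ _ hr⟩
  | qoutp => exact Or.inl ⟨_, rfl, fun σ => .qoutp ..⟩
  | inp_int_left h hr ih =>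
    exact Or.inl ⟨_, rfl, fun σ => .inp_int_left (KeepForm.pure ih (by simp) σ) hr⟩
  | inp_int_right h hr ih =>
    exact Or.inl ⟨_, rfl, fun σ => .inp_int_right (KeepForm.pure ih (by simp) σ) hr⟩
  | oth_int_left h hq ih =>
    exact ih.map _ Finset.subset_union_left id fun σ κ hκ => .oth_int_left hκ hq
  | oth_int_right h hq ih =>
    exact ih.map _ Finset.subset_union_right id fun σ κ hκ => .oth_int_right hκ hq
  | sum_left h ih => exact ih.of_step Finset.subset_union_left fun σ κ hκ => .sum_left hκ
  | sum_right h ih => exact ih.of_step Finset.subset_union_right fun σ κ hκ => .sum_right hκ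
  | rel h ih =>
    exact ih.map _ subset_rfl (fun h => by rw [h]; rfl) fun σ κ hκ => .rel hκ
  | res h hL ih => exact ih.map _ subset_rfl id fun σ κ hκ => .res hκ hL
  | cho h hb ih => exact ih.of_step subset_rfl fun σ κ hκ => .cho hκ hb
  | unfold h ih => exact ih.of_step (D.qv_unfold _ _) fun σ κ hκ => .unfold hκ

/-- Visible transitions lead to a point distribution, keep the state, and do not depend on it. -/
theorem Step.visible {D : Equations S} {C : Config S} {α μ} (h : Step D C α μ) (hα : α ≠ .tau) :
    KeepForm D C.proc α C.state μ :=
  h.form.resolve_right fun h => hα h.1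

end

/-! ### Positive operators of trace class -/

/-- The quadratic form is tested on finitely supported vectors only, and each of these sees a finite
principal submatrix. -/
theorem posSemidef_of_finite {n : Type*} {M : Matrix n n ℂ}
    (h : ∀ s : Finset n, (M.submatrix (Subtype.val : s → n) Subtype.val).PosSemidef) :
    M.PosSemidef := by
  classical
  refine ⟨?_, fun x => ?_⟩
  · ext i j
    have := congrFun (congrFun (h {i, j}).1 ⟨i, by simp⟩) ⟨j, by simp⟩
    simpa using this
  · have := (h x.support).2 (x.subtypeDomain (· ∈ x.support))
    simp only [Matrix.submatrix_apply] at this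
    rw [Finsupp.sum_subtypeDomain_index (p := (· ∈ x.support)) (fun _ h => h)
      (h := fun i xi => ((x.subtypeDomain (· ∈ x.support)).sum fun j xj => star xi * M i j * xj))]
      at this
    convert this using 1
    refine Finset.sum_congr rfl fun i _ => ?_
    exact (Finsupp.sum_subtypeDomain_index (p := (· ∈ x.support)) (fun _ h => h)
      (h := fun j xj => star (x i) * M i j * xj)).symm

namespace Op.IsPosTraceClass

variable {κ : Type} {A : Matrix κ κ ℂ}

theorem submatrix {κ' : Type} (h : IsPosTraceClass A) {e : κ' → κ} (he : Function.Injective e) :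
    IsPosTraceClass (A.submatrix e e) :=
  ⟨h.1.submatrix e, h.2.comp_injective he⟩

theorem diag_eq (h : IsPosTraceClass A) (a : κ) : A a a = ((A a a).re : ℂ) :=
  Complex.ext (by simp) (by simp [← (Complex.nonneg_iff.1 (h.1.diag_nonneg (i := a))).2])

theorem re_nonneg (h : IsPosTraceClass A) (a : κ) : 0 ≤ (A a a).re :=
  (Complex.nonneg_iff.1 (h.1.diag_nonneg (i := a))).1

theorem summable_re (h : IsPosTraceClass A) : Summable fun a => (A a a).re :=
  (Complex.hasSum_re h.2.hasSum).summable

/-- A nonnegative two-by-two principal minor gives `‖A a b‖² ≤ A a a * A b b`. The weaker additive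
bound is what makes off-diagonal entries summable by comparison with the diagonal. -/
theorem norm_le (h : IsPosTraceClass A) (a b : κ) : ‖A a b‖ ≤ (A a a).re + (A b b).re := by
  have hp := (h.1.submatrix ![a, b]).det_nonneg
  rw [Matrix.det_fin_two] at hp
  simp only [Matrix.submatrix_apply, Matrix.cons_val_zero, Matrix.cons_val_one] at hp
  have hs : A b a = star (A a b) := (h.1.1.apply b a).symm
  rw [hs, h.diag_eq a, h.diag_eq b] at hp
  have e : A a b * star (A a b) = ((‖A a b‖ ^ 2 : ℝ) : ℂ) := by
    simp [Complex.mul_conj, Complex.normSq_eq_norm_sq]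
  rw [e, ← Complex.ofReal_mul, ← Complex.ofReal_sub, Complex.zero_le_real] at hp
  have ha := h.re_nonneg a
  have hb := h.re_nonneg b
  refine abs_le_of_sq_le_sq' (by nlinarith [mul_nonneg ha hb]) (by positivity) |>.2

theorem summable_entry (h : IsPosTraceClass A) {X : Type*} {f g : X → κ}
    (hf : Function.Injective f) (hg : Function.Injective g) : Summable fun x => A (f x) (g x) :=
  Summable.of_norm_bounded
    ((h.summable_re.comp_injective hf).add (h.summable_re.comp_injective hg))
    fun _ => h.norm_le _ _

theorem smul (h : IsPosTraceClass A) {c : ℝ} (hc : 0 ≤ c) : IsPosTraceClass ((c : ℂ) • A) :=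
  ⟨h.1.smul (by exact_mod_cast hc), h.2.mul_left (c : ℂ)⟩

end Op.IsPosTraceClass

/-- The real part of the trace. -/
def trR {ι : Type} (A : Op ι) : ℝ := A.tr.re

section

variable {ι : Type} {A : Op ι}

theorem trR_eq (h : Op.IsPosTraceClass A) : trR A = ∑' a, (A a a).re :=
  Complex.re_tsum h.2

theorem tr_eq (h : Op.IsPosTraceClass A) : A.tr = (trR A : ℂ) := by
  rw [trR_eq h, Complex.ofReal_tsum]
  exact tsum_congr fun a => h.diag_eq a

theorem trR_nonneg (h : Op.IsPosTraceClass A) : 0 ≤ trR A := by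
  rw [trR_eq h]; exact tsum_nonneg h.re_nonneg

/-- A vanishing sum of nonnegative diagonal entries kills the diagonal, and `norm_le` then kills
every entry. -/
theorem trR_eq_zero_iff (h : Op.IsPosTraceClass A) : trR A = 0 ↔ A = 0 := by
  constructor
  · intro h0
    have hd : ∀ a, (A a a).re = 0 := fun a =>
      congrFun ((hasSum_zero_iff_of_nonneg h.re_nonneg).1
        (h0 ▸ trR_eq h ▸ h.summable_re.hasSum)) a
    ext a b
    have := h.norm_le a b
    rw [hd, hd, add_zero] at this
    simpa using this
  · rintro rfl; simp [trR, Op.tr]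

theorem trR_pos_iff (h : Op.IsPosTraceClass A) : 0 < trR A ↔ A ≠ 0 := by
  rw [← not_iff_not, not_lt, not_not, ← trR_eq_zero_iff h]
  exact ⟨fun h' => le_antisymm h' (trR_nonneg h), fun h => h.le⟩

theorem trR_smul (c : ℝ) (A : Op ι) : trR ((c : ℂ) • A) = c * trR A := by
  unfold trR Op.tr
  simp only [Matrix.smul_apply, smul_eq_mul, tsum_mul_left, Complex.re_ofReal_mul]

end

/-! ### Operators acting on some of the qubits -/

section Lift

variable {ι κ : Type}

/-- The part of a basis vector outside the range of `e`. -/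
def env (e : ι ↪ κ) (x : Finset κ) : Finset κ := by
  classical exact x.filter fun q => q ∉ Set.range e

/-- The part of a basis vector in the range of `e`. -/
def rd (e : ι ↪ κ) (x : Finset κ) : Finset ι := x.preimage e e.injective.injOn

/-- Adding the values `a` at the range of `e`. -/
def glue (e : ι ↪ κ) (a : Finset ι) (u : Finset κ) : Finset κ := by
  classical exact u ∪ a.map e

theorem mem_env {e : ι ↪ κ} {x : Finset κ} {q : κ} : q ∈ env e x ↔ q ∈ x ∧ ∀ i, e i ≠ q := by
  simp [env]

theorem mem_rd {e : ι ↪ κ} {x : Finset κ} {i : ι} : i ∈ rd e x ↔ e i ∈ x := by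
  simp [rd]

theorem mem_glue {e : ι ↪ κ} {a : Finset ι} {u : Finset κ} {q : κ} :
    q ∈ glue e a u ↔ q ∈ u ∨ ∃ i ∈ a, e i = q := by
  simp [glue]

theorem env_env (e : ι ↪ κ) (x : Finset κ) : env e (env e x) = env e x := by
  ext q; simp +contextual [mem_env]

theorem env_glue (e : ι ↪ κ) (a : Finset ι) (u : Finset κ) : env e (glue e a u) = env e u := by
  ext q; simp only [mem_env, mem_glue]; grind

theorem rd_glue (e : ι ↪ κ) (a : Finset ι) {u : Finset κ} (hu : env e u = u) :
    rd e (glue e a u) = a := by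
  ext i
  simp only [mem_rd, mem_glue, e.injective.eq_iff, exists_eq_right]
  refine or_iff_right fun h => ?_
  rw [← hu, mem_env] at h
  exact h.2 i rfl

theorem glue_rd_env (e : ι ↪ κ) (x : Finset κ) : glue e (rd e x) (env e x) = x := by
  ext q
  simp only [mem_glue, mem_rd, mem_env]
  by_cases h : ∃ i, e i = q
  · obtain ⟨i, rfl⟩ := h; simp
  · simp only [not_exists] at h; simp [h]

/-- The basis vectors that vanish on the range of `e`. -/
abbrev Env (e : ι ↪ κ) : Type := {u : Finset κ // env e u = u}

/-- Splitting a basis vector into its values on the range of `e` and the others. -/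
def splitEquiv (e : ι ↪ κ) : Finset ι × Env e ≃ Finset κ where
  toFun p := glue e p.1 p.2
  invFun x := (rd e x, ⟨env e x, env_env e x⟩)
  left_inv p := Prod.ext (rd_glue e p.1 p.2.2) (Subtype.ext ((env_glue e _ _).trans p.2.2))
  right_inv x := glue_rd_env e x

theorem splitEquiv_apply (e : ι ↪ κ) (p : Finset ι × Env e) : splitEquiv e p = glue e p.1 p.2 := rfl

theorem glue_injective (e : ι ↪ κ) (u : Env e) : Function.Injective fun a => glue e a u :=
  fun a b h => (Prod.ext_iff.1 ((splitEquiv e).injective (a₁ := (a, u)) (a₂ := (b, u)) h)).1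

theorem glue_injective_right (e : ι ↪ κ) (a : Finset ι) :
    Function.Injective fun u : Env e => glue e a u :=
  fun u w h => (Prod.ext_iff.1 ((splitEquiv e).injective (a₁ := (a, u)) (a₂ := (a, w)) h)).2

/-- A block of an operator. -/
def block (e : ι ↪ κ) (A : Op κ) (u w : Finset κ) : Op ι :=
  Matrix.of fun a b => A (glue e a u) (glue e b w)

/-- `Φ ⊗ I` for a map `Φ` of operators on the qubits `e i`. -/
def lift (e : ι ↪ κ) (Φ : Op ι →ₗ[ℂ] Op ι) : Op κ →ₗ[ℂ] Op κ where
  toFun A := Matrix.of fun x y => Φ (block e A (env e x) (env e y)) (rd e x) (rd e y)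
  map_add' A B := by
    ext x y
    have : block e (A + B) (env e x) (env e y) =
      block e A (env e x) (env e y) + block e B (env e x) (env e y) := rfl
    simp [this]
  map_smul' c A := by
    ext x y
    have : block e (c • A) (env e x) (env e y) = c • block e A (env e x) (env e y) := rfl
    simp [this]

theorem lift_apply (e : ι ↪ κ) (Φ : Op ι →ₗ[ℂ] Op ι) (A : Op κ) (x y : Finset κ) :
    lift e Φ A x y = Φ (block e A (env e x) (env e y)) (rd e x) (rd e y) := rfl

/-- Unlike `applyAt`, `lift` is bundled as a linear map and allows any ambient index type, so it can
be iterated along embeddings as in `lift_lift`. -/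
theorem applyAt_eq_lift (e : ι ↪ ℕ) (Φ : Op ι →ₗ[ℂ] Op ι) (ρ : Op ℕ) :
    applyAt e Φ ρ = lift e Φ ρ := by
  have key : ∀ a x, writeAt e a x = glue e a (env e x) := fun a x => by
    ext q; simp [writeAt, mem_glue, mem_env]
  ext x y
  simp only [applyAt, lift_apply, Matrix.of_apply, key]
  rfl

theorem block_lift (e : ι ↪ κ) (Φ : Op ι →ₗ[ℂ] Op ι) (A : Op κ) {u w : Finset κ}
    (hu : env e u = u) (hw : env e w = w) : block e (lift e Φ A) u w = Φ (block e A u w) := by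
  ext a b
  simp only [block, Matrix.of_apply, lift_apply, env_glue, hu, hw, rd_glue e _ hu, rd_glue e _ hw]

theorem lift_comp (e : ι ↪ κ) (Φ Ψ : Op ι →ₗ[ℂ] Op ι) (A : Op κ) :
    lift e (Φ ∘ₗ Ψ) A = lift e Φ (lift e Ψ A) := by
  ext x y
  rw [lift_apply, lift_apply, block_lift e Ψ A (env_env e x) (env_env e y)]
  rfl

theorem lift_id (e : ι ↪ κ) (A : Op κ) : lift e LinearMap.id A = A := by
  ext x y
  simp [lift_apply, block, glue_rd_env]

theorem lift_lift {μ : Type} (e : ι ↪ κ) (f : κ ↪ μ) (Φ : Op ι →ₗ[ℂ] Op ι) (A : Op μ) :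
    lift f (lift e Φ) A = lift (e.trans f) Φ A := by
  have h1 : ∀ a x, glue f (glue e a (env e (rd f x))) (env f x) =
      glue (e.trans f) a (env (e.trans f) x) := fun a x => by
    ext q
    simp only [mem_glue, mem_env, mem_rd, Function.Embedding.trans_apply]
    by_cases h : ∃ i, f i = q
    · obtain ⟨i, rfl⟩ := h
      simp [f.injective.eq_iff]
    · simp only [not_exists] at h; simp [h]
  have h2 : ∀ x, rd e (rd f x) = rd (e.trans f) x := fun x => by
    ext i; simp [mem_rd]
  have h3 : ∀ x y, block e (block f A (env f x) (env f y)) (env e (rd f x)) (env e (rd f y)) =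
      block (e.trans f) A (env (e.trans f) x) (env (e.trans f) y) := fun x y => by
    ext a b
    simp only [block, Matrix.of_apply, h1]
  ext x y
  simp only [lift_apply, h2, h3]

theorem block_isPosTraceClass (e : ι ↪ κ) {A : Op κ} (hA : Op.IsPosTraceClass A) (u : Env e) :
    Op.IsPosTraceClass (block e A u u) :=
  hA.submatrix (glue_injective e u)

end Lift

/-! ### Super-operators -/

section SuperOp

variable {ι κ : Type}

/-- Complete positivity is stated for finite ancillas, but a finite principal submatrix involves
only finitely many ancilla indices. Hence infinite ancillas are covered too. -/
theorem IsCompletelyPositive.amplify {Φ : Op ι →ₗ[ℂ] Op ι} (h : IsCompletelyPositive Φ) {K : Type}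
    {A : Matrix (K × Finset ι) (K × Finset ι) ℂ} (hA : Op.IsPosTraceClass A) :
    (Matrix.of fun i j : K × Finset ι =>
      Φ (Matrix.of fun a b => A (i.1, a) (j.1, b)) i.2 j.2).PosSemidef := by
  classical
  refine posSemidef_of_finite fun s => ?_
  let K₀ := s.image Prod.fst
  let ψ := K₀.equivFin
  have := h K₀.card _
    (hA.submatrix (e := fun p : Fin K₀.card × Finset ι => ((ψ.symm p.1 : K), p.2)) fun p q hpq => by
      simp only [Prod.mk.injEq, Subtype.val_inj, ψ.symm.injective.eq_iff] at hpq
      exact Prod.ext hpq.1 hpq.2)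
  have := this.submatrix fun p : s =>
    (ψ ⟨p.1.1, Finset.mem_image_of_mem _ p.2⟩, p.1.2)
  convert this using 1
  ext i j
  simp

theorem IsSuperOperator.diag_nonneg {Φ : Op ι →ₗ[ℂ] Op ι} (h : IsSuperOperator Φ) {A : Op ι}
    (hA : Op.IsPosTraceClass A) : (Φ A).PosSemidef := by
  have := h.1.amplify (K := Unit) (hA.submatrix (e := fun p : Unit × Finset ι => p.2)
    fun p q hpq => Prod.ext rfl hpq)
  exact this.submatrix fun a => ((), a)

theorem IsSuperOperator.map {Φ : Op ι →ₗ[ℂ] Op ι} (h : IsSuperOperator Φ) {A : Op ι}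
    (hA : Op.IsPosTraceClass A) : Op.IsPosTraceClass (Φ A) :=
  ⟨h.diag_nonneg hA, (h.2 A hA).1⟩

theorem IsSuperOperator.trR_le {Φ : Op ι →ₗ[ℂ] Op ι} (h : IsSuperOperator Φ) {A : Op ι}
    (hA : Op.IsPosTraceClass A) : trR (Φ A) ≤ trR A := (h.2 A hA).2

theorem IsSuperOperator.comp {Φ Ψ : Op ι →ₗ[ℂ] Op ι} (h : IsSuperOperator Φ)
    (k : IsSuperOperator Ψ) : IsSuperOperator (Φ ∘ₗ Ψ) := by
  refine ⟨fun n A hA => ?_, fun A hA =>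
    ⟨(h.map (k.map hA)).2, (h.trR_le (k.map hA)).trans (k.trR_le hA)⟩⟩
  refine h.1 n (Matrix.of fun i j => Ψ (Matrix.of fun a b => A (i.1, a) (j.1, b)) i.2 j.2)
    ⟨k.1 n A hA, ?_⟩
  -- The intermediate operator must be trace class before `Φ` may be applied; its diagonal consists
  -- of finitely many summable blocks.
  have hi : ∀ i, Summable fun a => Ψ (Matrix.of fun a b => A (i, a) (i, b)) a a := fun i =>
    (k.map (hA.submatrix (e := fun a => (i, a)) fun a b hab => (Prod.ext_iff.1 hab).2)).2
  refine Summable.of_norm ?_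
  rw [summable_prod_of_nonneg fun _ => norm_nonneg _]
  exact ⟨fun i => (hi i).norm, Summable.of_finite⟩

theorem isSuperOperator_id : IsSuperOperator (LinearMap.id : Op ι →ₗ[ℂ] Op ι) :=
  ⟨fun _ _ hA => hA.1, fun _ hA => ⟨hA.2, le_rfl⟩⟩

/-- The sum over basis vectors is reorganized by `splitEquiv` into a sum over environments of traces
of diagonal blocks. The blocks of `A` dominate their images under `Φ`, which justifies the
rearrangement. -/
theorem summable_lift (e : ι ↪ κ) {Φ : Op ι →ₗ[ℂ] Op ι} (h : IsSuperOperator Φ) {A : Op κ}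
    (hA : Op.IsPosTraceClass A) :
    Summable (fun x => lift e Φ A x x) ∧
      trR (lift e Φ A) = ∑' u : Env e, trR (Φ (block e A u u)) ∧
      trR A = ∑' u : Env e, trR (block e A u u) ∧
      (Summable fun u : Env e => trR (block e A u u)) ∧
      Summable fun u : Env e => trR (Φ (block e A u u)) := by
  let s := (Equiv.prodComm _ _).trans (splitEquiv e)
  have hB := fun u : Env e => block_isPosTraceClass e hA u
  have hs : ∀ p : Env e × Finset ι, lift e Φ A (s p) (s p) = Φ (block e A p.1 p.1) p.2 p.2 := by
    rintro ⟨u, a⟩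
    have := congrFun (congrFun (block_lift e Φ A u.2 u.2) a) a
    exact this
  have hA' : Summable fun p : Env e × Finset ι => (A (s p) (s p)).re :=
    hA.summable_re.comp_injective s.injective
  have hA2 := (summable_prod_of_nonneg (f := fun p : Env e × Finset ι => (A (s p) (s p)).re)
    fun p => hA.re_nonneg _).1 hA'
  have e1 : (fun u : Env e => trR (block e A u u)) = fun u => ∑' a, (A (s (u, a)) (s (u, a))).re :=
    funext fun u => trR_eq (hB u)
  have hA3 : Summable fun u : Env e => trR (block e A u u) := e1 ▸ hA2.2
  have hnn : ∀ u : Env e, 0 ≤ trR (Φ (block e A u u)) := fun u => trR_nonneg (h.map (hB u))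
  have hA4 : Summable fun u : Env e => trR (Φ (block e A u u)) :=
    Summable.of_nonneg_of_le hnn (fun u => h.trR_le (hB u)) hA3
  have e2 : (fun u : Env e => trR (Φ (block e A u u))) =
      fun u : Env e => ∑' a, (Φ (block e A u u) a a).re := funext fun u => trR_eq (h.map (hB u))
  have hP : Summable fun p : Env e × Finset ι => (Φ (block e A p.1 p.1) p.2 p.2).re := by
    rw [summable_prod_of_nonneg fun p => (h.map (hB p.1)).re_nonneg p.2]
    exact ⟨fun u => (h.map (hB u)).summable_re, e2 ▸ hA4⟩
  have hsum : Summable fun x => lift e Φ A x x := by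
    rw [← s.summable_iff]
    have : ((fun x => lift e Φ A x x) ∘ s) =
        fun p => (((Φ (block e A p.1 p.1) p.2 p.2).re : ℝ) : ℂ) :=
      funext fun p => (hs p).trans ((h.map (hB p.1)).diag_eq p.2)
    rw [this]
    exact Complex.summable_ofReal.2 hP
  refine ⟨hsum, ?_, ?_, hA3, hA4⟩
  · rw [trR, Op.tr, Complex.re_tsum hsum, ← s.tsum_eq, e2, ← hP.tsum_prod]
    exact tsum_congr fun p => by rw [hs]
  · rw [trR_eq hA, ← s.tsum_eq, e1, ← hA'.tsum_prod]

/-- For complete positivity, the untouched qubits are absorbed into the ancilla, which becomes `Fin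
n × Env e` and is infinite in general. The trace bound is checked block by block. -/
theorem IsSuperOperator.lift (e : ι ↪ κ) {Φ : Op ι →ₗ[ℂ] Op ι} (h : IsSuperOperator Φ) :
    IsSuperOperator (lift e Φ) := by
  refine ⟨fun n A hA => ?_, fun A hA => ?_⟩
  · have hB : Op.IsPosTraceClass (A.submatrix
        (fun p : (Fin n × Env e) × Finset ι => (p.1.1, glue e p.2 p.1.2)) _) :=
      hA.submatrix fun p q hpq => by
        obtain ⟨h1, h2⟩ := Prod.ext_iff.1 hpq
        have := (splitEquiv e).injective (a₁ := (p.2, p.1.2)) (a₂ := (q.2, q.1.2)) h2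
        obtain ⟨h3, h4⟩ := Prod.ext_iff.1 this
        exact Prod.ext (Prod.ext h1 h4) h3
    exact (h.1.amplify hB).submatrix
      fun p : Fin n × Finset κ => ((p.1, ⟨env e p.2, env_env e p.2⟩), rd e p.2)
  · obtain ⟨h1, h2, h3, h4, h5⟩ := summable_lift e h hA
    refine ⟨h1, ?_⟩
    change trR _ ≤ trR _
    rw [h2, h3]
    exact h5.tsum_le_tsum (fun u => h.trR_le (block_isPosTraceClass e hA u)) h4

theorem trR_lift_of_tracePreserving (e : ι ↪ κ) {Φ : Op ι →ₗ[ℂ] Op ι} (h : IsSuperOperator Φ)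
    (ht : IsTracePreserving Φ) {A : Op κ} (hA : Op.IsPosTraceClass A) :
    trR (QCCS.lift e Φ A) = trR A := by
  obtain ⟨h1, h2, h3, h4, h5⟩ := summable_lift e h hA
  rw [h2, h3]
  exact tsum_congr fun u => congrArg Complex.re (ht _ (block_isPosTraceClass e hA u))

end SuperOp

/-! ### Partial traces -/

section PartialTrace

/-- Equality of partial traces. -/
def PtrEq (V : Finset ℕ) (ρ σ : Op ℕ) : Prop :=
  ∀ y z, Disjoint V y → Disjoint V z →
    ∑ a ∈ V.powerset, ρ (a ∪ y) (a ∪ z) = ∑ a ∈ V.powerset, σ (a ∪ y) (a ∪ z)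

theorem partialTrace_eq_iff {V : Finset ℕ} {ρ σ : Op ℕ} :
    partialTrace V ρ = partialTrace V σ ↔ PtrEq V ρ σ := by
  constructor
  · intro h y z hy hz
    have hr : ∀ y : Finset ℕ, Disjoint V y →
        (y.subtype (· ∉ V)).map (Function.Embedding.subtype _) = y := fun y hy => by
      rw [Finset.subtype_map, Finset.filter_eq_self]
      exact fun x hx => Finset.disjoint_right.1 hy hx
    have := congrFun (congrFun h (y.subtype (· ∉ V))) (z.subtype (· ∉ V))
    simpa only [partialTrace, Matrix.of_apply, hr y hy, hr z hz] using this
  · intro h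
    have hd : ∀ y : Finset {q : ℕ // q ∉ V}, Disjoint V (y.map (Function.Embedding.subtype _)) :=
      fun y => Finset.disjoint_right.2 fun x hx => by
        obtain ⟨q, -, rfl⟩ := Finset.mem_map.1 hx
        exact q.2
    ext y z
    exact h _ _ (hd y) (hd z)

/-- Tracing out `W` amounts to tracing out `V` and then `W \ V`. -/
theorem PtrEq.mono {V W : Finset ℕ} {ρ σ : Op ℕ} (h : PtrEq V ρ σ) (hVW : V ⊆ W) :
    PtrEq W ρ σ := by
  intro y z hy hz
  have key : ∀ τ : Op ℕ, ∑ a ∈ W.powerset, τ (a ∪ y) (a ∪ z) =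
      ∑ b ∈ (W \ V).powerset, ∑ a ∈ V.powerset, τ (a ∪ (b ∪ y)) (a ∪ (b ∪ z)) := by
    intro τ
    rw [Finset.sum_sigma']
    refine Finset.sum_bij' (fun c _ => ⟨c \ V, c ∩ V⟩) (fun p _ => p.2 ∪ p.1) ?_ ?_ ?_ ?_ ?_
    · intro c hc
      simp only [Finset.mem_powerset, Finset.mem_sigma] at hc ⊢
      exact ⟨Finset.sdiff_subset_sdiff hc subset_rfl, Finset.inter_subset_right⟩
    · rintro ⟨b, a⟩ hp
      simp only [Finset.mem_powerset, Finset.mem_sigma] at hp ⊢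
      exact Finset.union_subset (hp.2.trans hVW) (hp.1.trans Finset.sdiff_subset)
    · intro c hc
      ext x; simp; tauto
    · rintro ⟨b, a⟩ hp
      simp only [Finset.mem_powerset, Finset.mem_sigma, Finset.subset_iff, Finset.mem_sdiff] at hp
      congr 1 <;> ext x <;> simp <;> grind
    · intro c hc
      congr 1 <;> (ext x; simp; tauto)
  rw [key, key]
  refine Finset.sum_congr rfl fun b hb => h _ _ ?_ ?_ <;>
  · rw [Finset.disjoint_union_right]
    rw [Finset.mem_powerset] at hb
    refine ⟨Finset.disjoint_of_subset_right hb Finset.disjoint_sdiff,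
      Finset.disjoint_of_subset_left hVW (by assumption)⟩

/-- An operation outside `V` commutes with the partial trace over `V`. As the latter is a finite
sum, linearity of `Φ` is enough. -/
theorem PtrEq.lift {ι : Type} (e : ι ↪ ℕ) (Φ : Op ι →ₗ[ℂ] Op ι) {V : Finset ℕ} {ρ σ : Op ℕ}
    (h : PtrEq V ρ σ) (he : ∀ i, e i ∉ V) : PtrEq V (lift e Φ ρ) (lift e Φ σ) := by
  have key : ∀ (τ : Op ℕ) (y z : Finset ℕ), ∑ a ∈ V.powerset, QCCS.lift e Φ τ (a ∪ y) (a ∪ z) =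
      Φ (Matrix.of fun b c => ∑ a ∈ V.powerset,
        τ (a ∪ glue e b (env e y)) (a ∪ glue e c (env e z))) (rd e y) (rd e z) := by
    intro τ y z
    have e1 : (Matrix.of fun b c => ∑ a ∈ V.powerset,
        τ (a ∪ glue e b (env e y)) (a ∪ glue e c (env e z))) =
        ∑ a ∈ V.powerset, Matrix.of fun b c =>
          τ (a ∪ glue e b (env e y)) (a ∪ glue e c (env e z)) := by
      ext b c; simp [Matrix.sum_apply]
    rw [e1, map_sum, Matrix.sum_apply]
    refine Finset.sum_congr rfl fun a ha => ?_
    rw [Finset.mem_powerset] at ha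
    have hrd : ∀ y, rd e (a ∪ y) = rd e y := fun y => by
      ext i
      simp only [mem_rd, Finset.mem_union, or_iff_right_iff_imp]
      exact fun h => (he i (ha h)).elim
    have hgl : ∀ b y, glue e b (env e (a ∪ y)) = a ∪ glue e b (env e y) := fun b y => by
      ext q
      simp only [mem_glue, mem_env, Finset.mem_union]
      have : q ∈ a → ∀ i, e i ≠ q := fun hq i hi => he i (hi ▸ ha hq)
      tauto
    have e2 : block e τ (env e (a ∪ y)) (env e (a ∪ z)) = Matrix.of fun b c =>
        τ (a ∪ glue e b (env e y)) (a ∪ glue e c (env e z)) := by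
      ext b c
      simp only [block, Matrix.of_apply, hgl]
    rw [lift_apply, hrd, hrd, e2]
  intro y z hy hz
  have e3 : (Matrix.of fun b c => ∑ a ∈ V.powerset,
        ρ (a ∪ glue e b (env e y)) (a ∪ glue e c (env e z))) =
      Matrix.of fun b c => ∑ a ∈ V.powerset,
        σ (a ∪ glue e b (env e y)) (a ∪ glue e c (env e z)) := ?_
  · rw [key, key, e3]
  ext b c
  refine h _ _ ?_ ?_
  all_goals
    rw [Finset.disjoint_right]
    intro q hq
    rcases mem_glue.1 hq with hq | ⟨i, -, rfl⟩
    · have := (mem_env.1 hq).1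
      first
        | exact Finset.disjoint_right.1 hy this
        | exact Finset.disjoint_right.1 hz this
    · exact he i

/-- The full trace is the trace of the partial trace, after grouping basis vectors by their values
outside `V`. -/
theorem PtrEq.tr_eq {V : Finset ℕ} {ρ σ : Op ℕ} (h : PtrEq V ρ σ)
    (hρ : Summable fun a => ρ a a) (hσ : Summable fun a => σ a a) : ρ.tr = σ.tr := by
  let e : V ↪ ℕ := Function.Embedding.subtype _
  let s := (Equiv.prodComm _ _).trans (splitEquiv e)
  have key : ∀ τ : Op ℕ, (Summable fun a => τ a a) →
      τ.tr = ∑' u : Env e, ∑ a ∈ V.powerset, τ (a ∪ u) (a ∪ u) := by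
    intro τ hτ
    have hs : Summable fun p => τ (s p) (s p) := hτ.comp_injective s.injective
    rw [Op.tr, ← s.tsum_eq, hs.tsum_prod]
    refine tsum_congr fun u => ?_
    rw [tsum_fintype]
    refine Finset.sum_bij (fun a _ => a.map e) ?_ ?_ ?_ ?_
    · intro a _
      rw [Finset.mem_powerset]
      intro x hx
      obtain ⟨q, -, rfl⟩ := Finset.mem_map.1 hx
      exact q.2
    · exact fun a _ b _ h => Finset.map_injective e h
    · intro b hb
      rw [Finset.mem_powerset] at hb
      refine ⟨b.subtype (· ∈ V), Finset.mem_univ _, ?_⟩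
      rw [Finset.subtype_map, Finset.filter_eq_self]
      exact fun x hx => hb hx
    · intro a _
      have : s (u, a) = a.map e ∪ u := by
        change glue e a u = _
        ext q; simp [mem_glue, or_comm]
      rw [this]
  rw [key ρ hρ, key σ hσ]
  refine tsum_congr fun u => h _ _ ?_ ?_ <;>
  · rw [Finset.disjoint_right]
    intro q hq hqV
    rw [← u.2] at hq
    exact (mem_env.1 hq).2 ⟨q, hqV⟩ rfl

end PartialTrace

/-! ### Operations on finitely many qubits -/

section FiniteLift

variable {ι κ : Type}

/-- Expansion in matrix units: with finitely many qubits `Φ` is a finite combination of entries, so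
it passes through infinite sums and through any other linear map. -/
theorem exists_apply_eq_sum [Fintype ι] (Φ : Op ι →ₗ[ℂ] Op ι) :
    ∃ k : Finset ι → Finset ι → Op ι, ∀ X c d, Φ X c d = ∑ a, ∑ b, X a b * k a b c d := by
  classical
  refine ⟨fun a b => Φ (Matrix.of fun a' b' => if a = a' ∧ b = b' then 1 else 0), fun X c d => ?_⟩
  have hX : X = ∑ a, ∑ b,
      X a b • (Matrix.of fun a' b' => if a = a' ∧ b = b' then (1 : ℂ) else 0) := by
    ext i j
    simp only [Matrix.sum_apply, Matrix.smul_apply, Matrix.of_apply, smul_eq_mul, mul_ite, mul_one,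
      mul_zero]
    rw [Finset.sum_eq_single i, Finset.sum_eq_single j] <;> simp +contextual
  conv_lhs => rw [hX]
  simp only [map_sum, map_smul, Matrix.sum_apply, Matrix.smul_apply, smul_eq_mul]

/-- Operations on disjoint sets of qubits commute if one of the sets is finite. -/
theorem lift_comm [Fintype ι] {ι' : Type} (e : ι ↪ κ) (f : ι' ↪ κ) (hef : ∀ i j, e i ≠ f j)
    (Φ : Op ι →ₗ[ℂ] Op ι) (Ψ : Op ι' →ₗ[ℂ] Op ι') (A : Op κ) :
    lift f Ψ (lift e Φ A) = lift e Φ (lift f Ψ A) := by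
  have rd_e : ∀ c x, rd e (glue f c (env f x)) = rd e x := fun c x => by
    ext i
    simp only [mem_rd, mem_glue, mem_env]
    have := hef i
    grind
  have rd_f : ∀ a x, rd f (glue e a (env e x)) = rd f x := fun a x => by
    ext j
    simp only [mem_rd, mem_glue, mem_env]
    have := fun i => hef i j
    grind
  have hgl : ∀ a c x, glue e a (env e (glue f c (env f x))) =
      glue f c (env f (glue e a (env e x))) :=
    fun a c x => by
      ext q
      simp only [mem_glue, mem_env]
      grind
  ext x y
  obtain ⟨k, hk⟩ := exists_apply_eq_sum Φ
  -- The block on which `Ψ` acts is a finite combination of blocks of `A`, so bare linearity of `Ψ`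
  -- suffices, even if `ι'` is infinite.
  have hin : block f (lift e Φ A) (env f x) (env f y) = ∑ a, ∑ b, k a b (rd e x) (rd e y) •
      block f A (env f (glue e a (env e x))) (env f (glue e b (env e y))) := by
    ext c d
    simp only [block, Matrix.of_apply, lift_apply, rd_e, Matrix.sum_apply, Matrix.smul_apply,
      smul_eq_mul]
    rw [hk]
    simp only [Matrix.of_apply, hgl]
    exact Finset.sum_congr rfl fun a _ => Finset.sum_congr rfl fun b _ => mul_comm _ _
  rw [lift_apply, hin, lift_apply, hk]
  simp only [map_sum, map_smul, Matrix.sum_apply, Matrix.smul_apply, smul_eq_mul]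
  refine Finset.sum_congr rfl fun a _ => Finset.sum_congr rfl fun b _ => ?_
  rw [mul_comm]
  simp only [block, Matrix.of_apply, lift_apply, rd_f]

/-- No positivity of `Φ` is assumed, because the probabilities of outcomes are defined by one-sided
multiplication with a projector. Summability comes from that of the entries of `A`. -/
theorem tr_lift_eq [Fintype ι] (e : ι ↪ κ) (Φ : Op ι →ₗ[ℂ] Op ι) {A : Op κ}
    (hA : Op.IsPosTraceClass A) : Summable (fun x => lift e Φ A x x) ∧
      (lift e Φ A).tr = ∑' u : Env e, (Φ (block e A u u)).trace := by
  have hs : ∀ a (u : Env e), lift e Φ A (glue e a u) (glue e a u) = Φ (block e A u u) a a :=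
    fun a u => congrFun (congrFun (block_lift e Φ A u.2 u.2) a) a
  have h1 : ∀ a, Summable fun u : Env e => Φ (block e A u u) a a := fun a => by
    obtain ⟨k, hk⟩ := exists_apply_eq_sum Φ
    simp only [hk]
    exact summable_sum fun b _ => summable_sum fun c _ => (hA.summable_entry
      (glue_injective_right e b) (glue_injective_right e c)).mul_right _
  have h2 : Summable fun p : Finset ι × Env e =>
      lift e Φ A (splitEquiv e p) (splitEquiv e p) := by
    refine Summable.of_norm ?_
    rw [summable_prod_of_nonneg fun _ => norm_nonneg _]
    refine ⟨fun a => ?_, Summable.of_finite⟩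
    simp only [splitEquiv_apply, hs]
    exact (h1 a).norm
  refine ⟨((splitEquiv e).summable_iff (f := fun x => lift e Φ A x x)).1 h2, ?_⟩
  rw [Op.tr, ← (splitEquiv e).tsum_eq, h2.tsum_prod, tsum_fintype]
  simp only [splitEquiv_apply, hs]
  rw [← Summable.tsum_finsetSum fun a _ => h1 a]
  rfl

end FiniteLift

/-! ### Measurements -/

section Measurement

variable {n : ℕ} (M : Observable n)

theorem Observable.proj_mul_proj (s t : ℝ) :
    M.proj s * M.proj t = if s = t then M.proj s else 0 := by
  have hU : star (M.2.eigenvectorUnitary : Op (Fin n)) *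
      (M.2.eigenvectorUnitary : Op (Fin n)) = 1 :=
    Unitary.star_mul_self_of_mem M.2.eigenvectorUnitary.2
  have : M.proj s * M.proj t = (M.2.eigenvectorUnitary : Op (Fin n)) *
      (Matrix.diagonal (fun a => if M.2.eigenvalues a = s then (1 : ℂ) else 0) *
        Matrix.diagonal (fun a => if M.2.eigenvalues a = t then (1 : ℂ) else 0)) *
      star (M.2.eigenvectorUnitary : Op (Fin n)) := by
    unfold Observable.proj
    calc _ = (M.2.eigenvectorUnitary : Op (Fin n)) *
          Matrix.diagonal (fun a => if M.2.eigenvalues a = s then (1 : ℂ) else 0) *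
          (star (M.2.eigenvectorUnitary : Op (Fin n)) * (M.2.eigenvectorUnitary : Op (Fin n))) *
          Matrix.diagonal (fun a => if M.2.eigenvalues a = t then (1 : ℂ) else 0) *
          star (M.2.eigenvectorUnitary : Op (Fin n)) := by simp only [mul_assoc]
      _ = _ := by rw [hU, mul_one]; simp only [mul_assoc]
  rw [this, Matrix.diagonal_mul_diagonal]
  split_ifs with h
  · subst h
    unfold Observable.proj
    congr 3
    ext a; simp
  · have : (fun a => (if M.2.eigenvalues a = s then (1 : ℂ) else 0) *
        if M.2.eigenvalues a = t then (1 : ℂ) else 0) = 0 := by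
      ext a
      by_cases hs : M.2.eigenvalues a = s
      · simp [hs, h]
      · simp [hs]
    rw [this]; simp

theorem Observable.conjTranspose_proj (t : ℝ) : (M.proj t).conjTranspose = M.proj t := by
  unfold Observable.proj
  simp only [Matrix.star_eq_conjTranspose, Matrix.conjTranspose_mul,
    Matrix.conjTranspose_conjTranspose, Matrix.diagonal_conjTranspose, mul_assoc]
  congr 3
  ext a
  by_cases h : M.2.eigenvalues a = t <;> simp [h]

/-- The eigenvalues. -/
def Observable.outcomes : Finset ℝ := Finset.univ.image M.2.eigenvalues

theorem Observable.proj_eq_zero {t : ℝ} (ht : t ∉ M.outcomes) : M.proj t = 0 := by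
  have : (fun a => if M.2.eigenvalues a = t then (1 : ℂ) else 0) = 0 := by
    ext a
    have : M.2.eigenvalues a ≠ t := fun h => ht (h ▸ Finset.mem_image_of_mem _ (Finset.mem_univ a))
    simp [this]
  simp [Observable.proj, this]

theorem Observable.sum_proj : ∑ t ∈ M.outcomes, M.proj t = 1 := by
  unfold Observable.proj
  rw [← Finset.sum_mul, ← Finset.mul_sum]
  have : ∑ t ∈ M.outcomes, Matrix.diagonal (fun a => if M.2.eigenvalues a = t then (1 : ℂ) else 0) =
      (1 : Op (Fin n)) := by
    ext a b
    simp only [Matrix.sum_apply, Matrix.diagonal_apply, Matrix.one_apply]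
    split_ifs with h
    · rw [Finset.sum_ite_eq]
      simp [Observable.outcomes]
    · simp
  rw [this, mul_one]
  exact Unitary.mul_star_self_of_mem M.2.eigenvectorUnitary.2

/-- The map `A ↦ E A E` for the projector `E` of an outcome. -/
def Observable.collapse (t : ℝ) : Op (Fin n) →ₗ[ℂ] Op (Fin n) :=
  LinearMap.mulLeft ℂ (M.proj t) ∘ₗ LinearMap.mulRight ℂ (M.proj t)

theorem Observable.collapse_apply (t : ℝ) (A : Op (Fin n)) :
    M.collapse t A = M.proj t * A * M.proj t := by
  simp [Observable.collapse, mul_assoc]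

theorem Observable.trace_collapse (t : ℝ) (A : Op (Fin n)) :
    (M.collapse t A).trace = (M.proj t * A).trace := by
  rw [M.collapse_apply, Matrix.trace_mul_cycle, M.proj_mul_proj, if_pos rfl]

theorem Observable.collapse_comp (s t : ℝ) :
    M.collapse s ∘ₗ M.collapse t = if s = t then M.collapse s else 0 := by
  ext1 A
  have : M.collapse s (M.collapse t A) = (M.proj s * M.proj t) * A * (M.proj t * M.proj s) := by
    simp only [M.collapse_apply, mul_assoc]
  rw [LinearMap.comp_apply, this, M.proj_mul_proj, M.proj_mul_proj]
  split_ifs with h h' h'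
  · subst h; rw [M.collapse_apply]
  · exact absurd h.symm h'
  · exact absurd h'.symm h
  · simp

theorem Observable.sum_trace_collapse (A : Op (Fin n)) :
    ∑ t ∈ M.outcomes, (M.collapse t A).trace = A.trace := by
  simp only [M.trace_collapse]
  rw [← Matrix.trace_sum, ← Finset.sum_mul, M.sum_proj, one_mul]

theorem Observable.posSemidef_collapse (t : ℝ) {A : Op (Fin n)} (hA : A.PosSemidef) :
    (M.collapse t A).PosSemidef := by
  rw [M.collapse_apply]
  nth_rewrite 2 [← M.conjTranspose_proj]
  exact hA.mul_mul_conjTranspose_same _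

theorem Observable.isSuperOperator_collapse (t : ℝ) : IsSuperOperator (M.collapse t) := by
  classical
  refine ⟨fun k A hA => ?_, fun A hA => ⟨Summable.of_finite, ?_⟩⟩
  -- The amplification of the collapse is conjugation by the Hermitian matrix `1 ⊗ E`.
  · let B : Matrix (Fin k × Finset (Fin n)) (Fin k × Finset (Fin n)) ℂ :=
      Matrix.kronecker 1 (M.proj t)
    have hB : B.conjTranspose = B := by
      simp only [B, Matrix.kronecker]
      rw [Matrix.conjTranspose_kronecker, M.conjTranspose_proj, Matrix.conjTranspose_one]
    have := hA.1.mul_mul_conjTranspose_same B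
    rw [hB] at this
    convert this using 1
    ext ⟨i, a⟩ ⟨j, b⟩
    simp only [Matrix.of_apply, M.collapse_apply, Matrix.mul_apply, B, Matrix.kronecker,
      Matrix.kroneckerMap_apply, Fintype.sum_prod_type, Matrix.one_apply]
    simp
  · change trR _ ≤ trR _
    have hfin : ∀ X : Op (Fin n), trR X = X.trace.re := fun X => by
      rw [trR, Op.tr, tsum_fintype]; rfl
    rw [hfin, hfin, ← M.sum_trace_collapse A]
    by_cases ht : t ∈ M.outcomes
    · rw [Complex.re_sum]
      exact Finset.single_le_sum (f := fun t => (M.collapse t A).trace.re)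
        (fun s _ => (Complex.nonneg_iff.1 (M.posSemidef_collapse s hA.1).trace_nonneg).1) ht
    · rw [M.collapse_apply, M.proj_eq_zero ht, Complex.re_sum]
      simp only [mul_zero, Matrix.trace_zero, Complex.zero_re]
      exact Finset.sum_nonneg fun s _ =>
        (Complex.nonneg_iff.1 (M.posSemidef_collapse s hA.1).trace_nonneg).1

variable (r : Fin n ↪ ℕ) {ρ : Op ℕ}

/-- By cyclicity of the trace and `E² = E`, left multiplication by `E` and the super-operator `A ↦ E
A E` have equal traces on every block. -/
theorem measProb_eq (hρ : Op.IsPosTraceClass ρ) (t : ℝ) :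
    measProb M r ρ t = trR (lift r (M.collapse t) ρ) / trR ρ := by
  have : (lift r (LinearMap.mulLeft ℂ (M.proj t)) ρ).tr = (lift r (M.collapse t) ρ).tr := by
    rw [(tr_lift_eq r _ hρ).2, (tr_lift_eq r _ hρ).2]
    exact tsum_congr fun u => (M.trace_collapse t _).symm
  rw [measProb, applyAt_eq_lift, this, tr_eq hρ,
    tr_eq ((M.isSuperOperator_collapse t).lift r |>.map hρ), ← Complex.ofReal_div,
    Complex.ofReal_re]

theorem measState_eq (t : ℝ) :
    measState M r ρ t = ((measProb M r ρ t : ℂ))⁻¹ • lift r (M.collapse t) ρ := by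
  rw [measState, applyAt_eq_lift]; rfl

/-- Blockwise this is `∑ E = 1`; the finite sum over outcomes is exchanged with the sum over
environments. -/
theorem sum_trR_collapse (hρ : Op.IsPosTraceClass ρ) :
    ∑ t ∈ M.outcomes, trR (lift r (M.collapse t) ρ) = trR ρ := by
  have h : ∑ t ∈ M.outcomes, (lift r (M.collapse t) ρ).tr = ρ.tr := by
    have e1 : ρ.tr = ∑' u : Env r, (block r ρ u u).trace := by
      have := (tr_lift_eq r LinearMap.id hρ).2
      rwa [lift_id] at this
    rw [e1]
    simp only [← M.sum_trace_collapse (block r ρ _ _), (tr_lift_eq r _ hρ).2]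
    rw [Summable.tsum_finsetSum]
    intro t _
    obtain ⟨k, hk⟩ := exists_apply_eq_sum (M.collapse t)
    simp only [Matrix.trace, Matrix.diag, hk]
    exact summable_sum fun a _ => summable_sum fun b _ => summable_sum fun c _ =>
      (hρ.summable_entry (glue_injective_right r b) (glue_injective_right r c)).mul_right _
  have := congrArg Complex.re h
  rwa [Complex.re_sum] at this

theorem trR_collapse_of_notMem {t : ℝ} (ht : t ∉ M.outcomes) :
    trR (lift r (M.collapse t) ρ) = 0 := by
  have : lift r (M.collapse t) ρ = 0 := by
    ext x y
    rw [lift_apply, M.collapse_apply, M.proj_eq_zero ht]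
    simp
  simp [this, trR, Op.tr]

/-- The distribution of the outcomes of a measurement. -/
theorem exists_measPMF (hρ : Op.IsPosTraceClass ρ) (h0 : ρ ≠ 0) :
    ∃ w : PMF ℝ, ∀ t, w t = ENNReal.ofReal (measProb M r ρ t) := by
  refine exists_pmf _ ?_
  have hpos := (trR_pos_iff hρ).2 h0
  rw [tsum_eq_sum (s := M.outcomes), ← ENNReal.ofReal_sum_of_nonneg]
  · simp only [measProb_eq M r hρ]
    rw [← Finset.sum_div, sum_trR_collapse M r hρ, div_self hpos.ne', ENNReal.ofReal_one]
  · intro t _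
    rw [measProb_eq M r hρ]
    exact div_nonneg (trR_nonneg ((M.isSuperOperator_collapse t).lift r |>.map hρ)) hpos.le
  · intro t ht
    rw [measProb_eq M r hρ, trR_collapse_of_notMem M r ht]
    simp

theorem lift_collapse_collapse (s t : ℝ) :
    lift r (M.collapse s) (lift r (M.collapse t) ρ) =
      if s = t then lift r (M.collapse s) ρ else 0 := by
  rw [← lift_comp, M.collapse_comp]
  split_ifs
  · rfl
  · rfl

end Measurement

/-! ### Operations outside a set of qubits -/

/-- Positive multiples of super-operators on the qubits outside `V`. -/
def External (V : Set ℕ) (G : Op ℕ → Op ℕ) : Prop :=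
  ∃ (c : ℝ) (Φ : Op ↥(Vᶜ) →ₗ[ℂ] Op ↥(Vᶜ)), 0 < c ∧ IsSuperOperator Φ ∧
    ∀ ρ, G ρ = (c : ℂ) • applyAt (Function.Embedding.subtype _) Φ ρ

section External

variable {V W : Set ℕ} {G : Op ℕ → Op ℕ}

/-- A super-operator on some qubits is one on any larger set of qubits. -/
theorem IsSuperOperator.exists_extension {ι : Type} {Φ : Op ι →ₗ[ℂ] Op ι} (hΦ : IsSuperOperator Φ)
    (e : ι ↪ ℕ) (he : ∀ i, e i ∉ V) : ∃ Φ' : Op ↥(Vᶜ) →ₗ[ℂ] Op ↥(Vᶜ), IsSuperOperator Φ' ∧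
      ∀ ρ, applyAt (Function.Embedding.subtype _) Φ' ρ = applyAt e Φ ρ := by
  let e' : ι ↪ ↥(Vᶜ) := ⟨fun i => ⟨e i, he i⟩, fun i j h => e.injective (congrArg Subtype.val h)⟩
  refine ⟨QCCS.lift e' Φ, hΦ.lift e', fun ρ => ?_⟩
  rw [applyAt_eq_lift, applyAt_eq_lift, lift_lift]
  rfl

theorem External.of_embedding {ι : Type} {Φ : Op ι →ₗ[ℂ] Op ι} (hΦ : IsSuperOperator Φ)
    (e : ι ↪ ℕ) (he : ∀ i, e i ∉ V) {c : ℝ} (hc : 0 < c) :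
    External V fun ρ => (c : ℂ) • applyAt e Φ ρ := by
  obtain ⟨Φ', h1, h2⟩ := hΦ.exists_extension e he
  exact ⟨c, Φ', hc, h1, fun ρ => by rw [h2]⟩

theorem External.mono (h : External V G) (hWV : W ⊆ V) : External W G := by
  obtain ⟨c, Φ, hc, hΦ, hG⟩ := h
  obtain rfl : G = _ := funext hG
  exact .of_embedding hΦ _ (fun i hi => i.2 (hWV hi)) hc

theorem External.smul_id (V : Set ℕ) {c : ℝ} (hc : 0 < c) : External V fun ρ => (c : ℂ) • ρ := by
  have := External.of_embedding (V := V) (isSuperOperator_id (ι := ↥(Vᶜ)))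
    (Function.Embedding.subtype _) (fun i => i.2) hc
  simpa only [applyAt_eq_lift, lift_id] using this

theorem External.smul (h : External V G) {c : ℝ} (hc : 0 < c) :
    External V fun ρ => (c : ℂ) • G ρ := by
  obtain ⟨c', Φ, hc', hΦ, hG⟩ := h
  exact ⟨c * c', Φ, mul_pos hc hc', hΦ, fun ρ => by
    change (c : ℂ) • G ρ = _
    rw [hG, smul_smul, Complex.ofReal_mul]⟩

theorem External.map (h : External V G) {ρ : Op ℕ} (hρ : Op.IsPosTraceClass ρ) :
    Op.IsPosTraceClass (G ρ) := by
  obtain ⟨c, Φ, hc, hΦ, hG⟩ := h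
  rw [hG, applyAt_eq_lift]
  exact ((hΦ.lift _).map hρ).smul hc.le

theorem External.map_smul (h : External V G) (c : ℂ) (ρ : Op ℕ) : G (c • ρ) = c • G ρ := by
  obtain ⟨c, Φ, hc, hΦ, hG⟩ := h
  rw [hG, hG, applyAt_eq_lift, applyAt_eq_lift, LinearMap.map_smul, smul_comm]

theorem External.map_zero (h : External V G) : G 0 = 0 := by
  have := h.map_smul 0 0
  simpa using this

theorem External.ptrEq {V : Finset ℕ} (h : External V G) {ρ σ : Op ℕ} (hρ : PtrEq V ρ σ) :
    PtrEq V (G ρ) (G σ) := by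
  obtain ⟨c, Φ, hc, hΦ, hG⟩ := h
  have := hρ.lift (Function.Embedding.subtype _) Φ fun i => i.2
  intro y z hy hz
  simp only [hG, applyAt_eq_lift, Matrix.smul_apply, ← Finset.smul_sum]
  rw [this y z hy hz]

/-- This is what makes the reweighting caused by `G` agree on bisimilar configurations. -/
theorem External.trR_eq {V : Finset ℕ} (h : External V G) {ρ σ : Op ℕ} (hρ : PtrEq V ρ σ)
    (h1 : Op.IsPosTraceClass ρ) (h2 : Op.IsPosTraceClass σ) : trR (G ρ) = trR (G σ) :=
  congrArg Complex.re ((h.ptrEq hρ).tr_eq (h.map h1).2 (h.map h2).2)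

theorem External.comm (h : External V G) {n : ℕ} (r : Fin n ↪ ℕ) (hr : ∀ i, r i ∈ V)
    (Φ : Op (Fin n) →ₗ[ℂ] Op (Fin n)) (ρ : Op ℕ) : G (lift r Φ ρ) = lift r Φ (G ρ) := by
  obtain ⟨c, Ψ, hc, hΨ, hG⟩ := h
  rw [hG, hG, applyAt_eq_lift, applyAt_eq_lift, LinearMap.map_smul, lift_comm]
  intro i j hij
  exact j.2 (by rw [← show r i = (j : ℕ) from hij]; exact hr i)

end External

universe u v w
variable {S : Signature.{u, v, w}} {D : Equations S}

/-! ### Simulation of the moves of one configuration by another -/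

/-- The conditions of a bisimulation on one pair of configurations and on the transitions of the
first one. -/
def HalfSim (D : Equations S) (R : Config S → Config S → Prop) (C C' : Config S) : Prop :=
  (C.IsCon ∧ C'.IsCon ∧ C.proc.qv = C'.proc.qv ∧ PtrEq C.proc.qv C.state C'.state) ∧
  (∀ c q P', Step D C (.qin c q) (PMF.pure ⟨P', C.state⟩) →
    ∃ μ₁ ν, WeakStep D C' μ₁ ∧ LiftTrans (fun C => Step D C (.qin c q)) μ₁ ν ∧
      ∀ Φ : Op ↥(((P'.qv : Set ℕ) \ {q})ᶜ) →ₗ[ℂ] Op ↥(((P'.qv : Set ℕ) \ {q})ᶜ),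
        IsSuperOperator Φ → applyAt (Function.Embedding.subtype _) Φ C.state ≠ 0 →
        ∀ X ∈ ν.support,
          R ⟨P', applyAt (Function.Embedding.subtype _) Φ C.state⟩ (X.applyOn _ Φ)) ∧
  (∀ α P', α ≠ .tau → ¬ α.IsQIn → Step D C α (PMF.pure ⟨P', C.state⟩) →
    ∃ μ₁ ν₁ ν, WeakStep D C' μ₁ ∧ LiftTrans (fun C => Step D C α) μ₁ ν₁ ∧
      LiftTrans (WeakStep D) ν₁ ν ∧ ∀ X ∈ ν.support, R ⟨P', C.state⟩ X) ∧
  ∀ μ, Step D C .tau μ → ∃ ν, WeakStep D C' ν ∧ LiftRel R μ ν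

theorem HalfSim.mono {R T : Config S → Config S → Prop} {C C' : Config S} (h : HalfSim D R C C')
    (hRT : ∀ X Y, R X Y → T X Y) : HalfSim D T C C' := by
  obtain ⟨h1, h2, h3, h4⟩ := h
  refine ⟨h1, fun c q P' hs => ?_, fun α P' hα hq hs => ?_, fun μ hs => ?_⟩
  · obtain ⟨μ₁, ν, k1, k2, k3⟩ := h2 c q P' hs
    exact ⟨μ₁, ν, k1, k2, fun Φ hΦ h0 X hX => hRT _ _ (k3 Φ hΦ h0 X hX)⟩
  · obtain ⟨μ₁, ν₁, ν, k1, k2, k3, k4⟩ := h3 α P' hα hq hs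
    exact ⟨μ₁, ν₁, ν, k1, k2, k3, fun X hX => hRT _ _ (k4 X hX)⟩
  · obtain ⟨ν, k1, k2⟩ := h4 μ hs
    exact ⟨ν, k1, k2.mono hRT⟩

theorem hat_of_ne_tau {α : Act S} (h : α ≠ .tau) : α.hat = [α] := by
  cases α <;> first | exact absurd rfl h | rfl

theorem distQv_pure (C : Config S) : distQv (PMF.pure C) = (C.proc.qv : Set ℕ) := by
  simp [distQv]

theorem isQIn_iff {α : Act S} : α.IsQIn ↔ ∃ c r, α = .qin c r := by
  cases α <;> simp [Act.IsQIn]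

theorem relUnderSuperOps_pure {R : Config S → Config S → Prop} {C : Config S} {q : ℕ}
    {ν : PMF (Config S)} :
    RelUnderSuperOps R (distQv (PMF.pure C) \ {q}) (PMF.pure C) (PMF.pure C) ν ↔
      ∀ Φ : Op ↥(((C.proc.qv : Set ℕ) \ {q})ᶜ) →ₗ[ℂ] Op ↥(((C.proc.qv : Set ℕ) \ {q})ᶜ),
        IsSuperOperator Φ → applyAt (Function.Embedding.subtype _) Φ C.state ≠ 0 →
        ∀ X ∈ ν.support, R (C.applyOn _ Φ) (X.applyOn _ Φ) := by
  rw [distQv_pure]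
  unfold RelUnderSuperOps
  refine forall_congr' fun Φ => imp_congr_right fun _ => ?_
  simp only [PMF.mem_support_pure_iff, forall_eq]
  refine imp_congr Iff.rfl ?_
  rw [PMF.pure_map, liftRel_pure_left]
  simp only [PMF.mem_support_map_iff, forall_exists_index, and_imp, forall_apply_eq_imp_iff₂]

theorem IsBisimulation.halfSim {R : Config S → Config S → Prop} (h : IsBisimulation D R)
    {C C' : Config S} (hR : R C C') : HalfSim D R C C' := by
  obtain ⟨h1, h2, h3, h4, h5, h6, -⟩ := h C C' hR
  refine ⟨⟨h1, h2, h3, partialTrace_eq_iff.1 h4⟩, fun c q P' hs => ?_, fun α P' hα hq hs => ?_,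
    fun μ hs => ?_⟩
  · obtain ⟨ν, ⟨μ₁, k1, k2⟩, k3⟩ := h5 c q _ hs
    exact ⟨μ₁, ν, k1, k2, relUnderSuperOps_pure.1 k3⟩
  · obtain ⟨ν, k1, k2⟩ := h6 α _ hq hs
    rw [hat_of_ne_tau hα] at k1
    obtain ⟨μ₁, ν₁, k3, k4, k5⟩ := k1
    exact ⟨μ₁, ν₁, ν, liftTrans_pure.1 k3, k4, k5, liftRel_pure_left.1 k2⟩
  · obtain ⟨ν, k1, k2⟩ := h6 .tau μ (by simp [Act.IsQIn]) hs
    exact ⟨ν, liftTrans_pure.1 k1, k2⟩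

theorem relUnderSuperOps_symm {R : Config S → Config S → Prop} {V : Set ℕ}
    {κ μ ν : PMF (Config S)} (h : RelUnderSuperOps R V κ μ ν) :
    RelUnderSuperOps (fun X Y => R Y X) V κ ν μ :=
  fun Φ hΦ h0 => (h Φ hΦ h0).symm

/-- Visible transitions reach point distributions, so the clauses for general distributions reduce
to those of `HalfSim`; symmetry of `R` supplies the two reversed clauses. -/
theorem isBisimulation_of_halfSim {R : Config S → Config S → Prop}
    (hsymm : ∀ C C', R C C' → R C' C) (h : ∀ C C', R C C' → HalfSim D R C C') :
    IsBisimulation D R := by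
  have hR : (fun X Y => R Y X) = R := by
    ext X Y; exact ⟨hsymm _ _, hsymm _ _⟩
  have key : ∀ C C', R C C' →
      (∀ c q μ, Step D C (.qin c q) μ →
        ∃ ν, WeakThen D (.qin c q) C' ν ∧ RelUnderSuperOps R (distQv μ \ {q}) μ μ ν) ∧
      (∀ α μ, ¬ α.IsQIn → Step D C α μ →
        ∃ ν, WeakTrans D (PMF.pure C') α.hat ν ∧ LiftRel R μ ν) := by
    intro C C' hCC'
    obtain ⟨-, h2, h3, h4⟩ := h C C' hCC'
    refine ⟨fun c q μ hs => ?_, fun α μ hq hs => ?_⟩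
    · obtain ⟨P', rfl, -⟩ := hs.visible (by simp)
      obtain ⟨μ₁, ν, k1, k2, k3⟩ := h2 c q P' hs
      exact ⟨ν, ⟨μ₁, k1, k2⟩, relUnderSuperOps_pure.2 k3⟩
    · by_cases hα : α = .tau
      · subst hα
        obtain ⟨ν, k1, k2⟩ := h4 μ hs
        exact ⟨ν, liftTrans_pure.2 k1, k2⟩
      · obtain ⟨P', rfl, -⟩ := hs.visible hα
        obtain ⟨μ₁, ν₁, ν, k1, k2, k3, k4⟩ := h3 α P' hα hq hs
        refine ⟨ν, ?_, liftRel_pure_left.2 k4⟩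
        rw [hat_of_ne_tau hα]
        exact ⟨μ₁, ν₁, liftTrans_pure.2 k1, k2, k3⟩
  intro C C' hCC'
  obtain ⟨⟨h1, h2, h3, h4⟩, -⟩ := h C C' hCC'
  refine ⟨h1, h2, h3, partialTrace_eq_iff.2 h4, (key C C' hCC').1, (key C C' hCC').2,
    fun c q ν hs => ?_, fun α ν hq hs => ?_⟩
  · obtain ⟨μ, k1, k2⟩ := (key C' C (hsymm _ _ hCC')).1 c q ν hs
    exact ⟨μ, k1, hR ▸ relUnderSuperOps_symm k2⟩
  · obtain ⟨μ, k1, k2⟩ := (key C' C (hsymm _ _ hCC')).2 α ν hq hs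
    exact ⟨μ, k1, hR ▸ k2.symm⟩

theorem Bisimilar.symm {C C' : Config S} (h : Bisimilar D C C') : Bisimilar D C' C := by
  obtain ⟨R, hR, hCC'⟩ := h
  refine ⟨fun X Y => R Y X, fun X Y hXY => ?_, hCC'⟩
  obtain ⟨h1, h2, h3, h4, h5, h6, h7, h8⟩ := hR Y X hXY
  refine ⟨h2, h1, h3.symm, h3 ▸ h4.symm, fun c q μ hs => ?_, fun α μ hq hs => ?_,
    fun c q μ hs => ?_, fun α μ hq hs => ?_⟩
  · obtain ⟨ν, k1, k2⟩ := h7 c q μ hs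
    exact ⟨ν, k1, relUnderSuperOps_symm k2⟩
  · obtain ⟨ν, k1, k2⟩ := h8 α μ hq hs
    exact ⟨ν, k1, k2.symm⟩
  · obtain ⟨ν, k1, k2⟩ := h5 c q μ hs
    exact ⟨ν, k1, relUnderSuperOps_symm k2⟩
  · obtain ⟨ν, k1, k2⟩ := h6 α μ hq hs
    exact ⟨ν, k1, k2.symm⟩

/-- The clauses are monotone in the relation, so the union of all bisimulations satisfies them. -/
theorem Bisimilar.halfSim {C C' : Config S} (h : Bisimilar D C C') :
    HalfSim D (Bisimilar D) C C' := by
  obtain ⟨R, hR, hCC'⟩ := h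
  exact (hR.halfSim hCC').mono fun X Y hXY => ⟨R, hR, hXY⟩

theorem bisimilar_of_halfSim {R : Config S → Config S → Prop}
    (hsymm : ∀ C C', R C C' → R C' C) (h : ∀ C C', R C C' → HalfSim D R C C') {C C' : Config S}
    (hCC' : R C C') : Bisimilar D C C' :=
  ⟨R, isBisimulation_of_halfSim hsymm h, hCC'⟩

/-! ### Preservation of configurations -/

theorem Config.IsCon.pos {C : Config S} (h : C.IsCon) : Op.IsPosTraceClass C.state := h.2.2.1.1

theorem Config.IsCon.good {C : Config S} (h : C.IsCon) : C.proc.Good := ⟨h.1, h.2.1⟩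

theorem isCon_iff {C : Config S} : C.IsCon ↔ C.proc.Good ∧ Op.IsPosTraceClass C.state ∧
    trR C.state ≤ 1 ∧ 0 < trR C.state := by
  constructor
  · intro h
    exact ⟨h.good, h.pos, h.2.2.1.2, (trR_pos_iff h.pos).2 h.2.2.2⟩
  · rintro ⟨h1, h2, h3, h4⟩
    exact ⟨h1.1, h1.2, ⟨h2, h3⟩, (trR_pos_iff h2).1 h4⟩

/-! ### States after a measurement -/

section Measured

variable {n : ℕ} (M : Observable n) (r : Fin n ↪ ℕ) {ρ : Op ℕ} {t : ℝ}

theorem pos_collapse (hρ : Op.IsPosTraceClass ρ) : Op.IsPosTraceClass (lift r (M.collapse t) ρ) :=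
  ((M.isSuperOperator_collapse t).lift r).map hρ

theorem measProb_nonneg (hρ : Op.IsPosTraceClass ρ) : 0 ≤ measProb M r ρ t := by
  rw [measProb_eq M r hρ]
  exact div_nonneg (trR_nonneg (pos_collapse M r hρ)) (trR_nonneg hρ)

theorem measState_eq_real : measState M r ρ t =
    (((measProb M r ρ t)⁻¹ : ℝ) : ℂ) • lift r (M.collapse t) ρ := by
  rw [measState_eq, Complex.ofReal_inv]

theorem pos_measState (hρ : Op.IsPosTraceClass ρ) : Op.IsPosTraceClass (measState M r ρ t) := by
  rw [measState_eq_real]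
  exact (pos_collapse M r hρ).smul (inv_nonneg.2 (measProb_nonneg M r hρ))

theorem trR_measState (hρ : Op.IsPosTraceClass ρ) (h : measProb M r ρ t ≠ 0) :
    trR (measState M r ρ t) = trR ρ := by
  rw [measState_eq_real, trR_smul]
  rw [measProb_eq M r hρ] at h ⊢
  have h1 := (div_ne_zero_iff.1 h).1
  have h2 := (div_ne_zero_iff.1 h).2
  field_simp

end Measured

/-- Every transition preserves the trace of the state: the operations in the syntax are trace
preserving, and measured states are renormalized. -/
theorem Step.isCon {C : Config S} {α μ} (h : Step D C α μ) (hC : C.IsCon) :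
    ∀ C' ∈ μ.support, C'.IsCon := by
  intro C' hC'
  have hg := (h.reduces hC.good C' hC').1
  obtain ⟨-, hp, h1, h0⟩ := isCon_iff.1 hC
  rw [isCon_iff]
  refine ⟨hg, ?_⟩
  rcases h.form with ⟨P', rfl, -⟩ | ⟨rfl, ⟨n, E, r, P', -, rfl, -⟩ |
    ⟨n, M, r, P', w, -, hw, rfl, -⟩⟩
  · rw [PMF.mem_support_pure_iff] at hC'
    subst hC'
    exact ⟨hp, h1, h0⟩
  · rw [PMF.mem_support_pure_iff] at hC'
    subst hC'
    simp only [applyAt_eq_lift]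
    rw [trR_lift_of_tracePreserving r E.2.1 E.2.2 hp]
    exact ⟨(E.2.1.lift r).map hp, h1, h0⟩
  · obtain ⟨t, ht, rfl⟩ := (PMF.mem_support_map_iff ..).1 hC'
    have ht' : measProb M r C.state t ≠ 0 := fun h => by
      rw [PMF.mem_support_iff, hw, h] at ht
      simp at ht
    simp only [trR_measState M r hp ht']
    exact ⟨pos_measState M r hp, h1, h0⟩

theorem Step.qv_subset {C : Config S} {α μ} (h : Step D C α μ) (hC : C.IsCon) (hα : ¬ α.IsQIn) :
    ∀ C' ∈ μ.support, C'.proc.qv ⊆ C.proc.qv := by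
  intro C' hC'
  have hb := (h.reduces hC.good C' hC').2.1
  refine hb.trans ?_
  cases α <;> first | exact subset_rfl | exact Finset.erase_subset _ _ | exact absurd trivial hα

theorem WeakStep.isCon {C : Config S} {μ} (h : WeakStep D C μ) (hC : C.IsCon) :
    ∀ C' ∈ μ.support, C'.IsCon ∧ C'.proc.qv ⊆ C.proc.qv := by
  induction h with
  | refl C =>
    intro C' hC'
    rw [PMF.mem_support_pure_iff] at hC'
    subst hC'
    exact ⟨hC, subset_rfl⟩
  | @step C μ f h1 h2 ih =>
    intro C' hC'
    obtain ⟨X, hX, hC'⟩ := (PMF.mem_support_bind_iff ..).1 hC'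
    obtain ⟨k1, k2⟩ := ih X hX (h1.isCon hC X hX) C' hC'
    exact ⟨k1, k2.trans (h1.qv_subset hC (by simp [Act.IsQIn]) X hX)⟩

/-! ### Tilted distributions -/

/-- `c • μ'` is the image under `N` of the tilt of `μ` by `g`. -/
def Tilt {α : Type*} (N : α → α) (g : α → ENNReal) (c : ENNReal) (μ μ' : PMF α) : Prop :=
  ∀ h, c * expect μ' h = expect μ fun a => g a * h (N a)

theorem Tilt.support {α : Type*} {N : α → α} {g : α → ENNReal} {c : ENNReal} {μ μ' : PMF α}
    (h : Tilt N g c μ μ') (hc : c ≠ 0) {x : α} (hx : x ∈ μ'.support) :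
    ∃ a ∈ μ.support, g a ≠ 0 ∧ N a = x := by
  classical
  have h1 := h fun y => if y = x then 1 else 0
  rw [expect_ite_eq] at h1
  by_contra! hn
  have : expect μ (fun a => g a * if N a = x then 1 else 0) = 0 := by
    rw [expect_eq_zero_iff]
    intro a ha
    by_cases hg : g a = 0
    · simp [hg]
    · simp [hn a ha hg]
  rw [this] at h1
  exact (mul_ne_zero hc hx) h1

theorem Tilt.expect_eq {α : Type*} {N : α → α} {g : α → ENNReal} {c : ENNReal} {μ μ' : PMF α}
    (h : Tilt N g c μ μ') : expect μ g = c := by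
  have := h fun _ => 1
  simpa [expect_one] using this.symm

/-- The coupling is reweighted by the value of `g` at the first coordinate. Since `g` agrees on
related pairs, the second marginal is reweighted correctly as well; pairs of weight zero disappear,
so nothing is required of them. -/
theorem Tilt.liftRel {R T : Config S → Config S → Prop} {N : Config S → Config S}
    {g : Config S → ENNReal} {c : ENNReal} {μ μ' ν ν' : PMF (Config S)} (hμ : Tilt N g c μ μ')
    (hν : Tilt N g c ν ν') (hc : c ≠ 0) (hc' : c ≠ ⊤) (h : LiftRel R μ ν)
    (H : ∀ X ∈ μ.support, ∀ Y ∈ ν.support, R X Y → g X = g Y ∧ (g X ≠ 0 → T (N X) (N Y))) :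
    LiftRel T μ' ν' := by
  obtain ⟨π, hπ1, hπ2, hπR⟩ := h.exists_coupling
  have H' : ∀ p ∈ π.support, g p.1 = g p.2 ∧ (g p.1 ≠ 0 → T (N p.1) (N p.2)) := fun p hp =>
    H _ (by rw [← hπ1, PMF.mem_support_map_iff]; exact ⟨p, hp, rfl⟩)
      _ (by rw [← hπ2, PMF.mem_support_map_iff]; exact ⟨p, hp, rfl⟩) (hπR p hp)
  have hE : expect π (fun p => g p.1) = c := by
    rw [← expect_map π Prod.fst g, hπ1, hμ.expect_eq]
  obtain ⟨τ, hτ, hτs⟩ := exists_tilt π (fun p => g p.1) (hE ▸ hc) (hE ▸ hc')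
  rw [hE] at hτ
  have hcancel : ∀ a b : ENNReal, c * a = c * b → a = b := fun a b h =>
    (ENNReal.mul_right_inj hc hc').1 h
  refine liftRel_of_coupling (τ.map (Prod.map N N)) ?_ ?_ fun p hp => ?_
  · refine pmf_ext_expect fun h => hcancel _ _ ?_
    rw [PMF.map_comp, expect_map, hτ, hμ, ← hπ1, expect_map]
    rfl
  · refine pmf_ext_expect fun h => hcancel _ _ ?_
    rw [PMF.map_comp, expect_map, hτ, hν, ← hπ2, expect_map]
    refine expect_congr fun p hp => ?_
    rw [(H' p hp).1]
    rfl
  · obtain ⟨q, hq, rfl⟩ := (PMF.mem_support_map_iff ..).1 hp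
    exact (H' q (hτs q hq).1).2 (hτs q hq).2

/-! ### Applying an operation outside the quantum variables of a process -/

/-- Application of `G` and normalization of the trace to `c`. -/
def Config.nrm (G : Op ℕ → Op ℕ) (c : ℝ) (C : Config S) : Config S :=
  ⟨C.proc, ((c / trR (G C.state) : ℝ) : ℂ) • G C.state⟩

/-- The trace after the application of `G`. -/
def Config.wt (G : Op ℕ → Op ℕ) (C : Config S) : ENNReal := ENNReal.ofReal (trR (G C.state))

section Nrm

variable {V : Finset ℕ} {G : Op ℕ → Op ℕ} {c : ℝ}

theorem External.trR_pos {V : Set ℕ} (hG : External V G) {ρ : Op ℕ} (hρ : Op.IsPosTraceClass ρ)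
    (h : G ρ ≠ 0) : 0 < trR (G ρ) :=
  (trR_pos_iff (hG.map hρ)).2 h

theorem External.wt_ne_zero_iff {V : Set ℕ} (hG : External V G) {C : Config S}
    (hC : Op.IsPosTraceClass C.state) : C.wt G ≠ 0 ↔ G C.state ≠ 0 := by
  rw [Config.wt, ne_eq, ENNReal.ofReal_eq_zero, not_le, trR_pos_iff (hG.map hC)]

theorem trR_nrm {C : Config S} (h : trR (G C.state) ≠ 0) : trR (C.nrm G c).state = c := by
  rw [Config.nrm, trR_smul, div_mul_cancel₀ _ h]

theorem nrm_eq {C : Config S} (h : trR (G C.state) = c) (hc : c ≠ 0) :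
    C.nrm G c = ⟨C.proc, G C.state⟩ := by
  simp [Config.nrm, h, hc]

theorem tilt_pure {C C' : Config S} (h : trR (G C'.state) = trR (G C.state)) :
    Tilt (Config.nrm G c) (Config.wt G) (C.wt G) (PMF.pure C') (PMF.pure (C'.nrm G c)) := by
  intro k
  rw [expect_pure, expect_pure, Config.wt, Config.wt, h]

/-- The operation of the process commutes with `G` and preserves the trace, so the weight is
unchanged. -/
theorem trR_external_lift (hG : External V G) {n : ℕ} (r : Fin n ↪ ℕ) (hr : ∀ i, r i ∈ V)
    (E : TPSuperOperator n) {ρ : Op ℕ} (hρ : Op.IsPosTraceClass ρ) :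
    trR (G (applyAt r E.1 ρ)) = trR (G ρ) := by
  rw [applyAt_eq_lift, hG.comm r hr, trR_lift_of_tracePreserving r E.2.1 E.2.2 (hG.map hρ)]

theorem nrm_applyAt (hG : External V G) {n : ℕ} (r : Fin n ↪ ℕ) (hr : ∀ i, r i ∈ V)
    (E : TPSuperOperator n) {ρ : Op ℕ} (hρ : Op.IsPosTraceClass ρ) (P P' : Proc S) :
    (Config.mk P' (applyAt r E.1 ρ)).nrm G c =
      ⟨P', applyAt r E.1 ((Config.mk P ρ).nrm G c).state⟩ := by
  simp only [Config.nrm, trR_external_lift hG r hr E hρ]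
  rw [applyAt_eq_lift, applyAt_eq_lift, hG.comm r hr, LinearMap.map_smul]

/-! ### Measurements after an external operation -/

section Meas

variable {n : ℕ} (M : Observable n) (r : Fin n ↪ ℕ) {ρ : Op ℕ}

theorem measProb_nrm (hG : External V G) (hc : 0 < c) (hρ : Op.IsPosTraceClass ρ) (h0 : G ρ ≠ 0)
    (P : Proc S) (t : ℝ) : measProb M r ((Config.mk P ρ).nrm G c).state t =
      trR (lift r (M.collapse t) (G ρ)) / trR (G ρ) := by
  have hpos := hG.trR_pos hρ h0
  have hs : 0 < c / trR (G ρ) := div_pos hc hpos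
  simp only [Config.nrm]
  rw [measProb_eq M r ((hG.map hρ).smul hs.le), LinearMap.map_smul, trR_smul, trR_smul,
    mul_div_mul_left _ _ hs.ne']

theorem collapse_eq_zero (hρ : Op.IsPosTraceClass ρ) {t : ℝ} (h : measProb M r ρ t = 0) :
    lift r (M.collapse t) ρ = 0 := by
  rw [← trR_eq_zero_iff (pos_collapse M r hρ)]
  rw [measProb_eq M r hρ, div_eq_zero_iff] at h
  rcases h with h | h
  · exact h
  · rw [(trR_eq_zero_iff hρ).1 h, LinearMap.map_zero]
    simp [trR, Op.tr]

theorem external_measState (hG : External V G) (hr : ∀ i, r i ∈ V) (t : ℝ) :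
    G (measState M r ρ t) = (((measProb M r ρ t)⁻¹ : ℝ) : ℂ) • lift r (M.collapse t) (G ρ) := by
  rw [measState_eq_real, hG.map_smul, hG.comm r hr]

/-- Both sides are multiples of `E (G ρ) E`. When this operator is nonzero, both scalars normalize
its trace to `c`; when its trace is zero, both scalars are zero. -/
theorem nrm_measState (hG : External V G) (hr : ∀ i, r i ∈ V) (hc : 0 < c)
    (hρ : Op.IsPosTraceClass ρ) (h0 : G ρ ≠ 0) (P P' : Proc S) {t : ℝ}
    (hp : measProb M r ρ t ≠ 0) :
    (Config.mk P' (measState M r ρ t)).nrm G c =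
      ⟨P', measState M r ((Config.mk P ρ).nrm G c).state t⟩ := by
  have hpos := (hG.trR_pos hρ h0).ne'
  simp only [Config.nrm, external_measState M r hG hr, trR_smul]
  rw [measState_eq_real]
  have := measProb_nrm M r hG hc hρ h0 P t
  simp only [Config.nrm] at this
  rw [this, LinearMap.map_smul, smul_smul, smul_smul, ← Complex.ofReal_mul, ← Complex.ofReal_mul]
  congr 3
  by_cases hk : trR (lift r (M.collapse t) (G ρ)) = 0
  · simp [hk]
  · field_simp

/-- With `p_t`, `ρ_t` the outcomes at `ρ` and `p'_t` the probabilities after `G`, both `p_t tr(G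
ρ_t)` and `tr(G ρ) p'_t` equal `tr(E (G ρ) E)`. -/
theorem tilt_meas (hG : External V G) (hr : ∀ i, r i ∈ V) (hc : 0 < c)
    (hρ : Op.IsPosTraceClass ρ) (h0 : G ρ ≠ 0) (P : Proc S) (P' : ℝ → Proc S) {w w' : PMF ℝ}
    (hw : ∀ t, w t = ENNReal.ofReal (measProb M r ρ t))
    (hw' : ∀ t, w' t = ENNReal.ofReal (measProb M r ((Config.mk P ρ).nrm G c).state t)) :
    Tilt (Config.nrm G c) (Config.wt G) ((Config.mk P ρ).wt G)
      (w.map fun t => ⟨P' t, measState M r ρ t⟩)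
      (w'.map fun t => ⟨P' t, measState M r ((Config.mk P ρ).nrm G c).state t⟩) := by
  intro h
  have hpos := hG.trR_pos hρ h0
  rw [expect_map, expect_map, expect, expect, ← ENNReal.tsum_mul_left]
  refine tsum_congr fun t => ?_
  rw [hw, hw', measProb_nrm M r hG hc hρ h0, ← mul_assoc, ← mul_assoc, Config.wt, Config.wt,
    ← ENNReal.ofReal_mul hpos.le, ← ENNReal.ofReal_mul (measProb_nonneg M r hρ)]
  simp only [external_measState M r hG hr, trR_smul]
  rw [mul_div_cancel₀ _ hpos.ne']
  -- For an impossible outcome `measState` involves the inverse of zero and carries no meaning, but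
  -- both weights vanish.
  by_cases hp : measProb M r ρ t = 0
  · have : lift r (M.collapse t) (G ρ) = 0 := by
      rw [← hG.comm r hr, collapse_eq_zero M r hρ hp, hG.map_zero]
    simp [this, hp, trR, Op.tr]
  · rw [nrm_measState M r hG hr hc hρ h0 P (P' t) hp, mul_inv_cancel_left₀ hp]

/-- Different outcomes of a measurement remain different. -/
theorem measState_eq_of_nrm_eq (hG : External V G) (hr : ∀ i, r i ∈ V) (hc : 0 < c)
    (hρ : Op.IsPosTraceClass ρ) {P P' : Proc S} {s t : ℝ}
    (hs : G (measState M r ρ s) ≠ 0)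
    (h : (Config.mk P (measState M r ρ s)).nrm G c = (Config.mk P' (measState M r ρ t)).nrm G c) :
    s = t := by
  by_contra hst
  have h1 := (Config.mk.injEq .. ▸ h).2
  -- Projecting onto the outcome `s` fixes the left side and annihilates the right one.
  have h2 := congrArg (lift r (M.collapse s)) h1
  have hpos := hG.trR_pos (pos_measState M r hρ) hs
  simp only [LinearMap.map_smul] at h2
  rw [external_measState M r hG hr t, LinearMap.map_smul, lift_collapse_collapse, if_neg hst,
    smul_zero, smul_zero, external_measState M r hG hr s, LinearMap.map_smul,
    lift_collapse_collapse, if_pos rfl, ← external_measState M r hG hr s, smul_eq_zero] at h2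
  rcases h2 with h2 | h2
  · rw [Complex.ofReal_eq_zero] at h2
    exact (div_pos hc hpos).ne' h2
  · exact hs h2

end Meas

/-- Injectivity of the normalization on the surviving branches is recorded because a weak transition
must later choose one continuation per branch. -/
theorem Step.tilt (hG : External V G) (hc : 0 < c) {C : Config S} {μ} (h : Step D C .tau μ)
    (hC : C.IsCon) (hV : C.proc.qv ⊆ V) (h0 : G C.state ≠ 0) :
    ∃ μ', Step D (C.nrm G c) .tau μ' ∧ Tilt (Config.nrm G c) (Config.wt G) (C.wt G) μ μ' ∧
      Set.InjOn (Config.nrm G c) {X | X ∈ μ.support ∧ G X.state ≠ 0} := by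
  have hρ := hC.pos
  rcases h.form with ⟨P', rfl, H⟩ | ⟨-, ⟨n, E, r, P', hr, rfl, H⟩ |
    ⟨n, M, r, P', w, hr, hw, rfl, H⟩⟩
  · refine ⟨_, H _, tilt_pure rfl, fun X hX Y hY _ => ?_⟩
    rw [(PMF.mem_support_pure_iff ..).1 hX.1, (PMF.mem_support_pure_iff ..).1 hY.1]
  · refine ⟨_, H _, ?_, fun X hX Y hY _ => ?_⟩
    · have := tilt_pure (c := c) (C := C) (C' := ⟨P', applyAt r E.1 C.state⟩)
        (trR_external_lift hG r (fun i => hV (hr i)) E hρ)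
      rwa [nrm_applyAt hG r (fun i => hV (hr i)) E hρ C.proc] at this
    · rw [(PMF.mem_support_pure_iff ..).1 hX.1, (PMF.mem_support_pure_iff ..).1 hY.1]
  · have hpos := hG.trR_pos hρ h0
    have hn : trR (C.nrm G c).state = c := trR_nrm hpos.ne'
    have hn' : Op.IsPosTraceClass (C.nrm G c).state := (hG.map hρ).smul (div_pos hc hpos).le
    obtain ⟨w', hw'⟩ := exists_measPMF M r hn' ((trR_pos_iff hn').1 (hn.symm ▸ hc))
    refine ⟨_, H _ w' hw', tilt_meas M r hG (fun i => hV (hr i)) hc hρ h0 C.proc P' hw hw', ?_⟩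
    rintro X ⟨hX, hX0⟩ Y ⟨hY, hY0⟩ hXY
    obtain ⟨s, -, rfl⟩ := (PMF.mem_support_map_iff ..).1 hX
    obtain ⟨t, -, rfl⟩ := (PMF.mem_support_map_iff ..).1 hY
    rw [measState_eq_of_nrm_eq M r hG (fun i => hV (hr i)) hc hρ hX0 hXY]

/-- The move is replayed at the original state. Outcomes that `G` annihilates may appear there, but
they have weight zero. -/
theorem Step.tilt_rev (hG : External V G) (hc : 0 < c) {C : Config S} {μ'}
    (h : Step D (C.nrm G c) .tau μ') (hC : C.IsCon) (hV : C.proc.qv ⊆ V) (h0 : G C.state ≠ 0) :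
    ∃ μ, Step D C .tau μ ∧ Tilt (Config.nrm G c) (Config.wt G) (C.wt G) μ μ' := by
  have hρ := hC.pos
  rcases h.form with ⟨P', rfl, H⟩ | ⟨-, ⟨n, E, r, P', hr, rfl, H⟩ |
    ⟨n, M, r, P', w, hr, hw, rfl, H⟩⟩
  · exact ⟨_, H _, tilt_pure rfl⟩
  · refine ⟨_, H _, ?_⟩
    have := tilt_pure (c := c) (C := C) (C' := ⟨P', applyAt r E.1 C.state⟩)
      (trR_external_lift hG r (fun i => hV (hr i)) E hρ)
    rwa [nrm_applyAt hG r (fun i => hV (hr i)) E hρ C.proc] at this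
  · obtain ⟨w', hw'⟩ := exists_measPMF M r hρ hC.2.2.2
    exact ⟨_, H _ w' hw', tilt_meas M r hG (fun i => hV (hr i)) hc hρ h0 C.proc P' hw' hw⟩

theorem Step.external_eq_zero (hG : External V G) {C : Config S} {μ} (h : Step D C .tau μ)
    (hV : C.proc.qv ⊆ V) (h0 : G C.state = 0) : ∀ X ∈ μ.support, G X.state = 0 := by
  intro X hX
  rcases h.form with ⟨P', rfl, H⟩ | ⟨-, ⟨n, E, r, P', hr, rfl, H⟩ |
    ⟨n, M, r, P', w, hr, hw, rfl, H⟩⟩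
  · rw [(PMF.mem_support_pure_iff ..).1 hX]; exact h0
  · rw [(PMF.mem_support_pure_iff ..).1 hX]
    simp only [applyAt_eq_lift]
    rw [hG.comm r (fun i => hV (hr i)), h0, LinearMap.map_zero]
  · obtain ⟨s, -, rfl⟩ := (PMF.mem_support_map_iff ..).1 hX
    simp only
    rw [external_measState M r hG (fun i => hV (hr i)), h0, LinearMap.map_zero, smul_zero]

theorem WeakStep.external_eq_zero (hG : External V G) {C : Config S} {μ} (h : WeakStep D C μ)
    (hC : C.IsCon) (hV : C.proc.qv ⊆ V) (h0 : G C.state = 0) : ∀ X ∈ μ.support, G X.state = 0 := by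
  induction h with
  | refl C =>
    intro X hX
    rw [(PMF.mem_support_pure_iff ..).1 hX]; exact h0
  | @step C μ f h1 h2 ih =>
    intro X hX
    obtain ⟨Y, hY, hX⟩ := (PMF.mem_support_bind_iff ..).1 hX
    exact ih Y hY (h1.isCon hC Y hY)
      ((h1.qv_subset hC (by simp [Act.IsQIn]) Y hY).trans hV)
      (h1.external_eq_zero hG hV h0 Y hY) X hX

/-- Reweightings compose along a weak transition: the weight of an intermediate branch is the
normalizing constant of the tilt of its continuation. -/
theorem WeakStep.tilt (hG : External V G) (hc : 0 < c) {C : Config S} {μ} (h : WeakStep D C μ)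
    (hC : C.IsCon) (hV : C.proc.qv ⊆ V) (h0 : G C.state ≠ 0) :
    ∃ μ', WeakStep D (C.nrm G c) μ' ∧ Tilt (Config.nrm G c) (Config.wt G) (C.wt G) μ μ' := by
  induction h with
  | refl C => exact ⟨_, .refl _, tilt_pure rfl⟩
  | @step C μ f h1 h2 ih =>
    have hcon : ∀ X ∈ μ.support, X.IsCon ∧ X.proc.qv ⊆ V := fun X hX =>
      ⟨h1.isCon hC X hX, (h1.qv_subset hC (by simp [Act.IsQIn]) X hX).trans hV⟩
    obtain ⟨μ', k1, k2, k3⟩ := h1.tilt hG hc hC hV h0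
    have : ∀ X, ∃ κ, X ∈ μ.support → G X.state ≠ 0 → WeakStep D (X.nrm G c) κ ∧
        Tilt (Config.nrm G c) (Config.wt G) (X.wt G) (f X) κ := fun X => by
      by_cases hX : X ∈ μ.support ∧ G X.state ≠ 0
      · obtain ⟨κ, hκ⟩ := ih X hX.1 (hcon X hX.1).1 (hcon X hX.1).2 hX.2
        exact ⟨κ, fun _ _ => hκ⟩
      · exact ⟨PMF.pure X, fun h h' => (hX ⟨h, h'⟩).elim⟩
    choose κ hκ using this
    have : Nonempty (Config S) := ⟨C⟩
    -- A normalized branch must determine the branch it comes from in order to receive its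
    -- continuation; on `A` the normalization is injective.
    set A : Set (Config S) := {X | X ∈ μ.support ∧ G X.state ≠ 0} with hA
    have hinv : ∀ X ∈ A, Function.invFunOn (Config.nrm G c) A (X.nrm G c) = X :=
      fun X hX => k3.leftInvOn_invFunOn hX
    refine ⟨μ'.bind fun Y => κ (Function.invFunOn (Config.nrm G c) A Y), .step _ k1 ?_, ?_⟩
    · intro Y hY
      obtain ⟨X, hX, hX0, rfl⟩ := k2.support ((hG.wt_ne_zero_iff hC.pos).2 h0) hY
      have hXA : X ∈ A := ⟨hX, (hG.wt_ne_zero_iff (hcon X hX).1.pos).1 hX0⟩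
      rw [hinv X hXA]
      exact (hκ X hXA.1 hXA.2).1
    · intro h
      rw [expect_bind, expect_bind, k2]
      refine expect_congr fun X hX => ?_
      -- A branch annihilated by `G` has only annihilated descendants, so it contributes zero on
      -- both sides.
      by_cases hX0 : G X.state = 0
      · have e1 : X.wt G = 0 := by simp [Config.wt, hX0, trR, Op.tr]
        have e2 : expect (f X) (fun a => a.wt G * h (a.nrm G c)) = 0 := by
          rw [expect_eq_zero_iff]
          intro Y hY
          have := (h2 X hX).external_eq_zero hG (hcon X hX).1 (hcon X hX).2 hX0 Y hY
          simp [Config.wt, this, trR, Op.tr]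
        rw [e1, e2, zero_mul]
      · rw [hinv X ⟨hX, hX0⟩, (hκ X hX hX0).2]

/-- `μ'` lives on images of points of `μ`. -/
def ImgSub (G : Op ℕ → Op ℕ) (c : ℝ) (μ μ' : PMF (Config S)) : Prop :=
  ∀ Y ∈ μ'.support, ∃ X ∈ μ.support, G X.state ≠ 0 ∧ X.nrm G c = Y

/-- Only supports are followed here, so any preimage of a point may provide its continuation and
injectivity is not needed. This suffices for answers to visible actions. -/
theorem LiftTrans.imgSub {T U : Config S → PMF (Config S) → Prop} {μ ν μ' : PMF (Config S)}
    (h : LiftTrans T μ ν) (hμ : ImgSub G c μ μ')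
    (H : ∀ X κ, X ∈ μ.support → G X.state ≠ 0 → T X κ → ∃ κ', U (X.nrm G c) κ' ∧ ImgSub G c κ κ') :
    ∃ ν', LiftTrans U μ' ν' ∧ ImgSub G c ν ν' := by
  obtain ⟨f, hf, rfl⟩ := h
  have : ∀ Y, ∃ κ', Y ∈ μ'.support → U Y κ' ∧ ∃ X ∈ μ.support, ImgSub G c (f X) κ' := fun Y => by
    by_cases hY : Y ∈ μ'.support
    · obtain ⟨X, hX, h0, rfl⟩ := hμ Y hY
      obtain ⟨κ', k1, k2⟩ := H X _ hX h0 (hf X hX)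
      exact ⟨κ', fun _ => ⟨k1, X, hX, k2⟩⟩
    · exact ⟨PMF.pure Y, fun h => (hY h).elim⟩
  choose k hk using this
  refine ⟨_, ⟨k, fun Y hY => (hk Y hY).1, rfl⟩, fun Z hZ => ?_⟩
  obtain ⟨Y, hY, hZ⟩ := (PMF.mem_support_bind_iff ..).1 hZ
  obtain ⟨-, X, hX, hXk⟩ := hk Y hY
  obtain ⟨W, hW, hW0, rfl⟩ := hXk Z hZ
  exact ⟨W, (PMF.mem_support_bind_iff ..).2 ⟨X, hX, hW⟩, hW0, rfl⟩

theorem WeakStep.imgSub (hG : External V G) (hc : 0 < c) {C : Config S} {μ} (h : WeakStep D C μ)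
    (hC : C.IsCon) (hV : C.proc.qv ⊆ V) (h0 : G C.state ≠ 0) :
    ∃ μ', WeakStep D (C.nrm G c) μ' ∧ ImgSub G c μ μ' := by
  obtain ⟨μ', k1, k2⟩ := h.tilt hG hc hC hV h0
  refine ⟨μ', k1, fun Y hY => ?_⟩
  obtain ⟨X, hX, hX0, rfl⟩ := k2.support ((hG.wt_ne_zero_iff hC.pos).2 h0) hY
  exact ⟨X, hX, (hG.wt_ne_zero_iff (h.isCon hC X hX).1.pos).1 hX0, rfl⟩

theorem Step.imgSub {C : Config S} {α μ} (h : Step D C α μ) (hα : α ≠ .tau)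
    (h0 : G C.state ≠ 0) : ∃ μ', Step D (C.nrm G c) α μ' ∧ ImgSub G c μ μ' := by
  obtain ⟨P', rfl, H⟩ := h.visible hα
  refine ⟨_, H _, fun Y hY => ?_⟩
  rw [PMF.mem_support_pure_iff] at hY
  subst hY
  exact ⟨_, mem_pure_self _, h0, rfl⟩

end Nrm

/-! ### Bisimilarity and operations outside the processes -/

/-- The pairs obtained from bisimilar ones by an operation outside their quantum variables. -/
def ExtRel (D : Equations S) (X Y : Config S) : Prop :=
  ∃ C C' G, Bisimilar D C C' ∧ External (C.proc.qv : Set ℕ) G ∧ X = ⟨C.proc, G C.state⟩ ∧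
    Y = ⟨C'.proc, G C'.state⟩ ∧ trR (G C.state) ≤ 1 ∧ G C.state ≠ 0

theorem Bisimilar.trR_eq {C C' : Config S} (h : Bisimilar D C C') {V : Finset ℕ}
    {G : Op ℕ → Op ℕ} (hG : External V G) (hV : C.proc.qv ⊆ V) :
    trR (G C.state) = trR (G C'.state) := by
  obtain ⟨⟨h1, h2, h3, h4⟩, -⟩ := h.halfSim
  exact hG.trR_eq (h4.mono hV) h1.pos h2.pos

/-- Both states are normalized by the same factor, since `G` gives them equal traces; this factor is
absorbed into `G`. -/
theorem Bisimilar.extRel {C C' : Config S} (h : Bisimilar D C C') {V : Set ℕ}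
    {G : Op ℕ → Op ℕ} (hG : External V G) (hV : (C.proc.qv : Set ℕ) ⊆ V) {c : ℝ} (hc : 0 < c)
    (hc1 : c ≤ 1) (h0 : G C.state ≠ 0) : ExtRel D (C.nrm G c) (C'.nrm G c) := by
  obtain ⟨⟨h1, h2, h3, h4⟩, -⟩ := h.halfSim
  have hG' := hG.mono hV
  have hpos := hG.trR_pos h1.pos h0
  have hs := div_pos hc hpos
  refine ⟨C, C', _, h, hG'.smul hs, rfl, ?_, ?_, ?_⟩
  · simp only [Config.nrm, h.trR_eq hG' subset_rfl]
  · rw [trR_smul, div_mul_cancel₀ _ hpos.ne']; exact hc1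
  · exact smul_ne_zero (Complex.ofReal_ne_zero.2 hs.ne') h0

theorem ExtRel.symm {X Y : Config S} (h : ExtRel D X Y) : ExtRel D Y X := by
  obtain ⟨C, C', G, h1, hG, rfl, rfl, h2, h3⟩ := h
  obtain ⟨⟨k1, k2, k3, k4⟩, -⟩ := h1.halfSim
  have := h1.trR_eq hG subset_rfl
  refine ⟨C', C, G, h1.symm, k3 ▸ hG, rfl, rfl, this ▸ h2, ?_⟩
  rw [← trR_pos_iff (hG.map k2.pos), ← this]
  exact hG.trR_pos k1.pos h3

theorem ExtRel.isCon {X Y : Config S} (h : ExtRel D X Y) : X.IsCon := by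
  obtain ⟨C, C', G, h1, hG, rfl, rfl, h2, h3⟩ := h
  obtain ⟨⟨k1, -⟩, -⟩ := h1.halfSim
  exact isCon_iff.2 ⟨k1.good, hG.map k1.pos, h2, hG.trR_pos k1.pos h3⟩

/-- A move of `X` is pulled back to the original `C`, answered by `C'`, and the answer is pushed
forward to `Y`. -/
theorem ExtRel.halfSim {X Y : Config S} (h : ExtRel D X Y) : HalfSim D (ExtRel D) X Y := by
  have hX := h.isCon
  have hY := h.symm.isCon
  obtain ⟨C, C', G, h1, hG, rfl, rfl, h2, h3⟩ := h
  obtain ⟨⟨hC, hC', hqv, hptr⟩, hin, hvis, htau⟩ := h1.halfSim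
  have hc := hG.trR_pos hC.pos h3
  set c := trR (G C.state) with hcdef
  have hc' : trR (G C'.state) = c := (h1.trR_eq hG subset_rfl).symm
  have h3' : G C'.state ≠ 0 := by
    rw [← trR_pos_iff (hG.map hC'.pos), hc']; exact hc
  -- With `c` the common trace after `G`, normalization does nothing at the two starting
  -- configurations.
  have eX : C.nrm G c = ⟨C.proc, G C.state⟩ := nrm_eq rfl hc.ne'
  have eY : C'.nrm G c = ⟨C'.proc, G C'.state⟩ := nrm_eq hc' hc.ne'
  have hqv' : C'.proc.qv ⊆ C.proc.qv := hqv ▸ subset_rfl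
  refine ⟨⟨hX, hY, hqv, hG.ptrEq hptr⟩, fun ch q P' hs => ?_, fun α P' hα hq hs => ?_,
    fun μ hs => ?_⟩
  · have hs' : Step D C (.qin ch q) (PMF.pure ⟨P', C.state⟩) :=
      KeepForm.pure hs.form (by simp) _
    have hb := (hs'.reduces hC.good _ (mem_pure_self _)).2.1
    obtain ⟨μ₁, ν, k1, k2, k3⟩ := hin ch q P' hs'
    obtain ⟨μ₁', m1, m2⟩ := k1.imgSub hG hc hC' hqv' h3'
    obtain ⟨ν', m3, m4⟩ := k2.imgSub (U := fun C => Step D C (.qin ch q)) m2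
      fun X κ _ h0 hX => hX.imgSub (by simp) h0
    rw [eY] at m1
    refine ⟨μ₁', ν', m1, m3, fun Ψ hΨ hne Z' hZ' => ?_⟩
    obtain ⟨Z, hZ, hZ0, rfl⟩ := m4 Z' hZ'
    have hWV : ((P'.qv : Set ℕ) \ {q}) ⊆ C.proc.qv := by
      rintro x ⟨hx, hxq⟩
      exact (Finset.mem_insert.1 (hb hx)).resolve_left hxq
    -- Apart from the received qubit, the new process owns only qubits of the old one. Thus `G` is,
    -- up to a scalar, one of the super-operators allowed in the input clause, and so is its
    -- composite with `Ψ`.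
    obtain ⟨a, Φ, ha, hΦ, hGΦ⟩ := hG.mono hWV
    have ha0 : (a : ℂ) ≠ 0 := Complex.ofReal_ne_zero.2 ha.ne'
    have hcomp : ∀ τ, applyAt (Function.Embedding.subtype _) Ψ (G τ) =
        (a : ℂ) • applyAt (Function.Embedding.subtype _) (Ψ ∘ₗ Φ) τ := fun τ => by
      rw [hGΦ, applyAt_eq_lift, applyAt_eq_lift, applyAt_eq_lift, LinearMap.map_smul, lift_comp]
    have hne2 : applyAt (Function.Embedding.subtype _) (Ψ ∘ₗ Φ) C.state ≠ 0 := fun h => by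
      apply hne
      change applyAt (Function.Embedding.subtype _) Ψ (G C.state) = 0
      rw [hcomp, h, smul_zero]
    have hne1 : applyAt (Function.Embedding.subtype _) Φ C.state ≠ 0 := fun h => by
      apply h3
      rw [hGΦ, h, smul_zero]
    -- The input clause is used twice: with `Φ` alone it shows that `G Z.state` already has trace
    -- `c`, so that normalization is void; with `Ψ ∘ₗ Φ` it gives the required pair.
    have hb1 := k3 Φ hΦ hne1 Z hZ
    have hb2 := k3 (Ψ ∘ₗ Φ) (hΨ.comp hΦ) hne2 Z hZ
    have etr : trR (G Z.state) = c := by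
      have := hb1.trR_eq (V := P'.qv) (.smul_id _ ha) subset_rfl
      rw [hcdef, hGΦ, hGΦ]
      exact this.symm
    rw [nrm_eq etr hc.ne']
    refine ⟨_, _, _, hb2, .smul_id _ ha, ?_, ?_, ?_, ?_⟩
    · exact congrArg _ (hcomp C.state)
    · exact congrArg (Config.mk Z.proc) (hcomp Z.state)
    · change trR ((a : ℂ) • applyAt _ (Ψ ∘ₗ Φ) C.state) ≤ 1
      rw [← hcomp, applyAt_eq_lift]
      exact ((hΨ.lift _).trR_le (hG.map hC.pos)).trans h2
    · exact smul_ne_zero ha0 hne2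
  · have hs' : Step D C α (PMF.pure ⟨P', C.state⟩) := KeepForm.pure hs.form hα _
    have hsub := hs'.qv_subset hC hq _ (mem_pure_self _)
    obtain ⟨μ₁, ν₁, ν, k1, k2, k3, k4⟩ := hvis α P' hα hq hs'
    obtain ⟨μ₁', m1, m2⟩ := k1.imgSub hG hc hC' hqv' h3'
    obtain ⟨ν₁', m3, m4⟩ := k2.imgSub (U := fun C => Step D C α) m2
      fun X κ _ h0 hX => hX.imgSub hα h0
    have hgood : ∀ X ∈ ν₁.support, X.IsCon ∧ X.proc.qv ⊆ C.proc.qv := fun X hX => by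
      obtain ⟨f, hf, rfl⟩ := k2
      obtain ⟨Y, hY, hX⟩ := (PMF.mem_support_bind_iff ..).1 hX
      obtain ⟨l1, l2⟩ := k1.isCon hC' Y hY
      exact ⟨(hf Y hY).isCon l1 X hX, ((hf Y hY).qv_subset l1 hq X hX).trans (l2.trans hqv')⟩
    obtain ⟨ν', m5, m6⟩ := k3.imgSub (U := WeakStep D) m4
      fun X κ hX h0 hXκ => hXκ.imgSub hG hc (hgood X hX).1 (hgood X hX).2 h0
    rw [eY] at m1
    refine ⟨μ₁', ν₁', ν', m1, m3, m5, fun Z' hZ' => ?_⟩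
    obtain ⟨Z, hZ, hZ0, rfl⟩ := m6 Z' hZ'
    have := (k4 Z hZ).extRel hG hsub hc h2 h3
    rwa [nrm_eq (by rfl) hc.ne'] at this
  -- Here weights matter: the coupling of `μ'` and `ν` is tilted, the density being equal on matched
  -- pairs.
  · rw [← eX] at hs
    obtain ⟨μ', k1, k2⟩ := hs.tilt_rev hG hc hC subset_rfl h3
    obtain ⟨ν, k3, k4⟩ := htau μ' k1
    obtain ⟨ν', k5, k6⟩ := k3.tilt hG hc hC' hqv' h3'
    rw [eY] at k5
    refine ⟨ν', k5, ?_⟩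
    have ew : C.wt G = C'.wt G := by rw [Config.wt, Config.wt, hc', hcdef]
    rw [← ew] at k6
    refine k2.liftRel k6 ((hG.wt_ne_zero_iff hC.pos).2 h3) ENNReal.ofReal_ne_top k4
      fun X hX Y hY hXY => ?_
    have hXV := k1.qv_subset hC (by simp [Act.IsQIn]) X hX
    refine ⟨?_, fun h0 => ?_⟩
    · rw [Config.wt, Config.wt, hXY.trR_eq hG hXV]
    · exact hXY.extRel hG hXV hc h2 ((hG.wt_ne_zero_iff (k1.isCon hC X hX).pos).1 h0)

theorem ExtRel.bisimilar {X Y : Config S} (h : ExtRel D X Y) : Bisimilar D X Y :=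
  bisimilar_of_halfSim (fun _ _ => ExtRel.symm) (fun _ _ => ExtRel.halfSim) h

/-- Bisimilarity is preserved by operations outside the quantum variables of the processes. -/
theorem Bisimilar.external {P Q : Proc S} {ρ σ : Op ℕ} (h : Bisimilar D ⟨P, ρ⟩ ⟨Q, σ⟩)
    {G : Op ℕ → Op ℕ} (hG : External (P.qv : Set ℕ) G) (h1 : trR (G ρ) ≤ 1) (h0 : G ρ ≠ 0) :
    Bisimilar D ⟨P, G ρ⟩ ⟨Q, G σ⟩ :=
  ExtRel.bisimilar ⟨_, _, G, h, hG, rfl, rfl, h1, h0⟩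

theorem mapProc_injective {g : Proc S → Proc S} (hg : Function.Injective g) :
    Function.Injective (Config.mapProc g) := by
  rintro ⟨P, ρ⟩ ⟨Q, σ⟩ h
  simp only [Config.mapProc, Config.mk.injEq] at h
  rw [hg h.1, h.2]

theorem applyAt_id {ι : Type} (e : ι ↪ ℕ) (ρ : Op ℕ) : applyAt e LinearMap.id ρ = ρ := by
  rw [applyAt_eq_lift, lift_id]

theorem exists_extension_of_subset {V W : Set ℕ} (hWV : W ⊆ V)
    {Φ : Op ↥(Vᶜ) →ₗ[ℂ] Op ↥(Vᶜ)} (hΦ : IsSuperOperator Φ) :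
    ∃ Φ' : Op ↥(Wᶜ) →ₗ[ℂ] Op ↥(Wᶜ), IsSuperOperator Φ' ∧ ∀ ρ,
      applyAt (Function.Embedding.subtype _) Φ' ρ = applyAt (Function.Embedding.subtype _) Φ ρ :=
  hΦ.exists_extension _ fun i hi => i.2 (hWV hi)

/-! ### Relabeling and restriction -/

/-- Contexts that rename or block some of the actions preserve bisimilarity. -/
theorem bisimilar_context (g : Proc S → Proc S) (act : Act S → Act S → Prop)
    (hinj : Function.Injective g) (hqv : ∀ P, (g P).qv = P.qv) (hgood : ∀ P, P.Good → (g P).Good)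
    (hτ : act .tau .tau) (hact : ∀ β α, act β α → (α = .tau ↔ β = .tau) ∧ (α.IsQIn ↔ β.IsQIn))
    (hq : ∀ β c q, act β (.qin c q) → ∃ c', β = .qin c' q)
    (hinv : ∀ P ρ α μ, Step D ⟨g P, ρ⟩ α μ →
      ∃ β κ, act β α ∧ Step D ⟨P, ρ⟩ β κ ∧ μ = κ.map (Config.mapProc g))
    (hstep : ∀ P ρ β α κ, act β α → Step D ⟨P, ρ⟩ β κ →
      Step D ⟨g P, ρ⟩ α (κ.map (Config.mapProc g)))
    {C C' : Config S} (h : Bisimilar D C C') :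
    Bisimilar D (C.mapProc g) (C'.mapProc g) := by
  have hinj' := mapProc_injective hinj
  refine bisimilar_of_halfSim (R := fun X Y => ∃ C C', Bisimilar D C C' ∧ X = C.mapProc g ∧
    Y = C'.mapProc g) ?_ ?_ ⟨C, C', h, rfl, rfl⟩
  · rintro _ _ ⟨C, C', h, rfl, rfl⟩
    exact ⟨C', C, h.symm, rfl, rfl⟩
  rintro _ _ ⟨C, C', h, rfl, rfl⟩
  obtain ⟨⟨hC, hC', hqv', hptr⟩, hin, hvis, htau⟩ := h.halfSim
  have hcon : ∀ C : Config S, C.IsCon → (C.mapProc g).IsCon := fun C hC =>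
    isCon_iff.2 ⟨hgood _ hC.good, (isCon_iff.1 hC).2⟩
  have hweak : ∀ {C : Config S} {μ}, WeakStep D C μ →
      WeakStep D (C.mapProc g) (μ.map (Config.mapProc g)) := fun h =>
    h.map hinj' fun C μ hs => hstep _ _ _ _ _ hτ hs
  have hlift : ∀ {β α μ ν}, act β α → LiftTrans (fun C => Step D C β) μ ν →
      LiftTrans (fun C => Step D C α) (μ.map (Config.mapProc g)) (ν.map (Config.mapProc g)) :=
    fun ha h => h.map hinj' fun C κ _ hs => hstep _ _ _ _ _ ha hs
  have hpure : ∀ {β P' κ}, Step D C β κ → β ≠ .tau →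
      PMF.pure (Config.mk P' (C.mapProc g).state) = κ.map (Config.mapProc g) →
      ∃ P'', P' = g P'' ∧ Step D C β (PMF.pure ⟨P'', C.state⟩) := by
    intro β P' κ hs hβ he
    obtain ⟨P'', rfl, H⟩ := hs.visible hβ
    rw [PMF.pure_map] at he
    exact ⟨P'', (pure_mk_inj he).1, hs⟩
  refine ⟨⟨hcon _ hC, hcon _ hC', ?_, ?_⟩, fun c q P' hs => ?_, fun α P' hα hq' hs => ?_,
    fun μ hs => ?_⟩
  · simp only [Config.mapProc, hqv, hqv']
  · simp only [Config.mapProc, hqv]; exact hptr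
  · obtain ⟨β, κ, ha, hs, he⟩ := hinv _ _ _ _ hs
    obtain ⟨c', rfl⟩ := hq _ _ _ ha
    obtain ⟨P', rfl, hs'⟩ := hpure hs (by simp) he
    obtain ⟨μ₁, ν, k1, k2, k3⟩ := hin c' q P' hs'
    refine ⟨_, _, hweak k1, hlift ha k2, fun Φ hΦ h0 X hX => ?_⟩
    obtain ⟨X, hX', rfl⟩ := (PMF.mem_support_map_iff ..).1 hX
    -- The index sets of the two super-operators agree only through `hqv`; the extension serves as
    -- transport.
    obtain ⟨Φ', hΦ', he⟩ := exists_extension_of_subset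
      (W := (P'.qv : Set ℕ) \ {q}) (by rw [hqv]) hΦ
    refine ⟨_, _, k3 Φ' hΦ' (by rw [he]; exact h0) X hX', ?_, ?_⟩
    · simp only [Config.mapProc, he]
    · simp only [Config.mapProc, Config.applyOn, he]
  · obtain ⟨β, κ, ha, hs, he⟩ := hinv _ _ _ _ hs
    have hβ : β ≠ .tau := fun h => hα ((hact _ _ ha).1.2 h)
    obtain ⟨P', rfl, hs'⟩ := hpure hs hβ he
    obtain ⟨μ₁, ν₁, ν, k1, k2, k3, k4⟩ :=
      hvis β P' hβ (fun h => hq' ((hact _ _ ha).2.2 h)) hs'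
    refine ⟨_, _, _, hweak k1, hlift ha k2, k3.map hinj' fun C κ _ h => hweak h, fun X hX => ?_⟩
    obtain ⟨X, hX', rfl⟩ := (PMF.mem_support_map_iff ..).1 hX
    exact ⟨_, _, k4 X hX', rfl, rfl⟩
  · obtain ⟨β, κ, ha, hs, rfl⟩ := hinv _ _ _ _ hs
    obtain rfl := (hact _ _ ha).1.1 rfl
    obtain ⟨ν, k1, k2⟩ := htau κ hs
    exact ⟨_, hweak k1, liftRel_map k2 fun X _ Y _ hXY => ⟨X, Y, hXY, rfl, rfl⟩⟩

theorem Bisimilar.relabel {C C' : Config S} (h : Bisimilar D C C') (f : Relabeling S) :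
    Bisimilar D (C.mapProc fun P => .relabel P f) (C'.mapProc fun P => .relabel P f) := by
  refine bisimilar_context _ (fun β α => α = β.relabel f) (fun P Q h => (Proc.relabel.inj h).1)
    (fun P => rfl) (fun P h => h) rfl ?_ ?_ ?_ ?_ h
  · rintro β α rfl
    cases β <;> simp [Act.relabel, Act.IsQIn]
  · intro β c q h
    cases β <;> simp_all [Act.relabel]
  · intro P ρ α μ h
    cases h with
    | rel h => exact ⟨_, _, rfl, h, rfl⟩
  · rintro P ρ β α κ rfl h
    exact .rel h

theorem Bisimilar.restrict {C C' : Config S} (h : Bisimilar D C C') (L : Set S.Chan) :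
    Bisimilar D (C.mapProc fun P => .restrict P L) (C'.mapProc fun P => .restrict P L) := by
  refine bisimilar_context _ (fun β α => α = β ∧ Disjoint α.cn L)
    (fun P Q h => (Proc.restrict.inj h).1) (fun P => rfl) (fun P h => h) (by simp [Act.cn])
    ?_ ?_ ?_ ?_ h
  · rintro β α ⟨rfl, -⟩
    simp
  · rintro β c q ⟨rfl, -⟩
    exact ⟨c, rfl⟩
  · intro P ρ α μ h
    cases h with
    | res h hL => exact ⟨_, _, ⟨rfl, hL⟩, h, rfl⟩
  · rintro P ρ β α κ ⟨rfl, hL⟩ h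
    exact .res h hL

/-! ### Conditionals -/

/-- The guard disappears with the first transition, so `bisimilar_context`, which keeps the context
on the targets, does not apply. -/
theorem Bisimilar.cond {C C' : Config S} (h : Bisimilar D C C') {b : Exp Bool} (hb : b.vars = ∅) :
    Bisimilar D (C.mapProc (.cond b)) (C'.mapProc (.cond b)) := by
  have hcon : ∀ C : Config S, C.IsCon → (C.mapProc (.cond b)).IsCon := fun C hC =>
    isCon_iff.2 ⟨⟨hC.1, by simp [Config.mapProc, Proc.fv, hb, hC.2.1]⟩, (isCon_iff.1 hC).2⟩
  have hinv : ∀ {C : Config S} {α μ}, Step D (C.mapProc (.cond b)) α μ →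
      b.value = true ∧ Step D C α μ := fun h => by
    cases h with
    | cho h hb => exact ⟨hb, h⟩
  by_cases hv : b.value = true
  swap
  -- A false guard blocks all transitions, so only the static conditions remain.
  · refine bisimilar_of_halfSim (R := fun X Y => ∃ C C', Bisimilar D C C' ∧
      X = C.mapProc (.cond b) ∧ Y = C'.mapProc (.cond b)) ?_ ?_ ⟨C, C', h, rfl, rfl⟩
    · rintro _ _ ⟨C, C', h, rfl, rfl⟩
      exact ⟨C', C, h.symm, rfl, rfl⟩
    rintro _ _ ⟨C, C', h, rfl, rfl⟩
    obtain ⟨⟨hC, hC', hqv, hptr⟩, -⟩ := h.halfSim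
    exact ⟨⟨hcon _ hC, hcon _ hC', hqv, hptr⟩, fun c q P' hs => (hv (hinv hs).1).elim,
      fun α P' hα hq hs => (hv (hinv hs).1).elim, fun μ hs => (hv (hinv hs).1).elim⟩
  -- Under a true guard, each side may independently carry the guard or have lost it.
  let E : Config S → Config S → Prop := fun X C => X = C ∨ X = C.mapProc (.cond b)
  have hE1 : ∀ {X C : Config S}, E X C → X.proc.qv = C.proc.qv ∧ X.state = C.state := by
    rintro X C (rfl | rfl) <;> exact ⟨rfl, rfl⟩
  have hE2 : ∀ {X C : Config S}, E X C → C.IsCon → X.IsCon := by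
    rintro X C (rfl | rfl) hC
    · exact hC
    · exact hcon _ hC
  have hE3 : ∀ {X C : Config S} {α μ}, E X C → Step D X α μ → Step D C α μ := by
    rintro X C α μ (rfl | rfl) h
    · exact h
    · exact (hinv h).2
  have hE4 : ∀ {X C : Config S} {α μ}, E X C → Step D C α μ → Step D X α μ := by
    rintro X C α μ (rfl | rfl) h
    · exact h
    · exact .cho h hv
  -- The empty weak transition is the exception: it leaves the guard in place.
  have hE5 : ∀ {X C : Config S} {μ}, E X C → WeakStep D C μ → ∃ μ', WeakStep D X μ' ∧
      (μ' = μ ∨ (μ = PMF.pure C ∧ μ' = PMF.pure X)) := by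
    intro X C μ hX h
    cases h with
    | refl => exact ⟨_, .refl X, Or.inr ⟨rfl, rfl⟩⟩
    | step f h1 h2 => exact ⟨_, .step f (hE4 hX h1) h2, Or.inl rfl⟩
  have hE6 : ∀ {X C : Config S} {α μ₁ ν}, E X C → WeakStep D C μ₁ →
      LiftTrans (fun C => Step D C α) μ₁ ν → ∃ μ₁', WeakStep D X μ₁' ∧
        LiftTrans (fun C => Step D C α) μ₁' ν := by
    intro X C α μ₁ ν hX h1 h2
    obtain ⟨μ', k1, rfl | ⟨rfl, rfl⟩⟩ := hE5 hX h1
    · exact ⟨_, k1, h2⟩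
    · exact ⟨_, k1, liftTrans_pure.2 (hE4 hX (liftTrans_pure.1 h2))⟩
  refine bisimilar_of_halfSim (R := fun X Y => ∃ C C', Bisimilar D C C' ∧ E X C ∧ E Y C')
    ?_ ?_ ⟨C, C', h, Or.inr rfl, Or.inr rfl⟩
  · rintro _ _ ⟨C, C', h, hX, hY⟩
    exact ⟨C', C, h.symm, hY, hX⟩
  rintro X Y ⟨C, C', h, hX, hY⟩
  have hR : ∀ X Y, Bisimilar D X Y → ∃ C C', Bisimilar D C C' ∧ E X C ∧ E Y C' := fun X Y h =>
    ⟨X, Y, h, Or.inl rfl, Or.inl rfl⟩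
  obtain ⟨⟨hC, hC', hqv, hptr⟩, hin, hvis, htau⟩ := h.halfSim.mono hR
  obtain ⟨e1, e2⟩ := hE1 hX
  obtain ⟨e3, e4⟩ := hE1 hY
  refine ⟨⟨hE2 hX hC, hE2 hY hC', by rw [e1, e3, hqv], by rw [e1, e2, e4]; exact hptr⟩, ?_, ?_, ?_⟩
  · rw [e2]
    intro c q P' hs
    obtain ⟨μ₁, ν, k1, k2, k3⟩ := hin c q P' (hE3 hX hs)
    obtain ⟨μ₁', k1', k2'⟩ := hE6 hY k1 k2
    exact ⟨μ₁', ν, k1', k2', k3⟩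
  · rw [e2]
    intro α P' hα hq hs
    obtain ⟨μ₁, ν₁, ν, k1, k2, k3, k4⟩ := hvis α P' hα hq (hE3 hX hs)
    obtain ⟨μ₁', k1', k2'⟩ := hE6 hY k1 k2
    exact ⟨μ₁', ν₁, ν, k1', k2', k3, k4⟩
  · intro μ hs
    obtain ⟨ν, k1, k2⟩ := h.halfSim.2.2.2 μ (hE3 hX hs)
    obtain ⟨ν', k3, rfl | ⟨rfl, rfl⟩⟩ := hE5 hY k1
    · exact ⟨_, k3, k2.mono hR⟩
    · refine ⟨_, k3, ?_⟩
      have := liftRel_map (g := id) (k := fun _ => Y) k2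
        (T := fun X Y => ∃ C C', Bisimilar D C C' ∧ E X C ∧ E Y C') fun X _ Z hZ hXZ => by
          rw [PMF.mem_support_pure_iff] at hZ
          subst hZ
          exact ⟨X, Z, hXZ, Or.inl rfl, hY⟩
      rwa [PMF.pure_map, PMF.map_id] at this

/-! ### Parallel composition -/

theorem Step.com {P₁ P₂ P₁' P₂' : Proc S} {ρ : Op ℕ} {β γ : Act S} (h : Com β γ)
    (h₁ : Step D ⟨P₁, ρ⟩ β (PMF.pure ⟨P₁', ρ⟩)) (h₂ : Step D ⟨P₂, ρ⟩ γ (PMF.pure ⟨P₂', ρ⟩)) :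
    Step D ⟨.par P₁ P₂, ρ⟩ .tau (PMF.pure ⟨.par P₁' P₂', ρ⟩) := by
  rcases h with ⟨c, v, rfl, rfl⟩ | ⟨c, v, rfl, rfl⟩ | ⟨c, r, rfl, rfl⟩ | ⟨c, r, rfl, rfl⟩
  · exact .ccom_left h₁ h₂
  · exact .ccom_right h₁ h₂
  · exact .qcom_left h₁ h₂
  · exact .qcom_right h₁ h₂

theorem Com.ne_tau {β γ : Act S} (h : Com β γ) : β ≠ .tau ∧ γ ≠ .tau := by
  rcases h with ⟨c, v, rfl, rfl⟩ | ⟨c, v, rfl, rfl⟩ | ⟨c, r, rfl, rfl⟩ | ⟨c, r, rfl, rfl⟩ <;> simp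

theorem Step.par_inv {P₁ P₂ : Proc S} {ρ : Op ℕ} {α μ} (h : Step D ⟨.par P₁ P₂, ρ⟩ α μ) :
    (α = .tau ∧ ∃ β γ P₁' P₂', Com β γ ∧ Step D ⟨P₁, ρ⟩ β (PMF.pure ⟨P₁', ρ⟩) ∧
      Step D ⟨P₂, ρ⟩ γ (PMF.pure ⟨P₂', ρ⟩) ∧ μ = PMF.pure ⟨.par P₁' P₂', ρ⟩) ∨
    (∃ c r P₁', α = .qin c r ∧ Step D ⟨P₁, ρ⟩ (.qin c r) (PMF.pure ⟨P₁', ρ⟩) ∧ r ∉ P₂.qv ∧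
      μ = PMF.pure ⟨.par P₁' P₂, ρ⟩) ∨
    (∃ c r P₂', α = .qin c r ∧ Step D ⟨P₂, ρ⟩ (.qin c r) (PMF.pure ⟨P₂', ρ⟩) ∧ r ∉ P₁.qv ∧
      μ = PMF.pure ⟨.par P₁ P₂', ρ⟩) ∨
    (¬ α.IsQIn ∧ ∃ κ, Step D ⟨P₁, ρ⟩ α κ ∧ μ = κ.map (Config.mapProc fun P' => .par P' P₂)) ∨
    (¬ α.IsQIn ∧ ∃ κ, Step D ⟨P₂, ρ⟩ α κ ∧ μ = κ.map (Config.mapProc fun P' => .par P₁ P')) := by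
  cases h with
  | ccom_left h₁ h₂ | ccom_right h₁ h₂ | qcom_left h₁ h₂ | qcom_right h₁ h₂ =>
    exact Or.inl ⟨rfl, _, _, _, _, by simp [Com], h₁, h₂, rfl⟩
  | inp_int_left h hr => exact Or.inr (Or.inl ⟨_, _, _, rfl, h, hr, rfl⟩)
  | inp_int_right h hr => exact Or.inr (Or.inr (Or.inl ⟨_, _, _, rfl, h, hr, rfl⟩))
  | oth_int_left h hq => exact Or.inr (Or.inr (Or.inr (Or.inl ⟨hq, _, h, rfl⟩)))
  | oth_int_right h hq => exact Or.inr (Or.inr (Or.inr (Or.inr ⟨hq, _, h, rfl⟩)))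

theorem par_left_injective (R : Proc S) : Function.Injective fun P : Proc S => Proc.par P R :=
  fun _ _ h => (Proc.par.inj h).1

theorem WeakStep.par {C : Config S} {μ} (h : WeakStep D C μ) (R : Proc S) :
    WeakStep D (C.mapProc fun P => .par P R) (μ.map (Config.mapProc fun P => .par P R)) :=
  h.map (mapProc_injective (par_left_injective R)) fun _ _ hs =>
    .oth_int_left hs (by simp [Act.IsQIn])

theorem LiftTrans.par_weakStep {μ ν : PMF (Config S)} (h : LiftTrans (WeakStep D) μ ν)
    (R : Proc S) : LiftTrans (WeakStep D) (μ.map (Config.mapProc fun P => .par P R))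
      (ν.map (Config.mapProc fun P => .par P R)) :=
  h.map (mapProc_injective (par_left_injective R)) fun _ _ _ hs => hs.par R

/-- The answer may be spread over several states. The partner's visible move is independent of the
state, so it can synchronize in each of them. -/
theorem LiftTrans.par_com {μ ν : PMF (Config S)} {β γ : Act S} {R R' : Proc S}
    (h : LiftTrans (fun C => Step D C β) μ ν) (hβγ : Com β γ)
    (hR : ∀ σ, Step D ⟨R, σ⟩ γ (PMF.pure ⟨R', σ⟩)) :
    LiftTrans (WeakStep D) (μ.map (Config.mapProc fun P => .par P R))
      (ν.map (Config.mapProc fun P => .par P R')) :=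
  h.map (mapProc_injective (par_left_injective R)) fun C κ _ hs => by
    obtain ⟨P', rfl, H⟩ := hs.visible hβγ.ne_tau.1
    rw [PMF.pure_map]
    exact .single (.com hβγ (H _) (hR _))

theorem LiftTrans.par_of_not_isQIn {μ ν : PMF (Config S)} {α : Act S} (R : Proc S)
    (h : LiftTrans (fun C => Step D C α) μ ν) (hα : ¬ α.IsQIn) :
    LiftTrans (fun C => Step D C α) (μ.map (Config.mapProc fun P => .par P R))
      (ν.map (Config.mapProc fun P => .par P R)) :=
  h.map (mapProc_injective (par_left_injective R)) fun _ _ _ hs => .oth_int_left hs hα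

theorem LiftTrans.par_qin {μ ν : PMF (Config S)} {c : S.qChan} {r : ℕ} {R : Proc S}
    (h : LiftTrans (fun C => Step D C (.qin c r)) μ ν) (hr : r ∉ R.qv) :
    LiftTrans (fun C => Step D C (.qin c r)) (μ.map (Config.mapProc fun P => .par P R))
      (ν.map (Config.mapProc fun P => .par P R)) :=
  h.map (mapProc_injective (par_left_injective R)) fun C κ _ hs => by
    obtain ⟨P', rfl, H⟩ := hs.visible (by simp)
    rw [PMF.pure_map]
    exact .inp_int_left (H _) hr

/-- The identity super-operator and an empty final weak transition bring quantum inputs into the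
form of the other visible actions, so communications can be treated uniformly. -/
theorem Bisimilar.visible {C C' : Config S} (h : Bisimilar D C C') {α : Act S} {P' : Proc S}
    (hα : α ≠ .tau) (hs : Step D C α (PMF.pure ⟨P', C.state⟩)) :
    ∃ μ₁ ν₁ ν, WeakStep D C' μ₁ ∧ LiftTrans (fun C => Step D C α) μ₁ ν₁ ∧
      LiftTrans (WeakStep D) ν₁ ν ∧ ∀ X ∈ ν.support, Bisimilar D ⟨P', C.state⟩ X := by
  obtain ⟨⟨hC, -⟩, hin, hvis, -⟩ := h.halfSim
  by_cases hq : α.IsQIn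
  · obtain ⟨c, r, rfl⟩ := isQIn_iff.1 hq
    obtain ⟨μ₁, ν, k1, k2, k3⟩ := hin c r P' hs
    refine ⟨μ₁, ν, ν, k1, k2, ⟨PMF.pure, fun X _ => .refl X, (PMF.bind_pure ν).symm⟩,
      fun X hX => ?_⟩
    have := k3 LinearMap.id isSuperOperator_id (by rw [applyAt_id]; exact hC.2.2.2) X hX
    simpa only [Config.applyOn, applyAt_id] using this
  · exact hvis α P' hα hq hs

/-- Measurements outside the quantum variables of bisimilar processes. -/
theorem Bisimilar.measState {P Q : Proc S} {ρ σ : Op ℕ} (h : Bisimilar D ⟨P, ρ⟩ ⟨Q, σ⟩) {n : ℕ}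
    (M : Observable n) (r : Fin n ↪ ℕ) (hr : ∀ i, r i ∉ P.qv) (t : ℝ) :
    measProb M r σ t = measProb M r ρ t ∧ (measProb M r ρ t ≠ 0 →
      Bisimilar D ⟨P, measState M r ρ t⟩ ⟨Q, measState M r σ t⟩) := by
  obtain ⟨⟨hC, hC', hqv, hptr⟩, -⟩ := h.halfSim
  have hρ : Op.IsPosTraceClass ρ := hC.pos
  have hσ : Op.IsPosTraceClass σ := hC'.pos
  have hp : measProb M r σ t = measProb M r ρ t := by
    have h1 : trR ρ = trR σ := congrArg Complex.re (hptr.tr_eq hρ.2 hσ.2)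
    have h2 : trR (lift r (M.collapse t) ρ) = trR (lift r (M.collapse t) σ) :=
      congrArg Complex.re ((hptr.lift r (M.collapse t) hr).tr_eq
        (pos_collapse M r hρ).2 (pos_collapse M r hσ).2)
    rw [measProb_eq M r hρ, measProb_eq M r hσ, h1, h2]
  refine ⟨hp, fun h0 => ?_⟩
  -- Collapse and renormalization together are one external operation, with the same factor on both
  -- sides because the probabilities agree.
  have hpos : 0 < (measProb M r ρ t)⁻¹ :=
    inv_pos.2 (lt_of_le_of_ne (measProb_nonneg M r hρ) h0.symm)
  have hG := External.of_embedding (V := P.qv) (M.isSuperOperator_collapse t) r hr hpos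
  have e1 : QCCS.measState M r ρ t =
      (((measProb M r ρ t)⁻¹ : ℝ) : ℂ) • applyAt r (M.collapse t) ρ := by
    rw [measState_eq_real, applyAt_eq_lift]
  have e2 : QCCS.measState M r σ t =
      (((measProb M r ρ t)⁻¹ : ℝ) : ℂ) • applyAt r (M.collapse t) σ := by
    rw [measState_eq_real, applyAt_eq_lift, hp]
  have htr := trR_measState M r hρ h0
  rw [e1, e2]
  refine h.external hG ?_ ?_
  · rw [← e1, htr]; exact hC.2.2.1.2
  · rw [← e1, ← trR_pos_iff (pos_measState M r hρ), htr]; exact (trR_pos_iff hρ).2 hC.2.2.2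

/-- The pairs obtained from bisimilar ones by parallel composition with the same process. -/
def ParRel (D : Equations S) (X Y : Config S) : Prop :=
  ∃ P Q ρ σ R, Bisimilar D ⟨P, ρ⟩ ⟨Q, σ⟩ ∧ R.Good ∧ Disjoint P.qv R.qv ∧
    X = ⟨.par P R, ρ⟩ ∧ Y = ⟨.par Q R, σ⟩

theorem ParRel.symm {X Y : Config S} (h : ParRel D X Y) : ParRel D Y X := by
  obtain ⟨P, Q, ρ, σ, R, h, hR, hd, rfl, rfl⟩ := h
  have hqv : P.qv = Q.qv := h.halfSim.1.2.2.1
  exact ⟨Q, P, σ, ρ, R, h.symm, hR, hqv ▸ hd, rfl, rfl⟩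

theorem ParRel.isCon {X Y : Config S} (h : ParRel D X Y) : X.IsCon := by
  obtain ⟨P, Q, ρ, σ, R, h, hR, hd, rfl, rfl⟩ := h
  have hC := h.halfSim.1.1
  exact isCon_iff.2 ⟨Proc.good_par.2 ⟨hd, hC.good, hR⟩, (isCon_iff.1 hC).2⟩

/-- Silent moves of the process with which bisimilar processes are composed. -/
theorem ParRel.tau_right {P Q R : Proc S} {ρ σ : Op ℕ} (h : Bisimilar D ⟨P, ρ⟩ ⟨Q, σ⟩)
    (hR : R.Good) (hd : Disjoint P.qv R.qv) {κ : PMF (Config S)} (hs : Step D ⟨R, ρ⟩ .tau κ) :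
    ∃ κ', Step D ⟨R, σ⟩ .tau κ' ∧ LiftRel (ParRel D)
      (κ.map (Config.mapProc fun R' => .par P R'))
      (κ'.map (Config.mapProc fun R' => .par Q R')) := by
  obtain ⟨⟨hC, hC', hqv, hptr⟩, -⟩ := h.halfSim
  have hRcon : (Config.mk R ρ).IsCon := isCon_iff.2 ⟨hR, (isCon_iff.1 hC).2⟩
  have hR' : ∀ X ∈ κ.support, X.proc.Good ∧ Disjoint P.qv X.proc.qv := fun X hX =>
    ⟨(hs.isCon hRcon X hX).good,
      Finset.disjoint_of_subset_right (hs.qv_subset hRcon (by simp [Act.IsQIn]) X hX) hd⟩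
  rcases hs.form with ⟨R', rfl, H⟩ | ⟨-, ⟨n, E, r, R', hr, rfl, H⟩ |
    ⟨n, M, r, R', w, hr, hw, rfl, H⟩⟩
  · refine ⟨_, H σ, ?_⟩
    obtain ⟨h1, h2⟩ := hR' _ (mem_pure_self _)
    rw [PMF.pure_map, PMF.pure_map, liftRel_pure_left]
    simp only [PMF.mem_support_pure_iff, forall_eq]
    exact ⟨P, Q, ρ, σ, R', h, h1, h2, rfl, rfl⟩
  · refine ⟨_, H σ, ?_⟩
    obtain ⟨h1, h2⟩ := hR' _ (mem_pure_self _)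
    rw [PMF.pure_map, PMF.pure_map, liftRel_pure_left]
    simp only [PMF.mem_support_pure_iff, forall_eq]
    have hrP : ∀ i, r i ∉ P.qv := fun i => Finset.disjoint_right.1 hd (hr i)
    have hG := External.of_embedding (V := P.qv) E.2.1 r hrP one_pos
    simp only [Complex.ofReal_one, one_smul] at hG
    have hX := isCon_iff.1 (hs.isCon hRcon _ (mem_pure_self _))
    exact ⟨P, Q, _, _, R', h.external hG hX.2.2.1 ((trR_pos_iff hX.2.1).1 hX.2.2.2), h1, h2,
      rfl, rfl⟩
  · have hrP : ∀ i, r i ∉ P.qv := fun i => Finset.disjoint_right.1 hd (hr i)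
    have hm := h.measState M r hrP
    -- Equal probabilities allow the same outcome distribution `w` at `σ`; the coupling pairs equal
    -- outcomes.
    refine ⟨_, H σ w fun t => by rw [hw, (hm t).1], ?_⟩
    refine liftRel_of_coupling (w.map fun t => (⟨.par P (R' t), QCCS.measState M r ρ t⟩,
      ⟨.par Q (R' t), QCCS.measState M r σ t⟩)) ?_ ?_ fun p hp => ?_
    · rw [PMF.map_comp, PMF.map_comp]; rfl
    · rw [PMF.map_comp, PMF.map_comp]; rfl
    · obtain ⟨t, ht, rfl⟩ := (PMF.mem_support_map_iff ..).1 hp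
      obtain ⟨h1, h2⟩ := hR' ⟨R' t, _⟩ ((PMF.mem_support_map_iff ..).2 ⟨t, ht, rfl⟩)
      have ht' : measProb M r ρ t ≠ 0 := fun h => by
        rw [PMF.mem_support_iff, hw] at ht
        simp [h] at ht
      exact ⟨P, Q, _, _, R' t, (hm t).2 ht', h1, h2, rfl, rfl⟩

/-- The moves are classified by `Step.par_inv`: those of the left component and communications use
the answers of `Q`, while a move of `R` alone is repeated beside `Q`. -/
theorem ParRel.halfSim {X Y : Config S} (h : ParRel D X Y) : HalfSim D (ParRel D) X Y := by
  have hX := h.isCon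
  have hY := h.symm.isCon
  obtain ⟨P, Q, ρ, σ, R, h, hR, hd, rfl, rfl⟩ := h
  obtain ⟨⟨hC, hC', hqv, hptr⟩, hin, hvis, htau⟩ := h.halfSim
  simp only at hqv hptr
  have hRcon : (Config.mk R ρ).IsCon := isCon_iff.2 ⟨hR, (isCon_iff.1 hC).2⟩
  refine ⟨⟨hX, hY, by simp only [Proc.qv, hqv], hptr.mono Finset.subset_union_left⟩,
    fun c q P₀ hs => ?_, fun α P₀ hα hq hs => ?_, fun μ hs => ?_⟩
  · rcases hs.par_inv with ⟨h0, -⟩ | ⟨c', r, P', hα, hs', hr, he⟩ | ⟨c', r, R', hα, hs', hr, he⟩ |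
      ⟨hq, -⟩ | ⟨hq, -⟩
    · simp at h0
    · obtain ⟨rfl, rfl⟩ := (Act.qin.injEq ..).mp hα
      obtain rfl := (pure_mk_inj he).1
      obtain ⟨μ₁, ν, k1, k2, k3⟩ := hin c q P' hs'
      refine ⟨_, _, k1.par R, k2.par_qin hr, fun Φ hΦ h0 Z hZ => ?_⟩
      obtain ⟨Z, hZ', rfl⟩ := (PMF.mem_support_map_iff ..).1 hZ
      -- A super-operator that spares the qubits of `R` as well is in particular admissible for `P'`
      -- alone.
      obtain ⟨Φ', hΦ', he⟩ := exists_extension_of_subset (W := (P'.qv : Set ℕ) \ {q})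
        (Set.sdiff_subset_sdiff_left (by simp [Proc.qv])) hΦ
      have hb := k3 Φ' hΦ' (by rw [he]; exact h0) Z hZ'
      have hsub := (hs'.reduces hC.good _ (mem_pure_self _)).2.1
      refine ⟨_, _, _, _, R, hb, hR, ?_, ?_, ?_⟩
      · refine Finset.disjoint_of_subset_left hsub ?_
        simp only [Act.bound, Finset.disjoint_insert_left]
        exact ⟨hr, hd⟩
      · simp only [he]
      · simp only [Config.applyOn, Config.mapProc, he]
    · obtain ⟨rfl, rfl⟩ := (Act.qin.injEq ..).mp hα
      obtain rfl := (pure_mk_inj he).1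
      have hs₂ : Step D ⟨R, σ⟩ (.qin c q) (PMF.pure ⟨R', σ⟩) :=
        KeepForm.pure hs'.form (by simp) σ
      refine ⟨_, _, .refl _, liftTrans_pure.2 (.inp_int_right hs₂ (hqv ▸ hr)),
        fun Φ hΦ h0 Z hZ => ?_⟩
      rw [PMF.mem_support_pure_iff] at hZ
      subst hZ
      -- The qubit received by `R` is not one of `P`, so `Φ` acts entirely outside `P` and closure
      -- under external operations applies.
      have hPV : (P.qv : Set ℕ) ⊆ ((Proc.par P R').qv : Set ℕ) \ {q} := fun x hx =>
        ⟨Finset.mem_union_left _ hx, fun hxq => hr (hxq ▸ hx)⟩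
      have hG : External (P.qv : Set ℕ) fun τ => applyAt (Function.Embedding.subtype _) Φ τ :=
        External.mono ⟨1, Φ, one_pos, hΦ, fun τ => by simp⟩ hPV
      have htr : trR (applyAt (Function.Embedding.subtype _) Φ ρ) ≤ 1 := by
        rw [applyAt_eq_lift]
        exact ((hΦ.lift _).trR_le hC.pos).trans hC.2.2.1.2
      obtain ⟨h1, h2, -⟩ := hs'.reduces hR _ (mem_pure_self _)
      refine ⟨P, Q, _, _, R', h.external hG htr h0, h1, ?_, rfl, rfl⟩
      refine Finset.disjoint_of_subset_right h2 ?_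
      simp only [Act.bound, Finset.disjoint_insert_right]
      exact ⟨hr, hd⟩
    · exact (hq trivial).elim
    · exact (hq trivial).elim
  · rcases hs.par_inv with ⟨h0, -⟩ | ⟨c', r, P', rfl, -⟩ | ⟨c', r, R', rfl, -⟩ |
      ⟨-, κ, hs', he⟩ | ⟨-, κ, hs', he⟩
    · exact (hα h0).elim
    · exact (hq trivial).elim
    · exact (hq trivial).elim
    · obtain ⟨P', rfl, -⟩ := hs'.visible hα
      rw [PMF.pure_map] at he
      obtain rfl := (pure_mk_inj he).1
      obtain ⟨μ₁, ν₁, ν, k1, k2, k3, k4⟩ := hvis α P' hα hq hs'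
      refine ⟨_, _, _, k1.par R, k2.par_of_not_isQIn R hq, k3.par_weakStep R, fun Z hZ => ?_⟩
      obtain ⟨Z, hZ', rfl⟩ := (PMF.mem_support_map_iff ..).1 hZ
      exact ⟨_, _, _, _, R, k4 Z hZ', hR, Finset.disjoint_of_subset_left
        (hs'.qv_subset hC hq _ (mem_pure_self _)) hd, rfl, rfl⟩
    · obtain ⟨R', rfl, H⟩ := hs'.visible hα
      rw [PMF.pure_map] at he
      obtain rfl := (pure_mk_inj he).1
      have hs₂ := Step.oth_int_right (P₁ := Q) (H σ) hq
      rw [PMF.pure_map] at hs₂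
      refine ⟨_, _, _, .refl _, liftTrans_pure.2 hs₂, liftTrans_pure.2 (.refl _), fun Z hZ => ?_⟩
      rw [PMF.mem_support_pure_iff] at hZ
      subst hZ
      exact ⟨P, Q, ρ, σ, R', h, (hs'.isCon hRcon _ (mem_pure_self _)).good,
        Finset.disjoint_of_subset_right (hs'.qv_subset hRcon hq _ (mem_pure_self _)) hd, rfl, rfl⟩
  · rcases hs.par_inv with ⟨-, β, γ, P', R', hβγ, hs₁, hs₂, rfl⟩ | ⟨c', r, P', h0, -⟩ |
      ⟨c', r, R', h0, -⟩ | ⟨-, κ, hs', rfl⟩ | ⟨-, κ, hs', rfl⟩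
    -- A transferred qubit may change owner; subject reduction for the whole composition supplies
    -- the disjointness of `P'` and `R'`.
    · have hred := (hs₁.reduces hC.good _ (mem_pure_self _)).par_com
        (hs₂.reduces hR _ (mem_pure_self _)) hX.good hβγ
      obtain ⟨h1, -, h3⟩ := Proc.good_par.1 hred.1
      obtain ⟨μ₁, ν₁, ν, k1, k2, k3, k4⟩ := h.visible hβγ.ne_tau.1 hs₁
      refine ⟨_, ((k1.par R).trans_lift (k2.par_com hβγ
        (KeepForm.pure hs₂.form hβγ.ne_tau.2))).trans_lift (k3.par_weakStep R'), ?_⟩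
      rw [liftRel_pure_left]
      intro Z hZ
      obtain ⟨Z, hZ', rfl⟩ := (PMF.mem_support_map_iff ..).1 hZ
      exact ⟨_, _, _, _, R', k4 Z hZ', h3, h1, rfl, rfl⟩
    · simp at h0
    · simp at h0
    · obtain ⟨ν, k1, k2⟩ := htau κ hs'
      refine ⟨_, k1.par R, liftRel_map k2 fun Z hZ W hW hZW => ?_⟩
      exact ⟨_, _, _, _, R, hZW, hR, Finset.disjoint_of_subset_left
        (hs'.qv_subset hC (by simp [Act.IsQIn]) Z hZ) hd, rfl, rfl⟩
    · obtain ⟨κ', k1, k2⟩ := ParRel.tau_right h hR hd hs'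
      exact ⟨_, .single (.oth_int_right k1 (by simp [Act.IsQIn])), k2⟩

theorem Bisimilar.par {P Q R : Proc S} {ρ σ : Op ℕ} (h : Bisimilar D ⟨P, ρ⟩ ⟨Q, σ⟩)
    (hR : R.Good) (hd : Disjoint P.qv R.qv) :
    Bisimilar D ⟨.par P R, ρ⟩ ⟨.par Q R, σ⟩ :=
  bisimilar_of_halfSim (fun _ _ => ParRel.symm) (fun _ _ => ParRel.halfSim)
    ⟨P, Q, ρ, σ, R, h, hR, hd, rfl, rfl⟩

end QCCS

end

/-! ### The congruence theorem -/

theorem mainTheorem1 {S : QCCS.Signature} (D : QCCS.Equations S) (P Q : QCCS.Proc S)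
    (ρ σ : QCCS.Op ℕ) (h : QCCS.Bisimilar D ⟨P, ρ⟩ ⟨Q, σ⟩) :
    (∀ R : QCCS.Proc S, R.Valid → R.fv = ∅ → Disjoint P.qv R.qv →
      QCCS.Bisimilar D ⟨.par P R, ρ⟩ ⟨.par Q R, σ⟩) ∧
    (∀ f : QCCS.Relabeling S,
      QCCS.Bisimilar D ⟨.relabel P f, ρ⟩ ⟨.relabel Q f, σ⟩) ∧
    (∀ L : Set S.Chan,
      QCCS.Bisimilar D ⟨.restrict P L, ρ⟩ ⟨.restrict Q L, σ⟩) ∧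
    (∀ b : QCCS.Exp Bool, b.vars = ∅ →
      QCCS.Bisimilar D ⟨.cond b P, ρ⟩ ⟨.cond b Q, σ⟩) :=
  ⟨fun _ hv hf hd => h.par ⟨hv, hf⟩ hd, fun f => h.relabel f, fun L => h.restrict L,
    fun _ hb => h.cond hb⟩
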